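/- Let $R$ be a commutative ring and let $C$ be a semidualizing $R$-module: $C$ has a (possibly unbounded) resolution by free modules of finite rank, the homothety map $R\to\operatorname{Hom}_R(C,C)$ is an isomorphism, and $\operatorname{Ext}^n_R(C,C)=0$ for all $n\ge 1$. Complexes are indexed cohomologically, and all classes of modules are closed under isomorphism. Definitions. Let $\mathcal I_C$ be the class of modules isomorphic to $\operatorname{Hom}_R(C,I)$ with $I$ injective. For a class $\mathcal V$, a complex $W$ of modules in $\mathcal V$ is *totally $\mathcal V$-acyclic* if $W$, $\operatorname{Hom}_R(X,W)$ and $\operatorname{Hom}_R(W,X)$ are exact for every $X\in\mathcal V$. The class $\mathcal G(\mathcal V)$ consists of the modules isomorphic to $\operatorname{Coker}(W^{-1}\to W^0)$ for some totally $\mathcal V$-acyclic $W$. A *$\mathcal V$-coresolution* of $N$ is an exact sequence $0\to N\to V^0\to V^1\to\cdots$ with all $V^i\in\mathcal V$; it is *proper* if it stays exact under $\operatorname{Hom}_R(-,X)$ for every $X\in\mathcal V$. The dimension $\mathcal V\text{-}\mathrm{id}_R(N)$ is the infimum, over all $\mathcal V$-coresolutions $V$ of $N$, of $\sup\{n\ge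 0: V^n\ne 0\}$. A *Tate $\mathcal V$-coresolution* $N\to V\xrightarrow{\beta}S$ consists of a proper $\mathcal V$-coresolution $N\to V$, a totally $\mathcal V$-acyclic complex $S$, and a chain map $\beta$ such that $\beta^n$ is an isomorphism for all $n\gg 0$. Given a proper $\mathcal G(\mathcal I_C)$-coresolution $N\to Y$, a Tate $\mathcal I_C$-coresolution $N\to V\xrightarrow{\beta}S$ and a chain map $\kappa:Y\to V$ lifting $\mathrm{id}_N$, put for each module $M$ $$\operatorname{Ext}^n_{\mathcal G(\mathcal I_C)}(M,N)=H^n(\operatorname{Hom}_R(M,Y)),\quad \operatorname{Ext}^n_{\mathcal I_C}(M,N)=H^n(\operatorname{Hom}_R(M,V)),\quad \widehat{\operatorname{Ext}}{}^n_{\mathcal I_C}(M,N)=H^n(\operatorname{Hom}_R(M,S)),$$ and let $\vartheta^n=H^n(\operatorname{Hom}_R(M,\kappa))$ and $\varepsilon^n=H^n(\operatorname{Hom}_R(M,\beta))$ be the comparison maps $\operatorname{Ext}^n_{\mathcal G(\mathcal I_C)}(M,N)\to\operatorname{Ext}^n_{\mathcal I_C}(M,N)$ and $\operatorname{Ext}^n_{\mathcal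 I_C}(M,N)\to\widehat{\operatorname{Ext}}{}^n_{\mathcal I_C}(M,N)$. A homomorphism $f:M\to M'$ acts on these modules through $\operatorname{Hom}_R(f,-)$. A homomorphism $g:N\to N'$ acts through chain maps $Y\to Y'$ and $V\to V'$ lifting $g$ and a chain map $S\to S'$ whose square with $V\to V'$, $\beta$ and $\beta'$ commutes up to homotopy. Corollary 4.13. Such data $(Y,V,S,\beta,\kappa)$ exist for every $R$-module $N$ with $\mathcal G(\mathcal I_C)\text{-}\mathrm{id}_R(N)<\infty$, and every homomorphism $g:N\to N'$ has such lifts for any choices of the data of $N$ and $N'$. There are $R$-linear maps $\delta^n:\widehat{\operatorname{Ext}}{}^n_{\mathcal I_C}(M,N)\to\operatorname{Ext}^{n+1}_{\mathcal G(\mathcal I_C)}(M,N)$ such that for all $R$-modules $M$ and $N$ with $d=\mathcal G(\mathcal I_C)\text{-}\mathrm{id}_R(N)<\infty$, and any choice of the data, the sequence $$0\to\operatorname{Ext}^1_{\mathcal G(\mathcal I_C)}(M,N)\xrightarrow{\vartheta^1}\operatorname{Ext}^1_{\mathcal I_C}(M,N)\xrightarrow{\varepsilon^1}\widehat{\operatorname{Ext}}{}^1_{\mathcal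 I_C}(M,N)\xrightarrow{\delta^1}\operatorname{Ext}^2_{\mathcal G(\mathcal I_C)}(M,N)\xrightarrow{\vartheta^2}\cdots$$ $$\cdots\xrightarrow{\delta^{d-1}}\operatorname{Ext}^d_{\mathcal G(\mathcal I_C)}(M,N)\xrightarrow{\vartheta^d}\operatorname{Ext}^d_{\mathcal I_C}(M,N)\xrightarrow{\varepsilon^d}\widehat{\operatorname{Ext}}{}^d_{\mathcal I_C}(M,N)\to 0$$ is exact (it is empty if $d=0$), and $\varepsilon^n:\operatorname{Ext}^n_{\mathcal I_C}(M,N)\to\widehat{\operatorname{Ext}}{}^n_{\mathcal I_C}(M,N)$ is an isomorphism for every $n>d$. The sequence is natural in $M$ and in $N$ (among modules of finite $\mathcal G(\mathcal I_C)$-injective dimension): for all $n\ge 1$ the maps $\vartheta^n$, $\varepsilon^n$ and $\delta^n$ commute with the maps induced by any $f:M\to M'$ and by any $g:N\to N'$, for all choices of the data and of the lifts of $g$. -/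

import Mathlib

open CategoryTheory CategoryTheory.Limits Opposite

universe u

noncomputable section

/-- An `R`-module `C` is semidualizing if it has a (possibly unbounded) resolution by finite rank
free modules, the homothety map `R → Hom_R(C, C)` is bijective, and `Ext_R^n(C, C) = 0` for all
`n ≥ 1`. -/
structure IsSemidualizing {R : Type u} [CommRing R] (C : ModuleCat.{u} R) : Prop where
  exists_resolution : ∃ P : ProjectiveResolution C,
    ∀ i, Module.Free R (P.complex.X i) ∧ Module.Finite R (P.complex.X i)
  homothety_bijective : Function.Bijective (LinearMap.lsmul R C)
  ext_eq_zero : ∀ n : ℕ, 1 ≤ n → Subsingleton (Abelian.Ext.{u} C C n)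

/-- The class of `C`-injective modules: those isomorphic to `Hom_R(C, I)` with `I` injective. -/
def CInjective {R : Type u} [CommRing R] (C : ModuleCat.{u} R) :
    ObjectProperty (ModuleCat.{u} R) :=
  fun X => ∃ I : ModuleCat.{u} R, Injective I ∧ Nonempty (X ≅ ModuleCat.of R (C →ₗ[R] I))

section Gorenstein

variable {R : Type u} [CommRing R]

/-- A complex `W` is totally `𝒱`-acyclic if its terms lie in `𝒱`, it is exact, and the complexes
`Hom_R(X, W)` and `Hom_R(W, X)` are exact for every `X` in `𝒱`. Complexes are indexed
cohomologically: the term in degree `n` is the one of homological degree `-n`. -/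
structure IsTotallyAcyclic (𝒱 : ObjectProperty (ModuleCat.{u} R))
    (W : CochainComplex (ModuleCat.{u} R) ℤ) : Prop where
  mem : ∀ n, 𝒱 (W.X n)
  exactAt : ∀ n, W.ExactAt n
  hom_to_exact : ∀ X, 𝒱 X → ∀ (n : ℤ) (f : X ⟶ W.X (n + 1)),
    f ≫ W.d (n + 1) (n + 2) = 0 → ∃ g : X ⟶ W.X n, g ≫ W.d n (n + 1) = f
  hom_from_exact : ∀ X, 𝒱 X → ∀ (n : ℤ) (f : W.X (n + 1) ⟶ X),
    W.d n (n + 1) ≫ f = 0 → ∃ g : W.X (n + 2) ⟶ X, W.d (n + 1) (n + 2) ≫ g = f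

/-- The class `𝒢(𝒱)` of modules isomorphic to `Coker(W⁻¹ → W⁰)` for a totally `𝒱`-acyclic
complex `W`. -/
def GorensteinClass (𝒱 : ObjectProperty (ModuleCat.{u} R)) : ObjectProperty (ModuleCat.{u} R) :=
  fun X => ∃ W : CochainComplex (ModuleCat.{u} R) ℤ,
    IsTotallyAcyclic 𝒱 W ∧ Nonempty (X ≅ cokernel (W.d (-1) 0))

/-- A `𝒱`-coresolution of `N`: a complex `V` concentrated in cohomological degrees `≥ 0` with terms
in `𝒱`, and an augmentation `N → V⁰` making `0 → N → V⁰ → V¹ → ⋯` exact. -/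
structure Coresolution (𝒱 : ObjectProperty (ModuleCat.{u} R)) (N : ModuleCat.{u} R) where
  cx : CochainComplex (ModuleCat.{u} R) ℤ
  aug : N ⟶ cx.X 0
  mem : ∀ n : ℤ, 0 ≤ n → 𝒱 (cx.X n)
  isZero : ∀ n : ℤ, n < 0 → IsZero (cx.X n)
  aug_comp : aug ≫ cx.d 0 1 = 0
  mono_aug : Mono aug
  exact_zero : (ShortComplex.mk aug (cx.d 0 1) aug_comp).Exact
  exactAt : ∀ n : ℤ, 0 < n → cx.ExactAt n

/-- A `𝒱`-coresolution is proper if the augmented complex `0 → N → V⁰ → V¹ → ⋯` becomes exact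
under `Hom_R(-, X)` for every `X` in `𝒱`. -/
structure Coresolution.IsProper {𝒱 : ObjectProperty (ModuleCat.{u} R)} {N : ModuleCat.{u} R}
    (V : Coresolution 𝒱 N) : Prop where
  at_aug : ∀ X, 𝒱 X → ∀ f : N ⟶ X, ∃ g : V.cx.X 0 ⟶ X, V.aug ≫ g = f
  at_zero : ∀ X, 𝒱 X → ∀ f : V.cx.X 0 ⟶ X,
    V.aug ≫ f = 0 → ∃ g : V.cx.X 1 ⟶ X, V.cx.d 0 1 ≫ g = f
  at_succ : ∀ X, 𝒱 X → ∀ (n : ℤ), 0 ≤ n → ∀ f : V.cx.X (n + 1) ⟶ X,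
    V.cx.d n (n + 1) ≫ f = 0 → ∃ g : V.cx.X (n + 2) ⟶ X, V.cx.d (n + 1) (n + 2) ≫ g = f

/-- The `𝒱`-injective dimension of `N`: the infimum, over all `𝒱`-coresolutions `V` of `N`, of the
supremum of the `n ≥ 0` with `Vⁿ ≠ 0`. It is `⊤` if there is no bounded `𝒱`-coresolution. -/
def injDim (𝒱 : ObjectProperty (ModuleCat.{u} R)) (N : ModuleCat.{u} R) : ℕ∞ :=
  ⨅ V : Coresolution 𝒱 N, ⨆ (n : ℕ) (_ : ¬ IsZero (V.cx.X (n : ℤ))), (n : ℕ∞)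

/-- A Tate `𝒱`-coresolution `N → V → S`: a proper `𝒱`-coresolution `V` of `N`, a totally
`𝒱`-acyclic complex `S`, and a chain map `β : V ⟶ S` that is an isomorphism in all sufficiently
large cohomological degrees. -/
structure TateCoresolution (𝒱 : ObjectProperty (ModuleCat.{u} R)) (N : ModuleCat.{u} R) where
  V : Coresolution 𝒱 N
  proper : V.IsProper
  S : CochainComplex (ModuleCat.{u} R) ℤ
  acyclic : IsTotallyAcyclic 𝒱 S
  β : V.cx ⟶ S
  eventually_isIso : ∃ n₀ : ℤ, ∀ n, n₀ ≤ n → IsIso (β.f n)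

/-- The chain map `φ` between coresolutions of `N` and `N'` lifts `g : N ⟶ N'`. -/
def IsLift {𝒱 𝒱' : ObjectProperty (ModuleCat.{u} R)} {N N' : ModuleCat.{u} R}
    (V : Coresolution 𝒱 N) (V' : Coresolution 𝒱' N') (g : N ⟶ N') (φ : V.cx ⟶ V'.cx) : Prop :=
  V.aug ≫ φ.f 0 = g ≫ V'.aug

/-- The resolutions of `N` from which relative and Tate cohomology and their comparison maps are
computed: a proper `𝒴`-coresolution `Y`, a Tate `𝒱`-coresolution `N → V → S`, and a lift
`Y ⟶ V` of the identity of `N`. -/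
structure ResolutionData (𝒴 𝒱 : ObjectProperty (ModuleCat.{u} R)) (N : ModuleCat.{u} R) where
  Y : Coresolution 𝒴 N
  proper : Y.IsProper
  T : TateCoresolution 𝒱 N
  κ : Y.cx ⟶ T.V.cx
  isLift : IsLift Y T.V (𝟙 N) κ

/-- The lifts of `g : N ⟶ N'` to chosen resolutions of `N` and `N'`, which induce the maps
`Ext(M, g)` in relative and Tate cohomology. The square formed by `onV`, `onS` and the maps
`V ⟶ S`, `V' ⟶ S'` commutes up to homotopy. -/
structure ResolutionLift {𝒴 𝒱 : ObjectProperty (ModuleCat.{u} R)} {N N' : ModuleCat.{u} R}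
    (D : ResolutionData 𝒴 𝒱 N) (D' : ResolutionData 𝒴 𝒱 N') (g : N ⟶ N') where
  onY : D.Y.cx ⟶ D'.Y.cx
  onV : D.T.V.cx ⟶ D'.T.V.cx
  onS : D.T.S ⟶ D'.T.S
  isLift_onY : IsLift D.Y D'.Y g onY
  isLift_onV : IsLift D.T.V D'.T.V g onV
  homotopic : Nonempty (Homotopy (D.T.β ≫ onS) (onV ≫ D'.T.β))

/-- The `R`-module `Hⁿ(Hom_R(M, K))`. -/
def homCoh (M : ModuleCat.{u} R) (K : CochainComplex (ModuleCat.{u} R) ℤ) (n : ℤ) :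
    ModuleCat.{u} R :=
  ((((linearCoyoneda R (ModuleCat.{u} R)).obj (op M)).mapHomologicalComplex _).obj K).homology n

/-- The map `Hⁿ(Hom_R(M, φ))` induced by a chain map `φ`. -/
def homCohMap (M : ModuleCat.{u} R) {K L : CochainComplex (ModuleCat.{u} R) ℤ} (φ : K ⟶ L)
    (n : ℤ) : homCoh M K n ⟶ homCoh M L n :=
  HomologicalComplex.homologyMap
    ((((linearCoyoneda R (ModuleCat.{u} R)).obj (op M)).mapHomologicalComplex _).map φ) n

/-- The map `Hⁿ(Hom_R(f, K))` induced by a homomorphism `f : M ⟶ M'`. -/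
def homCohComap {M M' : ModuleCat.{u} R} (f : M ⟶ M') (K : CochainComplex (ModuleCat.{u} R) ℤ)
    (n : ℤ) : homCoh M' K n ⟶ homCoh M K n :=
  HomologicalComplex.homologyMap
    ((NatTrans.mapHomologicalComplex
      ((linearCoyoneda R (ModuleCat.{u} R)).map f.op) _).app K) n

namespace ResolutionData

variable {𝒴 𝒱 : ObjectProperty (ModuleCat.{u} R)} {N : ModuleCat.{u} R}

/-- Relative cohomology `Ext_𝒴ⁿ(M, N)`, computed from the proper `𝒴`-coresolution of `N`. -/
abbrev extY (D : ResolutionData 𝒴 𝒱 N) (M : ModuleCat.{u} R) (n : ℤ) : ModuleCat.{u} R :=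
  homCoh M D.Y.cx n

/-- Relative cohomology `Ext_𝒱ⁿ(M, N)`, computed from the proper `𝒱`-coresolution of `N`. -/
abbrev extV (D : ResolutionData 𝒴 𝒱 N) (M : ModuleCat.{u} R) (n : ℤ) : ModuleCat.{u} R :=
  homCoh M D.T.V.cx n

/-- Tate cohomology, computed from the totally acyclic complex of the Tate coresolution of `N`. -/
abbrev extTate (D : ResolutionData 𝒴 𝒱 N) (M : ModuleCat.{u} R) (n : ℤ) : ModuleCat.{u} R :=
  homCoh M D.T.S n

/-- The comparison map `Ext_𝒴ⁿ(M, N) ⟶ Ext_𝒱ⁿ(M, N)`. -/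
abbrev ϑ (D : ResolutionData 𝒴 𝒱 N) (M : ModuleCat.{u} R) (n : ℤ) : D.extY M n ⟶ D.extV M n :=
  homCohMap M D.κ n

/-- The comparison map from `Ext_𝒱ⁿ(M, N)` to Tate cohomology. -/
abbrev ε (D : ResolutionData 𝒴 𝒱 N) (M : ModuleCat.{u} R) (n : ℤ) : D.extV M n ⟶ D.extTate M n :=
  homCohMap M D.T.β n

end ResolutionData

end Gorenstein

end

/-! The argument is formal once the class `𝒱` of `C`-injectives is known to be self-orthogonal:
`Ext^i(X, Y) = 0` for `X`, `Y` in `𝒱` and `i ≥ 1`. Everything between the definitions and the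
section on semidualizing modules is done for an arbitrary `IsSelfOrthogonal` class.

For such a class, an Auslander–Buchweitz approximation
(`HasFiniteCoresolution.exists_approximation`) embeds `N` into a module `G` of `𝒢(𝒱)` with cokernel
of finite `𝒱`-dimension. Splicing gives a coresolution `Y` of `N` of length `d` with `Y⁰ = G` and
`Yⁿ` in `𝒱` for `n > 0`; it is proper because `Ext^i(𝒱, 𝒢(𝒱)) = 0`. Let `S` be a complete resolution
of `Y⁰`, so that `Y⁰` is the kernel of `S⁰ → S¹`. The map `Y⁰ → Y¹` extends to a map `φ` from the
part of `S` in degrees `≥ 0` to `Y` shifted by one. The complex `S⁰ → S¹ × Y¹ → S² × Y² → ⋯`, with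
`φ` as the off-diagonal part of the differential, is a proper `𝒱`-coresolution `V` of `N`, and the
projection `V → S` is an isomorphism above degree `d`. This is a Tate coresolution.

In positive degrees `0 → Y → V → S → 0` is split in each degree, so `Hom(M, -)` yields the long
exact sequence, with `φ` inducing `δ`. It starts with an injection in degree one because a map `M →
S⁰` killed by the differential comes from `Y⁰`, where `φ` restricts to the differential of `Y`. It
stops at `d` because `Y` does.

Chain lifts between resolution data exist and are unique up to homotopy, so any choice of data is
canonically isomorphic on cohomology to the one above. Exactness and `δ` are transported along these
isomorphisms, and naturality need only be checked on one lift between approximations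
(`ApproximationData.exists_lift`).

Self-orthogonality of `𝒱` (`IsSemidualizing.extVanish`): if `F → C` is a resolution by finite free
modules and `J` is injective, `Hom(F, J)` is an injective coresolution of `Hom(C, J)`. For finite
free `P`, maps `Hom(C, I) → Hom(P, J)` are the same as maps `Hom(Hom(P, C), I) → J`. Since `Ext^i(C,
C) = 0` makes `Hom(F, C)` exact in positive degrees, so is `Hom(Hom(C, I), Hom(F, J))`. -/

noncomputable section

/-! ### Short exact sequences of modules and dimension shifting for `Ext`. -/

section ShortExactSequences

variable {R : Type u} [CommRing R]

/-- The maps `f` and `g` form a short exact sequence `0 → A → B → C → 0`. -/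
structure IsSES {A B C : ModuleCat.{u} R} (f : A ⟶ B) (g : B ⟶ C) : Prop where
  injective : Function.Injective f
  exact : Function.Exact f g
  surjective : Function.Surjective g

/-- All higher extensions of `A` by `B` vanish. -/
def ExtVanish (A B : ModuleCat.{u} R) : Prop :=
  ∀ i : ℕ, 1 ≤ i → Subsingleton (Abelian.Ext.{u} A B i)

namespace IsSES

variable {A B C : ModuleCat.{u} R} {f : A ⟶ B} {g : B ⟶ C}

lemma comp_eq_zero (h : IsSES f g) : f ≫ g = 0 := by
  ext x
  exact h.exact.apply_apply_eq_zero x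

lemma shortExact (h : IsSES f g) : (ShortComplex.mk f g h.comp_eq_zero).ShortExact where
  exact := by
    rw [ShortComplex.moduleCat_exact_iff]
    intro x hx
    exact (h.exact x).1 hx
  mono_f := (ModuleCat.mono_iff_injective _).2 h.injective
  epi_g := (ModuleCat.epi_iff_surjective _).2 h.surjective

lemma exists_desc (h : IsSES f g) {X : ModuleCat.{u} R} (k : B ⟶ X) (hk : f ≫ k = 0) :
    ∃ l : C ⟶ X, g ≫ l = k := by
  have := h.shortExact.epi_g
  exact ⟨h.shortExact.exact.desc k hk, h.shortExact.exact.g_desc k hk⟩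

/-- Maps out of `A` extend to `B` when the extensions of `C` by the target split. -/
lemma exists_extend (h : IsSES f g) {X : ModuleCat.{u} R}
    (hX : Subsingleton (Abelian.Ext.{u} C X 1)) (a : A ⟶ X) : ∃ b : B ⟶ X, f ≫ b = a := by
  obtain ⟨y, hy⟩ := Abelian.Ext.contravariant_sequence_exact₁ h.shortExact X
    (Abelian.Ext.mk₀ a) (n₁ := 1) rfl (Subsingleton.elim _ _)
  obtain ⟨b, rfl⟩ := Abelian.Ext.addEquiv₀.symm.surjective y
  refine ⟨b, ?_⟩
  apply Abelian.Ext.addEquiv₀.symm.injective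
  simpa using hy

lemma subsingleton_ext_left (h : IsSES f g) {X : ModuleCat.{u} R} {i : ℕ}
    (hB : Subsingleton (Abelian.Ext.{u} B X i))
    (hC : Subsingleton (Abelian.Ext.{u} C X (1 + i))) :
    Subsingleton (Abelian.Ext.{u} A X i) := by
  refine subsingleton_of_forall_eq 0 fun x => ?_
  obtain ⟨y, rfl⟩ := Abelian.Ext.contravariant_sequence_exact₁ h.shortExact X x rfl
    (Subsingleton.elim _ _)
  rw [Subsingleton.elim y 0, Abelian.Ext.comp_zero]

/-- A class in `Ext¹(C, X)` dies in `Ext¹(B, X)`, so it is the image of some `A ⟶ X` under the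
connecting map. That map extends to `B`, hence its image is zero. -/
lemma subsingleton_ext_one_right (h : IsSES f g) {X : ModuleCat.{u} R}
    (hA : ∀ a : A ⟶ X, ∃ b : B ⟶ X, f ≫ b = a)
    (hB : Subsingleton (Abelian.Ext.{u} B X 1)) :
    Subsingleton (Abelian.Ext.{u} C X 1) := by
  refine subsingleton_of_forall_eq 0 fun x => ?_
  obtain ⟨y, rfl⟩ := Abelian.Ext.contravariant_sequence_exact₃ h.shortExact X x
    (Subsingleton.elim _ _) (n₀ := 0) rfl
  obtain ⟨a, rfl⟩ := Abelian.Ext.addEquiv₀.symm.surjective y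
  obtain ⟨b, rfl⟩ := hA a
  have := Abelian.Ext.mk₀_comp_mk₀ f b
  simp only [Abelian.Ext.addEquiv₀_symm_apply, ← this]
  exact h.shortExact.extClass_comp_assoc _

/-- The covariant counterpart: every class is the connecting image of some `X ⟶ C`, and such maps
lift to `B`. -/
lemma subsingleton_ext_one_of_lift (h : IsSES f g) {X : ModuleCat.{u} R}
    (hC : ∀ c : X ⟶ C, ∃ b : X ⟶ B, b ≫ g = c)
    (hB : Subsingleton (Abelian.Ext.{u} X B 1)) :
    Subsingleton (Abelian.Ext.{u} X A 1) := by
  refine subsingleton_of_forall_eq 0 fun x => ?_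
  obtain ⟨y, rfl⟩ := Abelian.Ext.covariant_sequence_exact₁ X h.shortExact x
    (Subsingleton.elim _ _) (n₀ := 0) rfl
  obtain ⟨c, rfl⟩ := Abelian.Ext.addEquiv₀.symm.surjective y
  obtain ⟨b, rfl⟩ := hC c
  have := Abelian.Ext.mk₀_comp_mk₀ b g
  simp only [Abelian.Ext.addEquiv₀_symm_apply, ← this]
  rw [Abelian.Ext.comp_assoc_of_second_deg_zero, h.shortExact.comp_extClass,
    Abelian.Ext.comp_zero]

lemma subsingleton_ext_of_lift (h : IsSES f g) {X : ModuleCat.{u} R} {i : ℕ}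
    (hC : Subsingleton (Abelian.Ext.{u} X C i))
    (hB : Subsingleton (Abelian.Ext.{u} X B (i + 1))) :
    Subsingleton (Abelian.Ext.{u} X A (i + 1)) := by
  refine subsingleton_of_forall_eq 0 fun x => ?_
  obtain ⟨y, rfl⟩ := Abelian.Ext.covariant_sequence_exact₁ X h.shortExact x
    (Subsingleton.elim _ _) rfl
  rw [Subsingleton.elim y 0, Abelian.Ext.zero_comp]

lemma extVanish_left (h : IsSES f g) {X : ModuleCat.{u} R} (hB : ExtVanish B X)
    (hC : ExtVanish C X) : ExtVanish A X :=
  fun i hi => h.subsingleton_ext_left (hB i hi) (hC _ (by omega))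

end IsSES

lemma ExtVanish.of_isZero {A X : ModuleCat.{u} R} (hA : IsZero A) : ExtVanish A X := by
  intro i _
  refine subsingleton_of_forall_eq 0 fun x => ?_
  rw [← Abelian.Ext.mk₀_id_comp x, hA.eq_of_src (𝟙 A) 0, Abelian.Ext.mk₀_zero,
    Abelian.Ext.zero_comp]

lemma ExtVanish.of_iso {A A' X X' : ModuleCat.{u} R} (h : ExtVanish A X) (e : A ≅ A')
    (e' : X ≅ X') : ExtVanish A' X' := by
  intro i hi
  have := h i hi
  refine subsingleton_of_forall_eq 0 fun x => ?_
  have h1 : ((Abelian.Ext.mk₀ e.hom).comp x (zero_add i)).comp (Abelian.Ext.mk₀ e'.inv)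
      (add_zero i) = 0 := Subsingleton.elim _ _
  have h2 := congrArg (fun z => (Abelian.Ext.mk₀ e.inv).comp
    (z.comp (Abelian.Ext.mk₀ e'.hom) (add_zero i)) (zero_add i)) h1
  simpa using h2

lemma ExtVanish.of_injective {A X : ModuleCat.{u} R} [Injective X] : ExtVanish A X := by
  intro i hi
  obtain ⟨j, rfl⟩ := Nat.exists_eq_add_of_le' hi
  exact subsingleton_of_forall_eq 0 fun x => Abelian.Ext.eq_zero_of_injective x

lemma ExtVanish.of_projective {A X : ModuleCat.{u} R} [Projective A] : ExtVanish A X := by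
  intro i hi
  obtain ⟨j, rfl⟩ := Nat.exists_eq_add_of_le' hi
  exact subsingleton_of_forall_eq 0 fun x => Abelian.Ext.eq_zero_of_projective x

end ShortExactSequences

/-! ### Recursion along `ℤ` in either direction from a given degree. -/

section Recursion

variable {T : ℤ → Type*} (P : ∀ n, T n → Prop) (Q : ∀ m n, T m → T n → Prop) (n₀ : ℤ)
  (t : ∀ n, T n) (h₀ : P n₀ (t n₀))

/-- A family of elements built by recursion towards larger indices. -/
def familyRight (step : ∀ m n, m + 1 = n → n₀ ≤ m → ∀ x, P m x → ∃ y, P n y ∧ Q m n x y) (n : ℤ) :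
    {x : T n // n₀ ≤ n → P n x} :=
  if h : n₀ < n then
    ⟨(step (n - 1) n (by omega) (by omega) (familyRight step (n - 1)).1
        ((familyRight step (n - 1)).2 (by omega))).choose,
      fun _ => (step (n - 1) n (by omega) (by omega) (familyRight step (n - 1)).1
        ((familyRight step (n - 1)).2 (by omega))).choose_spec.1⟩
  -- On the other side of `n₀` the family is the prescribed `t`. Since `P` is required only from
  -- `n₀` on, `h₀` is the only case to check.
  else ⟨t n, fun h' => by
    obtain rfl : n = n₀ := by omega
    exact h₀⟩
termination_by (n - n₀).toNat
decreasing_by all_goals omega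

include h₀ in
lemma exists_family_right
    (step : ∀ m n, m + 1 = n → n₀ ≤ m → ∀ x, P m x → ∃ y, P n y ∧ Q m n x y) :
    ∃ f : ∀ n, T n, (∀ n ≤ n₀, f n = t n) ∧ ∀ m n, m + 1 = n → n₀ ≤ m → Q m n (f m) (f n) := by
  refine ⟨fun n => (familyRight P Q n₀ t h₀ step n).1, fun n hn => ?_, fun m n hmn hm => ?_⟩
  · dsimp only
    rw [familyRight, dif_neg (by omega)]
  · obtain rfl : m = n - 1 := by omega
    have hspec := (step (n - 1) n (by omega) (by omega) (familyRight P Q n₀ t h₀ step (n - 1)).1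
        ((familyRight P Q n₀ t h₀ step (n - 1)).2 (by omega))).choose_spec.2
    have e : (familyRight P Q n₀ t h₀ step n).1 = (step (n - 1) n (by omega) (by omega)
        (familyRight P Q n₀ t h₀ step (n - 1)).1
        ((familyRight P Q n₀ t h₀ step (n - 1)).2 (by omega))).choose := by
      conv_lhs => rw [familyRight, dif_pos (by omega)]
    dsimp only
    rw [e]
    exact hspec

/-- A family of elements built by recursion towards smaller indices. -/
def familyLeft (step : ∀ m n, m + 1 = n → n ≤ n₀ → ∀ y, P n y → ∃ x, P m x ∧ Q m n x y) (n : ℤ) :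
    {x : T n // n ≤ n₀ → P n x} :=
  if h : n < n₀ then
    ⟨(step n (n + 1) rfl (by omega) (familyLeft step (n + 1)).1
        ((familyLeft step (n + 1)).2 (by omega))).choose,
      fun _ => (step n (n + 1) rfl (by omega) (familyLeft step (n + 1)).1
        ((familyLeft step (n + 1)).2 (by omega))).choose_spec.1⟩
  else ⟨t n, fun h' => by
    obtain rfl : n = n₀ := by omega
    exact h₀⟩
termination_by (n₀ - n).toNat
decreasing_by all_goals omega

include h₀ in
lemma exists_family_left
    (step : ∀ m n, m + 1 = n → n ≤ n₀ → ∀ y, P n y → ∃ x, P m x ∧ Q m n x y) :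
    ∃ f : ∀ n, T n, (∀ n, n₀ ≤ n → f n = t n) ∧
      ∀ m n, m + 1 = n → n ≤ n₀ → Q m n (f m) (f n) := by
  refine ⟨fun n => (familyLeft P Q n₀ t h₀ step n).1, fun n hn => ?_, fun m n hmn hm => ?_⟩
  · dsimp only
    rw [familyLeft, dif_neg (by omega)]
  · subst hmn
    have hspec := (step m (m + 1) rfl (by omega) (familyLeft P Q n₀ t h₀ step (m + 1)).1
        ((familyLeft P Q n₀ t h₀ step (m + 1)).2 (by omega))).choose_spec.2
    have e : (familyLeft P Q n₀ t h₀ step m).1 = (step m (m + 1) rfl (by omega)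
        (familyLeft P Q n₀ t h₀ step (m + 1)).1
        ((familyLeft P Q n₀ t h₀ step (m + 1)).2 (by omega))).choose := by
      conv_lhs => rw [familyLeft, dif_pos (by omega)]
    dsimp only
    rw [e]
    exact hspec

end Recursion

/-! ### Degreewise construction of chain maps and homotopies. -/

section Complexes

variable {R : Type u} [CommRing R]

lemma CochainComplex.d_d_apply {K : CochainComplex (ModuleCat.{u} R) ℤ} {l m n : ℤ}
    (x : K.X l) : K.d m n (K.d l m x) = 0 := by
  rw [← ModuleCat.comp_apply, K.d_comp_d]
  rfl

lemma CochainComplex.hom_comm_apply {K L : CochainComplex (ModuleCat.{u} R) ℤ} (φ : K ⟶ L)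
    {m n : ℤ} (x : K.X m) : L.d m n (φ.f m x) = φ.f n (K.d m n x) := by
  rw [← ModuleCat.comp_apply, φ.comm, ModuleCat.comp_apply]

lemma CochainComplex.exactAt_iff_apply (K : CochainComplex (ModuleCat.{u} R) ℤ) {l m n : ℤ}
    (hlm : l + 1 = m) (hmn : m + 1 = n) :
    K.ExactAt m ↔ ∀ x, K.d m n x = 0 → ∃ y, K.d l m y = x := by
  rw [K.exactAt_iff' l m n (by simp; omega) (by simp; omega), ShortComplex.moduleCat_exact_iff]
  rfl

lemma ModuleCat.eq_zero_of_isZero {X : ModuleCat.{u} R} (h : IsZero X) (x : X) : x = 0 :=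
  @Subsingleton.elim _ (ModuleCat.subsingleton_of_isZero h) x 0

lemma ModuleCat.hom_neg_apply {A B : ModuleCat.{u} R} (f : A ⟶ B) (x : A) : (-f) x = -f x := rfl

lemma ModuleCat.hom_zero_apply {A B : ModuleCat.{u} R} (x : A) : (0 : A ⟶ B) x = 0 := rfl

lemma ModuleCat.hom_add_apply {A B : ModuleCat.{u} R} (f g : A ⟶ B) (x : A) :
    (f + g) x = f x + g x := rfl

lemma ModuleCat.hom_sub_apply {A B : ModuleCat.{u} R} (f g : A ⟶ B) (x : A) :
    (f - g) x = f x - g x := rfl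

lemma ModuleCat.comp_eq_zero_apply {A B C : ModuleCat.{u} R} {f : A ⟶ B} {g : B ⟶ C}
    (h : f ≫ g = 0) (x : A) : g (f x) = 0 := by
  rw [← ModuleCat.comp_apply, h]
  rfl

/-- Maps `K.X m ⟶ X` vanishing on the cocycles extend along the differential. -/
def ExtendsTo (K : CochainComplex (ModuleCat.{u} R) ℤ) (X : ModuleCat.{u} R) : Prop :=
  ∀ m n, m + 1 = n → ∀ f : K.X m ⟶ X, (∀ x, K.d m n x = 0 → f x = 0) →
    ∃ g : K.X n ⟶ X, K.d m n ≫ g = f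

/-- Maps from `X` to the cocycles of `L` lift along the differential. -/
def LiftsFrom (X : ModuleCat.{u} R) (L : CochainComplex (ModuleCat.{u} R) ℤ) : Prop :=
  ∀ l m n, l + 1 = m → m + 1 = n → ∀ f : X ⟶ L.X m, f ≫ L.d m n = 0 →
    ∃ g : X ⟶ L.X l, g ≫ L.d l m = f

section

variable (K : CochainComplex (ModuleCat.{u} R) ℤ) {B : ℤ → ModuleCat.{u} R}
  (e : ∀ m n, B m ⟶ B n)
  (E : ∀ m n, m + 1 = n → (K.X m ⟶ B n))
  (n₀ : ℤ) (t : ∀ n, K.X n ⟶ B n)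

/-- Solving `d ≫ σ = σ ≫ e + E` by recursion towards larger degrees. -/
lemma exists_solution_right
    (hE : ∀ l m n, n₀ ≤ l → ∀ (h : l + 1 = m) (h' : m + 1 = n),
      E l m h ≫ e m n + K.d l m ≫ E m n h' = 0)
    (he : ∀ l m n, e l m ≫ e m n = 0)
    (hK : ∀ n, n₀ < n → K.ExactAt n)
    (hext : ∀ m n, m + 1 = n → n₀ ≤ m → ∀ f : K.X m ⟶ B n, (∀ x, K.d m n x = 0 → f x = 0) →
      ∃ g : K.X n ⟶ B n, K.d m n ≫ g = f)
    (ht : ∀ x, K.d n₀ (n₀ + 1) x = 0 →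
      e n₀ (n₀ + 1) (t n₀ x) + E n₀ (n₀ + 1) rfl x = 0) :
    ∃ σ : ∀ n, K.X n ⟶ B n, (∀ n ≤ n₀, σ n = t n) ∧
      ∀ m n (h : m + 1 = n), n₀ ≤ m → K.d m n ≫ σ n = σ m ≫ e m n + E m n h := by
  -- The invariant is that the right-hand side `σ ≫ e + E` vanishes on cocycles, which is what
  -- `hext` needs to define the next component. It propagates by exactness of `K` and `hE`.
  obtain ⟨σ, h1, h2⟩ := exists_family_right (T := fun n => K.X n ⟶ B n)
    (fun m s => ∀ n (h : m + 1 = n), ∀ x, K.d m n x = 0 → e m n (s x) + E m n h x = 0)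
    (fun m n s s' => ∀ h : m + 1 = n, K.d m n ≫ s' = s ≫ e m n + E m n h) n₀ t
    (by rintro _ rfl; exact ht) (by
      intro m n hmn hm s hs
      obtain ⟨g, hg⟩ := hext m n hmn hm (s ≫ e m n + E m n hmn) (hs n hmn)
      refine ⟨g, fun p hp x hx => ?_, fun _ => hg⟩
      obtain ⟨z, rfl⟩ := (K.exactAt_iff_apply hmn hp).1 (hK n (by omega)) x hx
      have h3 : g (K.d m n z) = e m n (s z) + E m n hmn z := congr($hg z)
      have h4 : e n p (E m n hmn z) + E n p hp (K.d m n z) = 0 := congr($(hE m n p hm hmn hp) z)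
      rw [h3, map_add, ModuleCat.comp_eq_zero_apply (he m n p), zero_add, h4])
  exact ⟨σ, h1, fun m n h hm => h2 m n h hm h⟩

/-- Solving `d ≫ σ = σ ≫ e + E` by recursion towards smaller degrees. -/
lemma exists_solution_left
    (hE : ∀ l m n (h : l + 1 = m) (h' : m + 1 = n), E l m h ≫ e m n + K.d l m ≫ E m n h' = 0)
    (hlift : ∀ l m n, l + 1 = m → m + 1 = n → m ≤ n₀ → ∀ f : K.X l ⟶ B m, f ≫ e m n = 0 →
      ∃ g : K.X l ⟶ B l, g ≫ e l m = f)
    (ht : ∀ m n, n₀ ≤ m → ∀ h : m + 1 = n, K.d m n ≫ t n = t m ≫ e m n + E m n h) :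
    ∃ σ : ∀ n, K.X n ⟶ B n, (∀ n, n₀ ≤ n → σ n = t n) ∧
      ∀ m n (h : m + 1 = n), K.d m n ≫ σ n = σ m ≫ e m n + E m n h := by
  -- The dual invariant: `d ≫ σ - E` is killed by `e`, so that it lifts along the preceding `e`.
  obtain ⟨σ, h1, h2⟩ := exists_family_left (T := fun n => K.X n ⟶ B n)
    (fun m s => ∀ l n (h : l + 1 = m) (_ : m + 1 = n), (K.d l m ≫ s - E l m h) ≫ e m n = 0)
    (fun m n s s' => ∀ h : m + 1 = n, K.d m n ≫ s' = s ≫ e m n + E m n h) n₀ t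
    (by
      intro l n h h'
      have h3 : t n₀ ≫ e n₀ n = K.d n₀ n ≫ t n - E n₀ n h' := by
        rw [ht n₀ n le_rfl h']; abel
      rw [Preadditive.sub_comp, Category.assoc, h3, Preadditive.comp_sub, K.d_comp_d_assoc,
        zero_comp, zero_sub, ← neg_add', add_comm, hE l n₀ n h h', neg_zero]) (by
      intro m n hmn hm s hs
      obtain ⟨g, hg⟩ := hlift m n (n + 1) hmn rfl hm (K.d m n ≫ s - E m n hmn) (hs m _ hmn rfl)
      refine ⟨g, fun l p hl hp => ?_, fun _ => ?_⟩
      · obtain rfl : p = n := by omega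
        rw [Preadditive.sub_comp, Category.assoc, hg, Preadditive.comp_sub, K.d_comp_d_assoc,
          zero_comp, zero_sub, ← neg_add', add_comm, hE l m p hl hp, neg_zero]
      · rw [hg]; abel)
  refine ⟨σ, h1, fun m n h => ?_⟩
  by_cases hm : n ≤ n₀
  · exact h2 m n h hm h
  · rw [h1 n (by omega), h1 m (by omega), ht m n (by omega)]

end

/-- A homotopy from a family of maps satisfying the homotopy relation. -/
def homotopyOfFamily {K L : CochainComplex (ModuleCat.{u} R) ℤ} {φ ψ : K ⟶ L}
    (h : ∀ i j, K.X i ⟶ L.X j)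
    (H : ∀ l m n, l + 1 = m → m + 1 = n →
      φ.f m = K.d m n ≫ h n m + h m l ≫ L.d l m + ψ.f m) : Homotopy φ ψ where
  hom i j := if j + 1 = i then h i j else 0
  zero i j hij := if_neg hij
  comm m := by
    rw [dNext_eq _ (show (ComplexShape.up ℤ).Rel m (m + 1) from rfl),
      prevD_eq _ (show (ComplexShape.up ℤ).Rel (m - 1) m by simp), if_pos rfl, if_pos (by omega)]
    exact H _ _ _ (by omega) rfl

lemma Homotopy.comm_of_eq {K L : CochainComplex (ModuleCat.{u} R) ℤ} {φ ψ : K ⟶ L}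
    (h : Homotopy φ ψ) {l m n : ℤ} (hl : l + 1 = m) (hm : m + 1 = n) :
    φ.f m = K.d m n ≫ h.hom n m + h.hom m l ≫ L.d l m + ψ.f m := by
  rw [h.comm m, dNext_eq _ (show (ComplexShape.up ℤ).Rel m n from hm),
    prevD_eq _ (show (ComplexShape.up ℤ).Rel l m from hl)]

section

variable {K L : CochainComplex (ModuleCat.{u} R) ℤ} (φ ψ : K ⟶ L)

/-- The differential of `L` shifted down by one, up to sign. -/
def downD (L : CochainComplex (ModuleCat.{u} R) ℤ) (m n : ℤ) : L.X (m - 1) ⟶ L.X (n - 1) :=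
  -L.d (m - 1) (n - 1)

lemma downD_comp (L : CochainComplex (ModuleCat.{u} R) ℤ) (l m n : ℤ) :
    downD L l m ≫ downD L m n = 0 := by
  simp [downD]

/-- The degree `m` part of a difference of chain maps, viewed as a map into `L.X (n - 1)`. -/
def downE (m n : ℤ) (h : m + 1 = n) : K.X m ⟶ L.X (n - 1) :=
  (φ.f m - ψ.f m) ≫ (L.XIsoOfEq (by omega : m = n - 1)).hom

lemma downE_comp (l m n : ℤ) (h : l + 1 = m) (h' : m + 1 = n) :
    downE φ ψ l m h ≫ downD L m n + K.d l m ≫ downE φ ψ m n h' = 0 := by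
  obtain rfl : m = n - 1 := by omega
  simp [downE, downD]

/-- Because of the sign in `downD`, the recursion equation is the homotopy relation with one term
moved across. Homotopies thus become instances of the same recursion as chain maps. -/
lemma nonempty_homotopy_of_solution (s : ∀ n, K.X n ⟶ L.X (n - 1))
    (H : ∀ m n (h : m + 1 = n), K.d m n ≫ s n = s m ≫ downD L m n + downE φ ψ m n h) :
    Nonempty (Homotopy φ ψ) := by
  refine ⟨homotopyOfFamily
    (fun i j => if h : i - 1 = j then s i ≫ (L.XIsoOfEq h).hom else 0) ?_⟩
  intro l m n hl hm
  rw [dif_pos (by omega), dif_pos (by omega), ← Category.assoc, H m n hm]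
  simp [downE, downD]

end

variable {K L : CochainComplex (ModuleCat.{u} R) ℤ} {φ ψ : K ⟶ L}

/-- Chain maps that agree in large degrees are homotopic if maps lift along the target. -/
lemma nonempty_homotopy_of_eventually (n₀ : ℤ) (h : ∀ i j, K.X i ⟶ L.X j)
    (H : ∀ l m n, n₀ ≤ m → l + 1 = m → m + 1 = n →
      φ.f m = K.d m n ≫ h n m + h m l ≫ L.d l m + ψ.f m)
    (hlift : ∀ n, LiftsFrom (K.X n) L) : Nonempty (Homotopy φ ψ) := by
  obtain ⟨s, -, hs⟩ := exists_solution_left K (downD L) (downE φ ψ)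
    n₀ (fun n => h n (n - 1)) (downE_comp φ ψ) (by
      intro l m n hl hm _ f hf
      obtain ⟨g, hg⟩ := hlift l (l - 1) (m - 1) (n - 1) (by omega) (by omega) f (by
        simpa [downD] using hf)
      exact ⟨-g, by simp [downD, hg]⟩) (by
      intro m n hm hn
      obtain rfl : m = n - 1 := by omega
      rw [downE, H (n - 1 - 1) (n - 1) n hm (by omega) (by omega), downD]
      simp)
  exact nonempty_homotopy_of_solution φ ψ s hs

/-- The homotopy may start with zero in degree `n₀`, because `φ` and `ψ` agree on the cocycles
there. -/
lemma nonempty_homotopy_right (n₀ : ℤ) (hK : ∀ n, n₀ < n → K.ExactAt n)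
    (hK' : ∀ n < n₀, IsZero (K.X n))
    (hext : ∀ n, n₀ ≤ n → ExtendsTo K (L.X n))
    (h₀ : ∀ x, K.d n₀ (n₀ + 1) x = 0 → φ.f n₀ x = ψ.f n₀ x) : Nonempty (Homotopy φ ψ) := by
  obtain ⟨s, hs, hs'⟩ := exists_solution_right K (downD L) (downE φ ψ)
    n₀ (fun n => 0) (fun l m n _ => downE_comp φ ψ l m n) (downD_comp L) hK (by
      intro m n hmn hm f hf
      exact hext _ (by omega) m n hmn f hf) (by
      intro x hx
      rw [ModuleCat.hom_zero_apply, map_zero, zero_add, downE, ModuleCat.comp_apply]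
      rw [ModuleCat.hom_sub_apply, h₀ x hx, sub_self, map_zero])
  refine nonempty_homotopy_of_solution φ ψ s fun m n hmn => ?_
  by_cases hm : n₀ ≤ m
  · exact hs' m n hmn hm
  · exact (hK' m (by omega)).eq_of_src _ _

end Complexes

/-! ### Comparison theorems for proper coresolutions and Tate coresolutions. -/

section Lifts

variable {R : Type u} [CommRing R] {𝒱 𝒱' : ObjectProperty (ModuleCat.{u} R)}
  {N N' : ModuleCat.{u} R}

lemma LiftsFrom.of_isZero {L : CochainComplex (ModuleCat.{u} R) ℤ} {X : ModuleCat.{u} R}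
    (hX : IsZero X) : LiftsFrom X L :=
  fun _ _ _ _ _ _ _ => ⟨0, hX.eq_of_src _ _⟩

namespace IsTotallyAcyclic

variable {W : CochainComplex (ModuleCat.{u} R) ℤ} (hW : IsTotallyAcyclic 𝒱 W)
  {X : ModuleCat.{u} R} (hX : 𝒱 X)

include hW hX

lemma liftsFrom : LiftsFrom X W := by
  rintro l _ _ rfl rfl f hf
  have h : l + 1 + 1 = l + 2 := by ring
  rw [h] at hf
  exact hW.hom_to_exact X hX l f hf

lemma extendsTo : ExtendsTo W X := by
  intro m n hmn f hf
  obtain ⟨l, rfl⟩ : ∃ l, m = l + 1 := ⟨m - 1, by ring⟩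
  obtain rfl : n = l + 2 := by omega
  refine hW.hom_from_exact X hX l f ?_
  ext x
  exact hf _ (CochainComplex.d_d_apply x)

end IsTotallyAcyclic

namespace Coresolution

variable (V : Coresolution 𝒱 N)

lemma aug_injective : Function.Injective V.aug :=
  (ModuleCat.mono_iff_injective _).1 V.mono_aug

lemma d_aug_apply (x : N) : V.cx.d 0 1 (V.aug x) = 0 :=
  ModuleCat.comp_eq_zero_apply V.aug_comp x

lemma exists_aug_eq (x : V.cx.X 0) (hx : V.cx.d 0 1 x = 0) : ∃ y, V.aug y = x :=
  (ShortComplex.moduleCat_exact_iff _).1 V.exact_zero x hx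

lemma IsProper.extendsTo {V : Coresolution 𝒱 N} (hV : V.IsProper) {X : ModuleCat.{u} R}
    (hX : 𝒱 X) : ExtendsTo V.cx X := by
  intro m n hmn f hf
  rcases lt_trichotomy m 0 with hm | rfl | hm
  · exact ⟨0, (V.isZero m hm).eq_of_src _ _⟩
  · obtain rfl : n = 1 := by omega
    refine hV.at_zero X hX f ?_
    ext x
    exact hf _ (V.d_aug_apply x)
  · obtain ⟨l, rfl⟩ : ∃ l, m = l + 1 := ⟨m - 1, by ring⟩
    obtain rfl : n = l + 2 := by omega
    refine hV.at_succ X hX l (by omega) f ?_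
    ext x
    exact hf _ (CochainComplex.d_d_apply x)

lemma exists_isLift (V : Coresolution 𝒱 N) (hV : V.IsProper) (V' : Coresolution 𝒱' N')
    (h : 𝒱' ≤ 𝒱) (g : N ⟶ N') : ∃ φ : V.cx ⟶ V'.cx, IsLift V V' g φ := by
  obtain ⟨φ₀, hφ₀⟩ := hV.at_aug _ (h _ (V'.mem 0 le_rfl)) (g ≫ V'.aug)
  obtain ⟨σ, hσ, hσ'⟩ := exists_solution_right V.cx V'.cx.d (fun _ _ _ => 0) 0
    -- The prescribed family is `φ₀` in degree zero and zero in negative degrees, where `V`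
    -- vanishes; its positive part is never used.
    (Function.update (fun n => 0) 0 φ₀) (by simp) (by simp) V.exactAt
    (fun m n hmn hm f hf => hV.extendsTo (h _ (V'.mem n (by omega))) m n hmn f hf) (by
      intro x hx
      obtain ⟨y, rfl⟩ := V.exists_aug_eq x hx
      have h1 : φ₀ (V.aug y) = V'.aug (g y) := congr($hφ₀ y)
      rw [Function.update_self, h1, ModuleCat.hom_zero_apply, add_zero]
      exact V'.d_aug_apply _)
  refine ⟨{ f := σ, comm' := ?_ }, ?_⟩
  · intro m n hmn
    by_cases hm : 0 ≤ m
    · simpa using (hσ' m n hmn hm).symm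
    · exact (V.isZero m (by omega)).eq_of_src _ _
  · change V.aug ≫ σ 0 = _
    rw [hσ 0 le_rfl, Function.update_self, hφ₀]

/-- The two classes are allowed to differ so that maps from a `𝒴`-coresolution to a `𝒱`-coresolution
are covered, as needed for `κ`. -/
lemma nonempty_homotopy_of_isLift {V : Coresolution 𝒱 N} (hV : V.IsProper)
    {V' : Coresolution 𝒱' N'} (h : 𝒱' ≤ 𝒱) {g : N ⟶ N'} {φ ψ : V.cx ⟶ V'.cx}
    (hφ : IsLift V V' g φ) (hψ : IsLift V V' g ψ) : Nonempty (Homotopy φ ψ) := by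
  refine nonempty_homotopy_right 0 V.exactAt V.isZero
    (fun n hn => hV.extendsTo (h _ (V'.mem n hn))) fun x hx => ?_
  obtain ⟨y, rfl⟩ := V.exists_aug_eq x hx
  have h1 := hφ.trans hψ.symm
  exact congr($h1 y)

end Coresolution

lemma IsLift.comp {𝒱'' : ObjectProperty (ModuleCat.{u} R)} {N'' : ModuleCat.{u} R}
    {V : Coresolution 𝒱 N} {V' : Coresolution 𝒱' N'} {V'' : Coresolution 𝒱'' N''}
    {g : N ⟶ N'} {g' : N' ⟶ N''} {φ : V.cx ⟶ V'.cx} {φ' : V'.cx ⟶ V''.cx}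
    (h : IsLift V V' g φ) (h' : IsLift V' V'' g' φ') : IsLift V V'' (g ≫ g') (φ ≫ φ') := by
  rw [IsLift] at *
  rw [HomologicalComplex.comp_f, ← Category.assoc, h, Category.assoc, h', Category.assoc]

lemma IsLift.id (V : Coresolution 𝒱 N) : IsLift V V (𝟙 N) (𝟙 V.cx) := by
  simp [IsLift]

namespace TateCoresolution

lemma liftsFrom (T' : TateCoresolution 𝒱 N') (T : TateCoresolution 𝒱 N) (n : ℤ) :
    LiftsFrom (T.V.cx.X n) T'.S := by
  by_cases hn : n < 0
  · exact .of_isZero (T.V.isZero n hn)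
  · exact T'.acyclic.liftsFrom (T.V.mem n (by omega))

/-- An inverse of `β` in large degrees. -/
lemma exists_inverse (T : TateCoresolution 𝒱 N) :
    ∃ (n₀ : ℤ) (j : ∀ n, T.S.X n ⟶ T.V.cx.X n),
      (∀ n, n₀ ≤ n → T.β.f n ≫ j n = 𝟙 _ ∧ j n ≫ T.β.f n = 𝟙 _) ∧
      ∀ m n, n₀ ≤ m → n₀ ≤ n → T.S.d m n ≫ j n = j m ≫ T.V.cx.d m n := by
  obtain ⟨n₀, hn₀⟩ := T.eventually_isIso
  have h : ∀ n, ∃ j : T.S.X n ⟶ T.V.cx.X n,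
      n₀ ≤ n → T.β.f n ≫ j = 𝟙 _ ∧ j ≫ T.β.f n = 𝟙 _ := by
    intro n
    by_cases hn : n₀ ≤ n
    · have := hn₀ n hn
      exact ⟨inv (T.β.f n), fun _ => ⟨IsIso.hom_inv_id _, IsIso.inv_hom_id _⟩⟩
    · exact ⟨0, fun h => absurd h hn⟩
  choose j hj using h
  refine ⟨n₀, j, hj, fun m n hm hn => ?_⟩
  rw [← Category.id_comp (T.S.d m n), ← (hj m hm).2, Category.assoc, Category.assoc,
    T.β.comm_assoc, (hj n hn).1, Category.comp_id]

/-- A chain map of coresolutions extends to the totally acyclic complexes. -/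
lemma exists_onS (T : TateCoresolution 𝒱 N) (T' : TateCoresolution 𝒱 N')
    (φ : T.V.cx ⟶ T'.V.cx) :
    ∃ σ : T.S ⟶ T'.S, Nonempty (Homotopy (T.β ≫ σ) (φ ≫ T'.β)) := by
  obtain ⟨n₀, j, hj, hjd⟩ := T.exists_inverse
  -- In large degrees `σ` is `β⁻¹ ≫ φ ≫ β'`; it is continued downwards by total acyclicity of the
  -- target.
  obtain ⟨σ, hσ, hσ'⟩ := exists_solution_left T.S T'.S.d (fun _ _ _ => 0) n₀
    (fun n => j n ≫ φ.f n ≫ T'.β.f n) (by simp)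
    (fun l m n hl hm _ f hf =>
      T'.acyclic.liftsFrom (T.acyclic.mem l) l m n hl hm f hf) (by
      intro m n hm hmn
      rw [← Category.assoc, hjd m n hm (by omega)]
      simp)
  refine ⟨{ f := σ, comm' := fun m n hmn => by simpa using (hσ' m n hmn).symm }, ?_⟩
  refine nonempty_homotopy_of_eventually n₀ (fun _ _ => 0) (fun l m n hm _ _ => ?_)
    fun n => T'.liftsFrom T n
  simp only [HomologicalComplex.comp_f, hσ m hm]
  rw [← Category.assoc, (hj m hm).1]
  simp

/-- The extension of a chain map of coresolutions to the totally acyclic complexes is unique up to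
homotopy. -/
lemma nonempty_homotopy_onS {T : TateCoresolution 𝒱 N} {T' : TateCoresolution 𝒱 N'}
    {φ ψ : T.V.cx ⟶ T'.V.cx} {σ τ : T.S ⟶ T'.S} (h : Nonempty (Homotopy φ ψ))
    (hσ : Nonempty (Homotopy (T.β ≫ σ) (φ ≫ T'.β)))
    (hτ : Nonempty (Homotopy (T.β ≫ τ) (ψ ≫ T'.β))) : Nonempty (Homotopy σ τ) := by
  obtain ⟨n₀, j, hj, hjd⟩ := T.exists_inverse
  obtain ⟨h⟩ := h
  obtain ⟨hσ⟩ := hσ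
  obtain ⟨hτ⟩ := hτ
  -- In large degrees `β` can be cancelled from `H`, which gives a homotopy between `σ` and `τ`
  -- there; the rest is obtained by downward recursion.
  let H : Homotopy (T.β ≫ σ) (T.β ≫ τ) := hσ.trans ((h.compRight T'.β).trans hτ.symm)
  refine nonempty_homotopy_of_eventually n₀ (fun i k => j i ≫ H.hom i k) (fun l m n hm hl hn => ?_)
    fun n => T'.acyclic.liftsFrom (T.acyclic.mem n)
  have h1 := congrArg (fun f => j m ≫ f) (H.comm_of_eq hl hn)
  simp only [HomologicalComplex.comp_f, Preadditive.comp_add] at h1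
  rw [← Category.assoc, (hj m hm).2, ← Category.assoc, ← hjd m n hm (by omega), ← Category.assoc,
    ← Category.assoc, (hj m hm).2, Category.id_comp, Category.id_comp] at h1
  simpa using h1

end TateCoresolution

namespace ResolutionLift

variable {𝒴 : ObjectProperty (ModuleCat.{u} R)}

lemma nonempty (D : ResolutionData 𝒴 𝒱 N) (D' : ResolutionData 𝒴 𝒱 N') (g : N ⟶ N') :
    Nonempty (ResolutionLift D D' g) := by
  obtain ⟨y, hy⟩ := Coresolution.exists_isLift D.Y D.proper D'.Y le_rfl g
  obtain ⟨v, hv⟩ := Coresolution.exists_isLift D.T.V D.T.proper D'.T.V le_rfl g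
  obtain ⟨s, hs⟩ := D.T.exists_onS D'.T v
  exact ⟨⟨y, v, s, hy, hv, hs⟩⟩

/-- The identity lift. -/
def refl (D : ResolutionData 𝒴 𝒱 N) : ResolutionLift D D (𝟙 N) where
  onY := 𝟙 _
  onV := 𝟙 _
  onS := 𝟙 _
  isLift_onY := .id _
  isLift_onV := .id _
  homotopic := ⟨Homotopy.ofEq (by simp)⟩

variable {N'' : ModuleCat.{u} R} {D : ResolutionData 𝒴 𝒱 N} {D' : ResolutionData 𝒴 𝒱 N'}
  {D'' : ResolutionData 𝒴 𝒱 N''} {g : N ⟶ N'} {g' : N' ⟶ N''}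

/-- The composition of lifts. -/
def comp (L : ResolutionLift D D' g) (L' : ResolutionLift D' D'' g') :
    ResolutionLift D D'' (g ≫ g') where
  onY := L.onY ≫ L'.onY
  onV := L.onV ≫ L'.onV
  onS := L.onS ≫ L'.onS
  isLift_onY := L.isLift_onY.comp L'.isLift_onY
  isLift_onV := L.isLift_onV.comp L'.isLift_onV
  homotopic := by
    obtain ⟨h⟩ := L.homotopic
    obtain ⟨h'⟩ := L'.homotopic
    exact ⟨((Homotopy.ofEq (by simp)).trans (h.compRight L'.onS)).trans
      (((Homotopy.ofEq (by simp)).trans (h'.compLeft L.onV)).trans (Homotopy.ofEq (by simp)))⟩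

lemma homotopy_onY (L L' : ResolutionLift D D' g) : Nonempty (Homotopy L.onY L'.onY) :=
  Coresolution.nonempty_homotopy_of_isLift D.proper le_rfl L.isLift_onY L'.isLift_onY

lemma homotopy_onV (L L' : ResolutionLift D D' g) : Nonempty (Homotopy L.onV L'.onV) :=
  Coresolution.nonempty_homotopy_of_isLift D.T.proper le_rfl L.isLift_onV L'.isLift_onV

lemma homotopy_onS (L L' : ResolutionLift D D' g) : Nonempty (Homotopy L.onS L'.onS) :=
  TateCoresolution.nonempty_homotopy_onS (L.homotopy_onV L') L.homotopic L'.homotopic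

/-- Both composites lift `g` from a proper `𝒴`-coresolution to a coresolution whose terms lie in
`𝒴`. -/
lemma homotopy_κ (h : 𝒱 ≤ 𝒴) (L : ResolutionLift D D' g) :
    Nonempty (Homotopy (D.κ ≫ L.onV) (L.onY ≫ D'.κ)) := by
  refine Coresolution.nonempty_homotopy_of_isLift (g := g) D.proper h ?_ ?_
  · simpa using D.isLift.comp L.isLift_onV
  · simpa using L.isLift_onY.comp D'.isLift

end ResolutionLift

end Lifts

/-! ### Cohomology of `Hom(M, K)` in terms of explicit cocycles `M ⟶ K.X n`. -/

section HomCohomology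

variable {R : Type u} [CommRing R] (M : ModuleCat.{u} R)
  {K L : CochainComplex (ModuleCat.{u} R) ℤ}

lemma homCohMap_id (n : ℤ) : homCohMap M (𝟙 K) n = 𝟙 _ := by
  simp [homCohMap, homCoh]

lemma homCohMap_comp {L' : CochainComplex (ModuleCat.{u} R) ℤ} (φ : K ⟶ L) (ψ : L ⟶ L') (n : ℤ) :
    homCohMap M (φ ≫ ψ) n = homCohMap M φ n ≫ homCohMap M ψ n := by
  rw [homCohMap, Functor.map_comp]
  exact HomologicalComplex.homologyMap_comp _ _ _

lemma homCohMap_eq_of_homotopy {φ ψ : K ⟶ L} (h : Nonempty (Homotopy φ ψ)) (n : ℤ) :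
    homCohMap M φ n = homCohMap M ψ n := by
  obtain ⟨h⟩ := h
  exact (((linearCoyoneda R (ModuleCat.{u} R)).obj (op M)).mapHomotopy h).homologyMap_eq n

lemma homCohMap_comp_homCohComap {M M' : ModuleCat.{u} R} (f : M ⟶ M') (φ : K ⟶ L) (n : ℤ) :
    homCohMap M' φ n ≫ homCohComap f L n = homCohComap f K n ≫ homCohMap M φ n := by
  have h := (NatTrans.mapHomologicalComplex
    ((linearCoyoneda R (ModuleCat.{u} R)).map f.op) (ComplexShape.up ℤ)).naturality φ
  exact (HomologicalComplex.homologyMap_comp _ _ _).symm.trans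
    ((congrArg (fun ψ => HomologicalComplex.homologyMap ψ n) h).trans
      (HomologicalComplex.homologyMap_comp _ _ _))

/-- The complex `Hom_R(M, K)`. -/
abbrev homCx (K : CochainComplex (ModuleCat.{u} R) ℤ) : CochainComplex (ModuleCat.{u} R) ℤ :=
  (((linearCoyoneda R (ModuleCat.{u} R)).obj (op M)).mapHomologicalComplex _).obj K

/-- The class of a cocycle in the homology of a complex of modules. -/
def homologyMk (A : CochainComplex (ModuleCat.{u} R) ℤ) (n : ℤ) :
    LinearMap.ker (A.d n (n + 1)).hom →ₗ[R] A.homology n :=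
  (A.liftCycles (ModuleCat.ofHom (LinearMap.ker (A.d n (n + 1)).hom).subtype) (n + 1) (by simp)
    (by ext x; exact x.2) ≫ A.homologyπ n).hom

lemma homologyMk_surjective (A : CochainComplex (ModuleCat.{u} R) ℤ) (n : ℤ) :
    Function.Surjective (homologyMk A n) := by
  intro y
  obtain ⟨z, rfl⟩ := (ModuleCat.epi_iff_surjective (A.homologyπ n)).1 inferInstance y
  refine ⟨⟨A.iCycles n z, ModuleCat.comp_eq_zero_apply (A.iCycles_d n (n + 1)) z⟩, ?_⟩
  rw [homologyMk, ModuleCat.hom_comp, LinearMap.comp_apply]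
  congr 1
  apply (ModuleCat.mono_iff_injective (A.iCycles n)).1 inferInstance
  have := A.liftCycles_i (ModuleCat.ofHom (LinearMap.ker (A.d n (n + 1)).hom).subtype) (n + 1)
    (by simp) (by ext x; exact x.2)
  exact congr($this ⟨A.iCycles n z, ModuleCat.comp_eq_zero_apply (A.iCycles_d n (n + 1)) z⟩)

lemma homologyMk_eq_zero_iff (A : CochainComplex (ModuleCat.{u} R) ℤ) {m n : ℤ} (h : m + 1 = n)
    (x : LinearMap.ker (A.d n (n + 1)).hom) :
    homologyMk A n x = 0 ↔ ∃ y, A.d m n y = x := by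
  have hi := A.liftCycles_i (ModuleCat.ofHom (LinearMap.ker (A.d n (n + 1)).hom).subtype) (n + 1)
    (by simp) (by ext x; exact x.2)
  have hinj := (ModuleCat.mono_iff_injective (A.iCycles n)).1 inferInstance
  have hex := (ShortComplex.moduleCat_exact_iff _).1 (ShortComplex.exact_of_g_is_cokernel
    (ShortComplex.mk (A.toCycles m n) (A.homologyπ n) (by simp))
    (A.homologyIsCokernel m n (by simp; omega)))
  rw [homologyMk, ModuleCat.hom_comp, LinearMap.comp_apply]
  constructor
  · intro hx
    obtain ⟨y, hy⟩ := hex _ hx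
    refine ⟨y, ?_⟩
    rw [← A.toCycles_i m n, ModuleCat.comp_apply]
    exact (congrArg (A.iCycles n) hy).trans congr($hi x)
  · rintro ⟨y, hy⟩
    have h1 : A.liftCycles (ModuleCat.ofHom (LinearMap.ker (A.d n (n + 1)).hom).subtype) (n + 1)
      (by simp) (by ext x; exact x.2) x = A.toCycles m n y := by
      apply hinj
      rw [← ModuleCat.comp_apply, ← ModuleCat.comp_apply, A.toCycles_i, hy]
      exact congr($hi x)
    exact (congrArg (A.homologyπ n) h1).trans
      (ModuleCat.comp_eq_zero_apply (A.toCycles_comp_homologyπ m n) y)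

lemma homologyMap_homologyMk {A B : CochainComplex (ModuleCat.{u} R) ℤ} (φ : A ⟶ B) (n : ℤ)
    (x : LinearMap.ker (A.d n (n + 1)).hom) (h : φ.f n x ∈ LinearMap.ker (B.d n (n + 1)).hom) :
    HomologicalComplex.homologyMap φ n (homologyMk A n x) = homologyMk B n ⟨φ.f n x, h⟩ := by
  have hi := A.liftCycles_i (ModuleCat.ofHom (LinearMap.ker (A.d n (n + 1)).hom).subtype) (n + 1)
    (by simp) (by ext x; exact x.2)
  have hi' := B.liftCycles_i (ModuleCat.ofHom (LinearMap.ker (B.d n (n + 1)).hom).subtype) (n + 1)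
    (by simp) (by ext x; exact x.2)
  rw [homologyMk, homologyMk, ModuleCat.hom_comp, LinearMap.comp_apply, ModuleCat.hom_comp,
    LinearMap.comp_apply]
  have h1 := congr($(HomologicalComplex.homologyπ_naturality φ n) (A.liftCycles
    (ModuleCat.ofHom (LinearMap.ker (A.d n (n + 1)).hom).subtype) (n + 1) (by simp)
    (by ext x; exact x.2) x))
  refine h1.trans (congrArg (B.homologyπ n) ?_)
  apply (ModuleCat.mono_iff_injective (B.iCycles n)).1 inferInstance
  have h2 := HomologicalComplex.cyclesMap_i φ n
  refine (congr($h2 (A.liftCycles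
    (ModuleCat.ofHom (LinearMap.ker (A.d n (n + 1)).hom).subtype) (n + 1) (by simp)
    (by ext x; exact x.2) x))).trans ?_
  exact (congrArg (φ.f n) congr($hi x)).trans congr($hi' ⟨φ.f n x, h⟩).symm

/-- The class in `Hⁿ(Hom_R(M, K))` of a cocycle. -/
def homCoh.mk (n : ℤ) (x : M ⟶ K.X n) (hx : x ≫ K.d n (n + 1) = 0) : homCoh M K n :=
  homologyMk (homCx M K) n ⟨x, hx⟩

namespace homCoh

variable {M}

lemma exists_rep {n : ℤ} (a : homCoh M K n) : ∃ x hx, homCoh.mk M n x hx = a := by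
  obtain ⟨⟨x, hx⟩, rfl⟩ := homologyMk_surjective (homCx M K) n a
  exact ⟨x, hx, rfl⟩

lemma mk_eq_zero_iff {m n : ℤ} (h : m + 1 = n) (x : M ⟶ K.X n) (hx : x ≫ K.d n (n + 1) = 0) :
    homCoh.mk M n x hx = 0 ↔ ∃ y : M ⟶ K.X m, y ≫ K.d m n = x :=
  homologyMk_eq_zero_iff (homCx M K) h ⟨x, hx⟩

lemma mk_eq_mk_iff {m n : ℤ} (h : m + 1 = n) (x x' : M ⟶ K.X n) (hx : x ≫ K.d n (n + 1) = 0)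
    (hx' : x' ≫ K.d n (n + 1) = 0) :
    homCoh.mk M n x hx = homCoh.mk M n x' hx' ↔ ∃ y : M ⟶ K.X m, y ≫ K.d m n = x - x' := by
  have hs : (x - x') ≫ K.d n (n + 1) = 0 := by rw [Preadditive.sub_comp, hx, hx', sub_zero]
  rw [← mk_eq_zero_iff h (x - x') hs, ← sub_eq_zero]
  exact (congrArg (· = 0) (map_sub (homologyMk (homCx M K) n) ⟨x, hx⟩ ⟨x', hx'⟩).symm).to_iff

lemma map_mk (φ : K ⟶ L) (n : ℤ) (x : M ⟶ K.X n) (hx : x ≫ K.d n (n + 1) = 0) :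
    homCohMap M φ n (homCoh.mk M n x hx) = homCoh.mk M n (x ≫ φ.f n)
      (by rw [Category.assoc, φ.comm, reassoc_of% hx, zero_comp]) :=
  homologyMap_homologyMk (A := homCx M K) (B := homCx M L)
    ((((linearCoyoneda R (ModuleCat.{u} R)).obj (op M)).mapHomologicalComplex _).map φ) n ⟨x, hx⟩
    (show (x ≫ φ.f n) ≫ L.d n (n + 1) = 0 by
      rw [Category.assoc, φ.comm, reassoc_of% hx, zero_comp])

lemma comap_mk {M' : ModuleCat.{u} R} (f : M' ⟶ M) (n : ℤ) (x : M ⟶ K.X n)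
    (hx : x ≫ K.d n (n + 1) = 0) :
    homCohComap f K n (homCoh.mk M n x hx) = homCoh.mk M' n (f ≫ x)
      (by rw [Category.assoc, hx, comp_zero]) :=
  homologyMap_homologyMk (A := homCx M K) (B := homCx M' K)
    ((NatTrans.mapHomologicalComplex
      ((linearCoyoneda R (ModuleCat.{u} R)).map f.op) _).app K) n ⟨x, hx⟩
    (show (f ≫ x) ≫ K.d n (n + 1) = 0 by rw [Category.assoc, hx, comp_zero])

/-- A family of maps `K.X n ⟶ L.X (n + 1)` that anticommutes with the differentials induces maps
`Hⁿ(Hom_R(M, K)) ⟶ Hⁿ⁺¹(Hom_R(M, L))`. -/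
lemma exists_connecting (n : ℤ) (ψ : K.X n ⟶ L.X (n + 1))
    (h₁ : ∃ ψ' : K.X (n + 1) ⟶ L.X (n + 1 + 1),
      K.d n (n + 1) ≫ ψ' = -ψ ≫ L.d (n + 1) (n + 1 + 1))
    (h₂ : ∃ ψ' : K.X (n - 1) ⟶ L.X n, K.d (n - 1) n ≫ ψ = ψ' ≫ L.d n (n + 1)) :
    ∃ δ : homCoh M K n ⟶ homCoh M L (n + 1), ∀ (x : M ⟶ K.X n) (hx : x ≫ K.d n (n + 1) = 0)
      (hx' : (x ≫ ψ) ≫ L.d (n + 1) (n + 1 + 1) = 0),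
      δ (homCoh.mk M n x hx) = homCoh.mk M (n + 1) (x ≫ ψ) hx' := by
  obtain ⟨ψ₁, h₁⟩ := h₁
  obtain ⟨ψ₂, h₂⟩ := h₂
  have hz : ∀ x : M ⟶ K.X n, x ≫ K.d n (n + 1) = 0 →
      (x ≫ ψ) ≫ L.d (n + 1) (n + 1 + 1) = 0 := by
    intro x hx
    rw [Category.assoc, ← neg_eq_iff_eq_neg.2 h₁, Preadditive.comp_neg, reassoc_of% hx, zero_comp,
      neg_zero]
  let p := homologyMk (homCx M K) n
  let q : LinearMap.ker ((homCx M K).d n (n + 1)).hom →ₗ[R] homCoh M L (n + 1) :=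
    homologyMk (homCx M L) (n + 1) ∘ₗ
      ((Linear.rightComp R M ψ).restrict (fun x hx => hz x hx))
  -- By `h₂`, `ψ` carries coboundaries to coboundaries, so `q` factors through the quotient by the
  -- kernel of `p`.
  have hpq : LinearMap.ker p ≤ LinearMap.ker q := by
    rintro ⟨x, hx⟩ h
    obtain ⟨y, hy⟩ := (mk_eq_zero_iff (M := M) (K := K) (m := n - 1) (by omega) x hx).1 h
    refine (mk_eq_zero_iff rfl (x ≫ ψ) (hz x hx)).2 ⟨y ≫ ψ₂, ?_⟩
    rw [Category.assoc, ← h₂, reassoc_of% hy]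
  refine ⟨ModuleCat.ofHom ((LinearMap.ker p).liftQ q hpq ∘ₗ
    (p.quotKerEquivOfSurjective (homologyMk_surjective _ n)).symm.toLinearMap),
    fun x hx hx' => ?_⟩
  have h1 : (p.quotKerEquivOfSurjective (homologyMk_surjective _ n)).symm (p ⟨x, hx⟩) =
      Submodule.Quotient.mk ⟨x, hx⟩ := by
    rw [LinearEquiv.symm_apply_eq]
    rfl
  change (LinearMap.ker p).liftQ q hpq ((p.quotKerEquivOfSurjective
    (homologyMk_surjective _ n)).symm (p ⟨x, hx⟩)) = _
  rw [h1]
  rfl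

end homCoh

end HomCohomology

/-! ### Modules of cocycles and the short exact sequences they form. -/

section Cycles

variable {R : Type u} [CommRing R] (K : CochainComplex (ModuleCat.{u} R) ℤ)

/-- The module of cocycles. -/
abbrev cocycles (n : ℤ) : ModuleCat.{u} R := ModuleCat.of R (LinearMap.ker (K.d n (n + 1)).hom)

/-- The inclusion of the cocycles. -/
def cocyclesι (n : ℤ) : cocycles K n ⟶ K.X n :=
  ModuleCat.ofHom (LinearMap.ker (K.d n (n + 1)).hom).subtype

/-- The differential, as a map to the cocycles. -/
def cocyclesπ (m n : ℤ) : K.X m ⟶ cocycles K n :=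
  ModuleCat.ofHom ((K.d m n).hom.codRestrict _ fun _ => CochainComplex.d_d_apply _)

lemma cocyclesι_injective (n : ℤ) : Function.Injective (cocyclesι K n) :=
  Subtype.val_injective

variable {K}

lemma isSES_cocycles {m n : ℤ} (hmn : m + 1 = n) (h : K.ExactAt n) :
    IsSES (cocyclesι K m) (cocyclesπ K m n) where
  injective := cocyclesι_injective K m
  exact x := by
    subst hmn
    constructor
    · intro hx
      exact ⟨⟨x, congrArg Subtype.val hx⟩, rfl⟩
    · rintro ⟨y, rfl⟩
      exact Subtype.ext y.2
  surjective := by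
    rintro ⟨x, hx⟩
    obtain ⟨y, rfl⟩ := (K.exactAt_iff_apply hmn rfl).1 h x hx
    exact ⟨y, rfl⟩

end Cycles

/-! ### Self-orthogonal classes, complete resolutions and the class `𝒢(𝒱)`. -/

section GorensteinModules

variable {R : Type u} [CommRing R] {𝒱 : ObjectProperty (ModuleCat.{u} R)}

/-- A self-orthogonal class: closed under isomorphisms and finite products, and without higher
extensions between its members. -/
structure IsSelfOrthogonal (𝒱 : ObjectProperty (ModuleCat.{u} R)) : Prop where
  of_iso : ∀ {X Y : ModuleCat.{u} R}, (X ≅ Y) → 𝒱 X → 𝒱 Y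
  of_isZero : ∀ {X : ModuleCat.{u} R}, IsZero X → 𝒱 X
  prod : ∀ {X Y : ModuleCat.{u} R}, 𝒱 X → 𝒱 Y → 𝒱 (ModuleCat.of R (X × Y))
  extVanish : ∀ {X Y : ModuleCat.{u} R}, 𝒱 X → 𝒱 Y → ExtVanish X Y

lemma IsTotallyAcyclic.of {W : CochainComplex (ModuleCat.{u} R) ℤ} (mem : ∀ n, 𝒱 (W.X n))
    (exactAt : ∀ n, W.ExactAt n) (lifts : ∀ X, 𝒱 X → LiftsFrom X W)
    (extends_ : ∀ X, 𝒱 X → ExtendsTo W X) : IsTotallyAcyclic 𝒱 W where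
  mem := mem
  exactAt := exactAt
  hom_to_exact X hX n f hf := by
    refine lifts X hX n (n + 1) (n + 2) rfl (by ring) f hf
  hom_from_exact X hX n f hf := by
    refine extends_ X hX (n + 1) (n + 2) (by ring) f fun x hx => ?_
    obtain ⟨y, rfl⟩ := (W.exactAt_iff_apply rfl (by ring)).1 (exactAt (n + 1)) x hx
    exact ModuleCat.comp_eq_zero_apply hf y

/-- A complete resolution of `G`: a totally acyclic complex with `G` as module of cocycles in degree
zero. -/
structure IsCompleteResolution (𝒱 : ObjectProperty (ModuleCat.{u} R)) {G : ModuleCat.{u} R}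
    (S : CochainComplex (ModuleCat.{u} R) ℤ) (ι : G ⟶ S.X 0) : Prop where
  acyclic : IsTotallyAcyclic 𝒱 S
  injective : Function.Injective ι
  exact : Function.Exact ι (S.d 0 1)

/-- The complex `W` with degrees shifted by `k`, without signs. -/
def reindex (W : CochainComplex (ModuleCat.{u} R) ℤ) (k : ℤ) :
    CochainComplex (ModuleCat.{u} R) ℤ where
  X n := W.X (n + k)
  d i j := W.d (i + k) (j + k)
  shape i j hij := W.shape _ _ fun h => hij (by simp at h ⊢; omega)
  d_comp_d' _ _ _ _ _ := W.d_comp_d _ _ _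

lemma IsTotallyAcyclic.reindex {W : CochainComplex (ModuleCat.{u} R) ℤ}
    (hW : IsTotallyAcyclic 𝒱 W) (k : ℤ) : IsTotallyAcyclic 𝒱 (reindex W k) :=
  .of (fun n => hW.mem _)
    (fun n => (CochainComplex.exactAt_iff_apply _ (show n - 1 + 1 = n by ring) rfl).2
      ((W.exactAt_iff_apply (show n - 1 + k + 1 = n + k by ring)
        (show n + k + 1 = n + 1 + k by ring)).1 (hW.exactAt _)))
    (fun X hX l m n hl hm f hf => hW.liftsFrom hX (l + k) (m + k) (n + k) (by omega) (by omega) f hf)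
    (fun X hX m n hm f hf => hW.extendsTo hX (m + k) (n + k) (by omega) f hf)

lemma IsTotallyAcyclic.exists_d_eq {W : CochainComplex (ModuleCat.{u} R) ℤ}
    (hW : IsTotallyAcyclic 𝒱 W) {l m n : ℤ} (hl : l + 1 = m) (hm : m + 1 = n) (x : W.X m)
    (hx : W.d m n x = 0) : ∃ y, W.d l m y = x :=
  (W.exactAt_iff_apply hl hm).1 (hW.exactAt m) x hx

/-- Exactness in degree zero identifies `G` with the image of `S⁻¹ → S⁰` as well. -/
lemma IsCompleteResolution.exists_π {G : ModuleCat.{u} R}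
    {S : CochainComplex (ModuleCat.{u} R) ℤ} {ι : G ⟶ S.X 0} (h : IsCompleteResolution 𝒱 S ι) :
    ∃ π : S.X (-1) ⟶ G, π ≫ ι = S.d (-1) 0 ∧ Function.Surjective π := by
  have : Mono ι := (ModuleCat.mono_iff_injective _).2 h.injective
  have hex : (ShortComplex.mk ι (S.d 0 1) (by ext x; exact (h.exact _).2 ⟨x, rfl⟩)).Exact :=
    (ShortComplex.moduleCat_exact_iff _).2 fun x hx => (h.exact x).1 hx
  have hπ := hex.lift_f (S.d (-1) 0) (by simp)
  refine ⟨hex.lift (S.d (-1) 0) (by simp), hπ, fun g => ?_⟩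
  obtain ⟨y, hy⟩ := h.acyclic.exists_d_eq (show -1 + 1 = (0 : ℤ) by rfl) (zero_add 1) (ι g)
    ((h.exact _).2 ⟨g, rfl⟩)
  refine ⟨y, h.injective ?_⟩
  rw [← hy]
  exact congr($hπ y)

/-- By exactness the cokernel of `W⁻¹ → W⁰` is the module of cocycles in `W¹`, so the two
descriptions differ by a shift of degree by one. -/
lemma gorensteinClass_iff {G : ModuleCat.{u} R} :
    GorensteinClass 𝒱 G ↔ ∃ (S : CochainComplex (ModuleCat.{u} R) ℤ) (ι : G ⟶ S.X 0),
      IsCompleteResolution 𝒱 S ι := by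
  constructor
  · rintro ⟨W, hW, ⟨e⟩⟩
    let j : cokernel (W.d (-1) 0) ⟶ W.X (0 + 1) := cokernel.desc _ (W.d 0 (0 + 1)) (by simp)
    have hj : cokernel.π (W.d (-1) 0) ≫ j = W.d 0 (0 + 1) := cokernel.π_desc _ _ _
    have hs : Function.Surjective (cokernel.π (W.d (-1) 0)) :=
      (ModuleCat.epi_iff_surjective _).1 inferInstance
    refine ⟨reindex W 1, e.hom ≫ j, hW.reindex 1, ?_, ?_⟩
    · have : Function.Injective j := by
        rw [injective_iff_map_eq_zero]
        intro c hc
        obtain ⟨x, rfl⟩ := hs c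
        obtain ⟨y, rfl⟩ := hW.exists_d_eq (show -1 + 1 = (0 : ℤ) by rfl) (zero_add 1) x
          (congr($hj x).symm.trans hc)
        exact ModuleCat.comp_eq_zero_apply (cokernel.condition _) y
      exact this.comp ((ModuleCat.mono_iff_injective _).1 inferInstance)
    · intro x
      constructor
      · intro hx
        obtain ⟨y, rfl⟩ := hW.exists_d_eq rfl (show 0 + 1 + 1 = (1 + 1 : ℤ) by rfl) x hx
        refine ⟨e.inv (cokernel.π (W.d (-1) 0) y), ?_⟩
        exact (congrArg j (e.inv_hom_id_apply _)).trans congr($hj y)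
      · rintro ⟨y, rfl⟩
        obtain ⟨z, hz⟩ := hs (e.hom y)
        change W.d (0 + 1) (1 + 1) (j (e.hom y)) = 0
        rw [← hz]
        have h1 : j (cokernel.π (W.d (-1) 0) z) = W.d 0 (0 + 1) z := congr($hj z)
        rw [h1]
        exact CochainComplex.d_d_apply z
  · rintro ⟨S, ι, h⟩
    obtain ⟨π, hπ, hs⟩ := h.exists_π
    have h0 : ∀ x, π x = 0 ↔ S.d (-1) 0 x = 0 := fun x => by
      rw [← hπ, ModuleCat.comp_apply, map_eq_zero_iff _ h.injective]
    let T := ShortComplex.mk ((reindex S (-1)).d (-1) 0) π (by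
        ext x; exact (h0 _).2 (CochainComplex.d_d_apply (K := S) x))
    have : Epi T.g := (ModuleCat.epi_iff_surjective π).2 hs
    have hex : T.Exact :=
      (ShortComplex.moduleCat_exact_iff _).2 fun x hx =>
        h.acyclic.exists_d_eq (show -1 + -1 + 1 = (0 + -1 : ℤ) by rfl)
          (show 0 + -1 + 1 = (0 : ℤ) by rfl) x ((h0 x).1 hx)
    exact ⟨reindex S (-1), h.acyclic.reindex (-1),
      ⟨hex.gIsCokernel.coconePointUniqueUpToIso (colimit.isColimit _)⟩⟩

lemma GorensteinClass.of_iso {G G' : ModuleCat.{u} R} (e : G ≅ G') (h : GorensteinClass 𝒱 G) :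
    GorensteinClass 𝒱 G' := by
  obtain ⟨W, hW, ⟨i⟩⟩ := h
  exact ⟨W, hW, ⟨e.symm ≪≫ i⟩⟩

/-! ### Extensions of complexes given by an off-diagonal differential. -/

section Twist

variable (A B : CochainComplex (ModuleCat.{u} R) ℤ) (θ : ∀ m n, A.X m ⟶ B.X n)
  (hθ : ∀ l m n, l + 1 = m → m + 1 = n → A.d l m ≫ θ m n + θ l m ≫ B.d m n = 0)

/-- The complex with terms `B.X n × A.X n` and differential `(b, a) ↦ (d b + θ a, d a)`. -/
def twist : CochainComplex (ModuleCat.{u} R) ℤ where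
  X n := ModuleCat.of R (B.X n × A.X n)
  d m n := if m + 1 = n then ModuleCat.ofHom
    (((B.d m n).hom.coprod (θ m n).hom).prod ((A.d m n).hom ∘ₗ LinearMap.snd R _ _)) else 0
  shape _ _ h := if_neg h
  d_comp_d' l m n hl hm := by
    have hl' : l + 1 = m := hl
    have hm' : m + 1 = n := hm
    rw [if_pos hl', if_pos hm']
    refine ModuleCat.hom_ext (LinearMap.ext ?_)
    rintro ⟨b, a⟩
    refine Prod.ext ?_ ?_
    · have h1 := congr($(hθ l m n hl' hm') a)
      refine Eq.trans ?_ h1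
      change B.d m n (B.d l m b + θ l m a) + θ m n (A.d l m a) = _
      rw [map_add, CochainComplex.d_d_apply, zero_add, add_comm]
      rfl
    · exact CochainComplex.d_d_apply a

variable {A B θ}

lemma twist_d_apply {m n : ℤ} (h : m + 1 = n) (b : B.X m) (a : A.X m) :
    (twist A B θ hθ).d m n (b, a) = (B.d m n b + θ m n a, A.d m n a) := by
  simp only [twist, if_pos h]
  rfl

include hθ in
lemma twist_rel_apply {l m n : ℤ} (hl : l + 1 = m) (hm : m + 1 = n) (a : A.X l) :
    θ m n (A.d l m a) = -B.d m n (θ l m a) :=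
  eq_neg_of_add_eq_zero_left congr($(hθ l m n hl hm) a)

/-- `B` is a subcomplex with quotient `A`, split in each degree. Elements and maps into the twist
are lifted in the `A`-coordinate first and then corrected by `θ` in the `B`-coordinate; maps out of
it are extended on `B` first. -/
lemma isTotallyAcyclic_twist (h𝒱 : IsSelfOrthogonal 𝒱) (hA : IsTotallyAcyclic 𝒱 A)
    (hB : IsTotallyAcyclic 𝒱 B) : IsTotallyAcyclic 𝒱 (twist A B θ hθ) := by
  refine .of (fun n => h𝒱.prod (hB.mem n) (hA.mem n)) (fun m => ?_) (fun X hX => ?_)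
    (fun X hX => ?_)
  · rw [CochainComplex.exactAt_iff_apply _ (show m - 1 + 1 = m by ring) rfl]
    rintro ⟨b, a⟩ h
    replace h := Prod.ext_iff.1 ((twist_d_apply hθ rfl b a).symm.trans h)
    obtain ⟨a', rfl⟩ := hA.exists_d_eq (show m - 1 + 1 = m by ring) rfl a h.2
    obtain ⟨b', hb'⟩ := hB.exists_d_eq (show m - 1 + 1 = m by ring) rfl (b - θ (m - 1) m a') (by
      have h1 : B.d m (m + 1) b + θ m (m + 1) (A.d (m - 1) m a') = 0 := h.1
      rwa [twist_rel_apply hθ (by ring) rfl, ← sub_eq_add_neg, ← map_sub] at h1)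
    refine ⟨(b', a'), ?_⟩
    rw [twist_d_apply hθ (by ring), hb', sub_add_cancel]
  · intro l m n hl hm f hf
    let b : X ⟶ B.X m := f ≫ ModuleCat.ofHom (LinearMap.fst R (B.X m) (A.X m))
    let a : X ⟶ A.X m := f ≫ ModuleCat.ofHom (LinearMap.snd R (B.X m) (A.X m))
    have h1 : ∀ x, B.d m n (b x) + θ m n (a x) = 0 ∧ A.d m n (a x) = 0 := fun x => by
      have := congr($hf x)
      rw [ModuleCat.comp_apply] at this
      have h2 := (twist_d_apply hθ hm (b x) (a x)).symm.trans this
      exact Prod.ext_iff.1 h2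
    obtain ⟨a', ha'⟩ := hA.liftsFrom hX l m n hl hm a (by ext x; exact (h1 x).2)
    have ha'' : ∀ x, A.d l m (a' x) = a x := fun x => congr($ha' x)
    obtain ⟨b', hb'⟩ := hB.liftsFrom hX l m n hl hm (b - a' ≫ θ l m) (by
      ext x
      change B.d m n (b x - θ l m (a' x)) = 0
      rw [map_sub, sub_eq_add_neg, ← twist_rel_apply hθ hl hm, ha'']
      exact (h1 x).1)
    have hb'' : ∀ x, B.d l m (b' x) = b x - θ l m (a' x) := fun x => congr($hb' x)
    refine ⟨ModuleCat.ofHom (b'.hom.prod a'.hom), ?_⟩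
    ext x : 2
    change (twist A B θ hθ).d l m (b' x, a' x) = _
    rw [twist_d_apply hθ hl, ha'', hb'', sub_add_cancel]
    rfl
  · intro m n hm f hf
    let φ : B.X m ⟶ X := ModuleCat.ofHom (LinearMap.inl R (B.X m) (A.X m)) ≫ f
    let ψ : A.X m ⟶ X := ModuleCat.ofHom (LinearMap.inr R (B.X m) (A.X m)) ≫ f
    have hf' : ∀ b a, f (b, a) = φ b + ψ a := fun b a => by
      refine (congrArg f ?_).trans (map_add f.hom (b, 0) (0, a))
      exact Prod.ext (add_zero b).symm (zero_add a).symm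
    obtain ⟨φ', hφ'⟩ := hB.extendsTo hX m n hm φ (fun b hb => hf (b, 0) (by
      rw [twist_d_apply hθ hm, hb, map_zero, map_zero, add_zero]; rfl))
    have hφ'' : ∀ b, φ' (B.d m n b) = φ b := fun b => congr($hφ' b)
    obtain ⟨ψ', hψ'⟩ := hA.extendsTo hX m n hm (ψ - θ m n ≫ φ') (fun a ha => by
      change ψ a - φ' (θ m n a) = 0
      -- With `d b = θ a`, the pair `(-b, a)` is a cocycle of the twist lying over `a`, and `f`
      -- vanishes on it.
      obtain ⟨b, hb⟩ := hB.exists_d_eq hm rfl (θ m n a) (by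
        rw [← neg_eq_zero, ← twist_rel_apply hθ hm rfl, ha, map_zero])
      rw [← hb, hφ'']
      have := hf (-b, a) (by
        rw [twist_d_apply hθ hm, map_neg, hb, ha, neg_add_cancel]; rfl)
      rw [hf', map_neg] at this
      rw [← this]; abel)
    have hψ'' : ∀ a, ψ' (A.d m n a) = ψ a - φ' (θ m n a) := fun a => congr($hψ' a)
    refine ⟨ModuleCat.ofHom (φ'.hom.coprod ψ'.hom), ?_⟩
    ext ⟨b, a⟩ : 2
    refine ((congrArg (φ'.hom.coprod ψ'.hom) (twist_d_apply hθ hm b a)).trans ?_).trans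
      (hf' b a).symm
    change φ' (B.d m n b + θ m n a) + ψ' (A.d m n a) = _
    rw [map_add, hφ'', hψ'']
    abel

end Twist

/-! ### The contractible complex that shows `𝒱 ≤ 𝒢(𝒱)`. -/

section Contractible

variable (V : ModuleCat.{u} R)

/-- The submodule of `V × V` that is the first factor in degree `-1`, the second one in degree `0`,
and zero otherwise. -/
def diskX (n : ℤ) : Submodule R (V × V) where
  carrier := {x | (n ≠ -1 → x.1 = 0) ∧ (n ≠ 0 → x.2 = 0)}
  add_mem' := by
    rintro ⟨a, b⟩ ⟨a', b'⟩ h h'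
    exact ⟨fun hn => (congrArg₂ (· + ·) (h.1 hn) (h'.1 hn)).trans (add_zero _),
      fun hn => (congrArg₂ (· + ·) (h.2 hn) (h'.2 hn)).trans (add_zero _)⟩
  zero_mem' := by simp
  smul_mem' := by
    rintro r ⟨a, b⟩ h
    exact ⟨fun hn => (congrArg (r • ·) (h.1 hn)).trans (smul_zero _),
      fun hn => (congrArg (r • ·) (h.2 hn)).trans (smul_zero _)⟩

/-- The complex `V → V` in degrees `-1` and `0`. -/
def disk : CochainComplex (ModuleCat.{u} R) ℤ where
  X n := ModuleCat.of R (diskX V n)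
  d m n := if h : m + 1 = n then ModuleCat.ofHom (LinearMap.codRestrict (diskX V n)
    (((LinearMap.inr R V V) ∘ₗ (LinearMap.fst R V V)) ∘ₗ (diskX V m).subtype)
      (fun x => ⟨fun _ => rfl, fun hn => x.2.1 (by omega)⟩)) else 0
  shape _ _ h := dif_neg h
  d_comp_d' l m n hl hm := by
    rw [dif_pos (show l + 1 = m from hl), dif_pos (show m + 1 = n from hm)]
    rfl

/-- The contraction of the disk complex. -/
def diskS (m n : ℤ) (h : m + 1 = n) : (disk V).X n ⟶ (disk V).X m :=
  ModuleCat.ofHom (LinearMap.codRestrict (diskX V m)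
    (((LinearMap.inl R V V) ∘ₗ (LinearMap.snd R V V)) ∘ₗ (diskX V n).subtype)
      (fun x => ⟨fun hn => x.2.2 (by omega), fun _ => rfl⟩))

variable {V}

lemma disk_contraction {l m n : ℤ} (hl : l + 1 = m) (hm : m + 1 = n) :
    (disk V).d m n ≫ diskS V m n hm + diskS V l m hl ≫ (disk V).d l m = 𝟙 _ := by
  simp only [disk, dif_pos hl, dif_pos hm]
  ext ⟨⟨a, b⟩, hx⟩ : 3
  exact Prod.ext (add_zero a) (zero_add b)

/-- A contractible complex stays exact under every additive functor; its terms here are `V`, `V` and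
zero modules. -/
lemma isTotallyAcyclic_disk (h𝒱 : IsSelfOrthogonal 𝒱) (hV : 𝒱 V) :
    IsTotallyAcyclic 𝒱 (disk V) := by
  refine .of (fun n => ?_) (fun m => ?_) (fun X _ l m n hl hm f hf => ?_)
    (fun X _ m n hm f hf => ?_)
  · by_cases h1 : n = -1
    · refine h𝒱.of_iso (LinearEquiv.toModuleIso (LinearEquiv.ofBijective
        (LinearMap.codRestrict (diskX V n) (LinearMap.inl R V V)
          (fun x => ⟨fun h => absurd h1 h, fun _ => rfl⟩)) ⟨fun x y h => ?_, ?_⟩)) hV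
      · exact congrArg (fun z => z.1.1) h
      · rintro ⟨⟨a, b⟩, hx⟩
        exact ⟨a, Subtype.ext (Prod.ext rfl (hx.2 (by omega)).symm)⟩
    · by_cases h2 : n = 0
      · refine h𝒱.of_iso (LinearEquiv.toModuleIso (LinearEquiv.ofBijective
          (LinearMap.codRestrict (diskX V n) (LinearMap.inr R V V)
            (fun x => ⟨fun _ => rfl, fun h => absurd h2 h⟩)) ⟨fun x y h => ?_, ?_⟩)) hV
        · exact congrArg (fun z => z.1.2) h
        · rintro ⟨⟨a, b⟩, hx⟩
          exact ⟨b, Subtype.ext (Prod.ext (hx.1 (by omega)).symm rfl)⟩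
      · have : Subsingleton (diskX V n) := ⟨by
          rintro ⟨⟨a, b⟩, hx⟩ ⟨⟨a', b'⟩, hx'⟩
          exact Subtype.ext (Prod.ext ((hx.1 h1).trans (hx'.1 h1).symm)
            ((hx.2 h2).trans (hx'.2 h2).symm))⟩
        exact h𝒱.of_isZero (ModuleCat.isZero_of_subsingleton (ModuleCat.of R (diskX V n)))
  · rw [CochainComplex.exactAt_iff_apply _ (show m - 1 + 1 = m by ring) rfl]
    intro x hx
    refine ⟨diskS V (m - 1) m (by ring) x, ?_⟩
    have h := congr($(disk_contraction (V := V) (show m - 1 + 1 = m by ring) rfl) x)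
    rw [ModuleCat.hom_add_apply, ModuleCat.comp_apply, hx, map_zero, zero_add] at h
    exact h
  · refine ⟨f ≫ diskS V l m hl, ?_⟩
    have h := congrArg (fun k => f ≫ k) (disk_contraction (V := V) hl hm)
    simpa [reassoc_of% hf] using h
  · refine ⟨diskS V m n hm ≫ f, ?_⟩
    ext x
    have h := congr($(disk_contraction (V := V) (show m - 1 + 1 = m by ring) hm) x)
    have h2 := hf (diskS V (m - 1) m (by ring) ≫ (disk V).d (m - 1) m <| x)
      (CochainComplex.d_d_apply _)
    conv_rhs => rw [← ModuleCat.id_apply _ x, ← h]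
    exact (add_zero _).symm.trans ((congrArg (_ + ·) h2.symm).trans (map_add f.hom _ _).symm)

lemma IsSelfOrthogonal.le_gorensteinClass (h𝒱 : IsSelfOrthogonal 𝒱) : 𝒱 ≤ GorensteinClass 𝒱 := by
  intro V hV
  rw [gorensteinClass_iff]
  refine ⟨disk V, ModuleCat.ofHom (LinearMap.codRestrict (diskX V 0) (LinearMap.inr R V V)
    (fun x => ⟨fun _ => rfl, fun h => absurd rfl h⟩)), isTotallyAcyclic_disk h𝒱 hV, ?_, ?_⟩
  · intro x y h
    exact congrArg (fun z : diskX V 0 => z.1.2) h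
  · rintro ⟨⟨a, b⟩, hx⟩
    constructor
    · intro _
      exact ⟨b, Subtype.ext (Prod.ext (hx.1 (by omega)).symm rfl)⟩
    · rintro ⟨y, hy⟩
      rw [← hy]
      simp only [disk, zero_add, dite_true]
      rfl

end Contractible

end GorensteinModules

/-! ### `Ext`-vanishing for Gorenstein modules and Auslander–Buchweitz approximation. -/

section Approximation

variable {R : Type u} [CommRing R] {𝒱 : ObjectProperty (ModuleCat.{u} R)}

/-- Exactness of `Hom(V, S)` lifts maps from `V` to the cocycles `Zⁿ⁺¹` along `Sⁿ → Zⁿ⁺¹`, so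
`Ext¹(V, Zⁿ) = 0` for all `n`. Self-orthogonality then shifts `Extⁱ⁺¹(V, Zⁿ)` to `Extⁱ(V, Zⁿ⁺¹)`. -/
lemma IsTotallyAcyclic.extVanish_cocycles (h𝒱 : IsSelfOrthogonal 𝒱)
    {S : CochainComplex (ModuleCat.{u} R) ℤ} (hS : IsTotallyAcyclic 𝒱 S) {V : ModuleCat.{u} R}
    (hV : 𝒱 V) (n : ℤ) : ExtVanish V (cocycles S n) := by
  have key : ∀ (i : ℕ) (n : ℤ), Subsingleton (Abelian.Ext.{u} V (cocycles S n) (i + 1)) := by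
    intro i
    induction i with
    | zero =>
      intro n
      refine (isSES_cocycles rfl (hS.exactAt (n + 1))).subsingleton_ext_one_of_lift (fun c => ?_)
        (h𝒱.extVanish hV (hS.mem n) 1 le_rfl)
      obtain ⟨g, hg⟩ := hS.liftsFrom hV n (n + 1) (n + 1 + 1) rfl rfl (c ≫ cocyclesι S (n + 1)) (by
        ext x
        exact (c x).2)
      exact ⟨g, ModuleCat.hom_ext (LinearMap.ext fun x => Subtype.ext congr($hg x))⟩
    | succ i ih =>
      intro n
      exact (isSES_cocycles rfl (hS.exactAt (n + 1))).subsingleton_ext_of_lift (ih (n + 1))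
        (h𝒱.extVanish hV (hS.mem n) _ (by omega))
  intro i hi
  obtain ⟨j, rfl⟩ := Nat.exists_eq_add_of_le' hi
  exact key j n

namespace IsCompleteResolution

variable {G : ModuleCat.{u} R} {S : CochainComplex (ModuleCat.{u} R) ℤ} {ι : G ⟶ S.X 0}
  (h : IsCompleteResolution 𝒱 S ι)

include h

lemma d_ι_apply (g : G) : S.d 0 1 (ι g) = 0 := (h.exact _).2 ⟨g, rfl⟩

lemma exists_ι_eq (x : S.X 0) (hx : S.d 0 1 x = 0) : ∃ g, ι g = x := (h.exact _).1 hx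

lemma nonempty_iso : Nonempty (G ≅ cocycles S 0) :=
  ⟨LinearEquiv.toModuleIso (LinearEquiv.ofBijective (ι.hom.codRestrict _ h.d_ι_apply)
    ⟨fun _ _ hxy => h.injective (congrArg Subtype.val hxy), fun x => by
      obtain ⟨g, hg⟩ := h.exists_ι_eq x.1 x.2
      exact ⟨g, Subtype.ext hg⟩⟩)⟩

/-- Pulled back along the surjection `S⁻¹ → G`, the map `a` vanishes on cocycles and hence extends
along `S⁻¹ → S⁰`. -/
lemma exists_extend {X : ModuleCat.{u} R} (hX : 𝒱 X) (a : G ⟶ X) : ∃ b : S.X 0 ⟶ X, ι ≫ b = a := by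
  obtain ⟨π, hπ, hs⟩ := h.exists_π
  obtain ⟨b, hb⟩ := h.acyclic.extendsTo hX (-1) 0 rfl (π ≫ a) (fun x hx => by
    have h1 : ι (π x) = 0 := congr($hπ x).trans hx
    rw [ModuleCat.comp_apply, (map_eq_zero_iff _ h.injective).1 h1, map_zero])
  refine ⟨b, ?_⟩
  ext g
  obtain ⟨x, rfl⟩ := hs g
  have h1 : ι (π x) = S.d (-1) 0 x := congr($hπ x)
  exact (congrArg b h1).trans congr($hb x)

end IsCompleteResolution

lemma GorensteinClass.extVanish_left (h𝒱 : IsSelfOrthogonal 𝒱) {V G : ModuleCat.{u} R} (hV : 𝒱 V)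
    (hG : GorensteinClass 𝒱 G) : ExtVanish V G := by
  obtain ⟨S, ι, h⟩ := gorensteinClass_iff.1 hG
  obtain ⟨e⟩ := h.nonempty_iso
  exact (h.acyclic.extVanish_cocycles h𝒱 hV 0).of_iso (Iso.refl _) e.symm

/-- In `0 → Z⁻¹ → S⁻¹ → G → 0`, maps `Z⁻¹ ⟶ V` extend to `S⁻¹` by exactness of `Hom(S, V)`, and
`Ext¹(S⁻¹, V) = 0`. -/
lemma GorensteinClass.subsingleton_ext (h𝒱 : IsSelfOrthogonal 𝒱) {G V : ModuleCat.{u} R}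
    (hG : GorensteinClass 𝒱 G) (hV : 𝒱 V) : Subsingleton (Abelian.Ext.{u} G V 1) := by
  obtain ⟨S, ι, h⟩ := gorensteinClass_iff.1 hG
  obtain ⟨e⟩ := h.nonempty_iso
  have key : Subsingleton (Abelian.Ext.{u} (cocycles S 0) V 1) := by
    refine (isSES_cocycles (show -1 + 1 = (0 : ℤ) by rfl)
      (h.acyclic.exactAt 0)).subsingleton_ext_one_right (fun a => ?_)
      (h𝒱.extVanish (h.acyclic.mem _) hV 1 le_rfl)
    obtain ⟨b, hb⟩ := h.acyclic.extendsTo hV (-2) (-1) rfl (cocyclesπ S (-2) (-1) ≫ a)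
      (fun x hx => by
        rw [ModuleCat.comp_apply, show cocyclesπ S (-2) (-1) x = 0 from Subtype.ext hx, map_zero])
    refine ⟨b, ?_⟩
    ext x
    obtain ⟨y, rfl⟩ := (isSES_cocycles (show -2 + 1 = (-1 : ℤ) by rfl)
      (h.acyclic.exactAt (-1))).surjective x
    exact congr($hb y)
  exact subsingleton_of_forall_eq 0 fun x => by
    have h1 := Subsingleton.elim ((Abelian.Ext.mk₀ e.inv).comp x (zero_add 1)) 0
    have h2 := congrArg (fun z => (Abelian.Ext.mk₀ e.hom).comp z (zero_add 1)) h1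
    simpa using h2

/-- Gorenstein modules are closed under extensions. -/
lemma GorensteinClass.of_isSES (h𝒱 : IsSelfOrthogonal 𝒱) {G' P G : ModuleCat.{u} R}
    {i : G' ⟶ P} {q : P ⟶ G} (h : IsSES i q) (hG' : GorensteinClass 𝒱 G')
    (hG : GorensteinClass 𝒱 G) : GorensteinClass 𝒱 P := by
  obtain ⟨S', ι', hS'⟩ := gorensteinClass_iff.1 hG'
  obtain ⟨S, ι, hS⟩ := gorensteinClass_iff.1 hG
  -- As in the horseshoe lemma, `P` is to become the cocycles of a twist of `S` by `S'`, embedded by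
  -- `p ↦ (e p, ι (q p))`.
  obtain ⟨e, he⟩ := h.exists_extend (hG.subsingleton_ext h𝒱 (hS'.acyclic.mem 0)) ι'
  obtain ⟨c, hc⟩ := h.exists_desc (e ≫ S'.d 0 (0 + 1)) (by
    rw [reassoc_of% he]; ext x; exact hS'.d_ι_apply x)
  -- The sign makes `θ₀ (ι (q p))` cancel `d (e p)`, so that `(e p, ι (q p))` is a cocycle. The
  -- twisting map is then continued from degree zero in both directions.
  obtain ⟨θ₀, hθ₀⟩ := hS.exists_extend (hS'.acyclic.mem _) (-c)
  have hd : ∀ p, S'.d 0 1 (e p) = -θ₀ (ι (q p)) := fun p => by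
    have h1 : θ₀ (ι (q p)) = -c (q p) := congr($hθ₀ (q p))
    rw [h1, neg_neg]
    exact congr($hc p).symm
  obtain ⟨σ, hσ, hσ'⟩ := exists_solution_right S (B := fun n => S'.X (n + 1))
    (fun m n => -S'.d (m + 1) (n + 1)) (fun _ _ _ => 0) 0
    (Function.update (fun n => 0) 0 θ₀) (by simp) (by simp) (fun n _ => hS.acyclic.exactAt n)
    (fun m n hmn _ f hf => hS.acyclic.extendsTo (hS'.acyclic.mem _) m n hmn f hf) (by
      intro x hx
      obtain ⟨g, rfl⟩ := hS.exists_ι_eq x hx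
      obtain ⟨p, rfl⟩ := h.surjective g
      rw [Function.update_self, ModuleCat.hom_neg_apply, ModuleCat.hom_zero_apply, add_zero,
        ← map_neg]
      refine (congrArg (S'.d (0 + 1) (0 + 1 + 1)) (hd p).symm).trans ?_
      exact CochainComplex.d_d_apply _)
  obtain ⟨θ, hθ, hθ'⟩ := exists_solution_left S (B := fun n => S'.X (n + 1))
    (fun m n => -S'.d (m + 1) (n + 1)) (fun _ _ _ => 0) 0 σ (by simp) (by
      intro l m n hl hm _ f hf
      obtain ⟨g, hg⟩ := hS'.acyclic.liftsFrom (hS.acyclic.mem l) (l + 1) (m + 1) (n + 1)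
        (by omega) (by omega) f (by simpa using hf)
      exact ⟨-g, by simp [hg]⟩) (fun m n hm hn => hσ' m n hn hm)
  let Θ : ∀ m n, S.X m ⟶ S'.X n := fun m n =>
    if hmn : m + 1 = n then θ m ≫ (S'.XIsoOfEq hmn).hom else 0
  have hΘ : ∀ l m n, l + 1 = m → m + 1 = n → S.d l m ≫ Θ m n + Θ l m ≫ S'.d m n = 0 := by
    rintro l _ _ rfl rfl
    have h1 := hθ' l (l + 1) rfl
    simp only [Θ, dite_true, HomologicalComplex.XIsoOfEq_rfl, Iso.refl_hom, Category.comp_id, h1]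
    simp
  have hΘ₀ : ∀ x, Θ 0 1 x = θ₀ x := by
    intro x
    have h1 : θ 0 = θ₀ := by rw [hθ 0 le_rfl, hσ 0 le_rfl, Function.update_self]
    simp only [Θ, zero_add, dite_true, h1]
    rfl
  refine gorensteinClass_iff.2 ⟨twist S S' Θ hΘ,
    ModuleCat.ofHom (e.hom.prod (ι.hom ∘ₗ q.hom)), isTotallyAcyclic_twist hΘ h𝒱 hS.acyclic
      hS'.acyclic, ?_, ?_⟩
  · have key : ∀ p, e p = 0 → ι (q p) = 0 → p = 0 := by
      intro p h1 h2
      obtain ⟨g, rfl⟩ := (h.exact p).1 ((map_eq_zero_iff _ hS.injective).1 h2)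
      have h3 : e (i g) = ι' g := congr($he g)
      rw [(map_eq_zero_iff _ hS'.injective).1 (h3.symm.trans h1), map_zero]
    refine (injective_iff_map_eq_zero (e.hom.prod (ι.hom ∘ₗ q.hom))).2 fun p hp => ?_
    exact key p (Prod.ext_iff.1 hp).1 (Prod.ext_iff.1 hp).2
  · rintro ⟨b, a⟩
    constructor
    · intro hx
      have h1 := Prod.ext_iff.1 ((twist_d_apply hΘ (zero_add 1) b a).symm.trans hx)
      obtain ⟨g, rfl⟩ := hS.exists_ι_eq a h1.2
      obtain ⟨p, rfl⟩ := h.surjective g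
      have h2 : S'.d 0 1 b + Θ 0 1 (ι (q p)) = 0 := h1.1
      obtain ⟨g', hg'⟩ := hS'.exists_ι_eq (b - e p) (by
        rw [map_sub, hd, sub_neg_eq_add, ← hΘ₀, h2])
      have h3 : e (i g') = ι' g' := congr($he g')
      refine ⟨p + i g', Prod.ext ?_ ?_⟩
      · change e (p + i g') = b
        rw [map_add, h3, hg']; abel
      · change ι (q (p + i g')) = ι (q p)
        rw [map_add, h.exact.apply_apply_eq_zero, add_zero]
    · rintro ⟨p, hp⟩
      rw [← hp]
      refine (twist_d_apply hΘ (zero_add 1) (e p) (ι (q p))).trans (Prod.ext ?_ (hS.d_ι_apply _))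
      change S'.d 0 1 (e p) + Θ 0 1 (ι (q p)) = 0
      rw [hΘ₀, hd, neg_add_cancel]

/-- The module `K` has a coresolution by modules in `𝒱` with at most `k` non-zero terms. -/
def HasFiniteCoresolution (𝒱 : ObjectProperty (ModuleCat.{u} R)) : ℕ → ModuleCat.{u} R → Prop
  | 0, K => IsZero K
  | k + 1, K => ∃ (A L : ModuleCat.{u} R) (f : K ⟶ A) (g : A ⟶ L),
      IsSES f g ∧ 𝒱 A ∧ HasFiniteCoresolution 𝒱 k L

/-- The coresolution is cut at its cocycles; the degrees `0, …, d` account for `d + 1` terms. -/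
lemma Coresolution.hasFiniteCoresolution {N : ModuleCat.{u} R} (V : Coresolution 𝒱 N) {d : ℕ}
    (hd : ∀ n : ℤ, d < n → IsZero (V.cx.X n)) : HasFiniteCoresolution 𝒱 (d + 1) N := by
  have key : ∀ (k : ℕ) (n : ℤ), n + k = d + 1 → 0 < n →
      HasFiniteCoresolution 𝒱 k (cocycles V.cx n) := by
    intro k
    induction k with
    | zero =>
      intro n hn _
      have := ModuleCat.subsingleton_of_isZero (hd n (by omega))
      exact ModuleCat.isZero_of_subsingleton (cocycles V.cx n)
    | succ k ih =>
      intro n hn hn'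
      exact ⟨_, _, _, _, isSES_cocycles rfl (V.exactAt (n + 1) (by omega)), V.mem n hn'.le,
        ih (n + 1) (by push_cast at hn; omega) (by omega)⟩
  refine ⟨_, _, V.aug, cocyclesπ V.cx 0 1, ⟨V.aug_injective, fun x => ⟨fun hx => ?_, ?_⟩,
    (isSES_cocycles (zero_add 1) (V.exactAt 1 one_pos)).surjective⟩, V.mem 0 le_rfl,
    key d 1 (by ring) one_pos⟩
  · exact V.exists_aug_eq x (congrArg Subtype.val hx)
  · rintro ⟨y, rfl⟩
    exact Subtype.ext (V.d_aug_apply y)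

/-- An infimum of a nonempty family in `ℕ∞` is attained; the family is nonempty since the empty
infimum is `⊤`. -/
lemma exists_coresolution_of_injDim {N : ModuleCat.{u} R} {d : ℕ} (h : injDim 𝒱 N = d) :
    ∃ V : Coresolution 𝒱 N, ∀ n : ℤ, d < n → IsZero (V.cx.X n) := by
  have : Nonempty (Coresolution 𝒱 N) := by
    by_contra hne
    rw [not_nonempty_iff] at hne
    rw [injDim, iInf_of_empty] at h
    exact ENat.top_ne_natCast d h
  obtain ⟨V, hV⟩ := ciInf_mem fun V : Coresolution 𝒱 N =>
    ⨆ (n : ℕ) (_ : ¬ IsZero (V.cx.X (n : ℤ))), (n : ℕ∞)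
  refine ⟨V, fun n hn => ?_⟩
  obtain ⟨k, rfl⟩ := Int.eq_ofNat_of_zero_le (show 0 ≤ n by omega)
  by_contra hk
  have h1 : (k : ℕ∞) ≤ d := by
    rw [← h, injDim, ← hV]
    exact le_iSup₂_of_le k hk le_rfl
  have h2 : k ≤ d := by exact_mod_cast h1
  omega

/-- Auslander–Buchweitz approximation: a module of finite Gorenstein dimension embeds into a
Gorenstein module with cokernel of finite dimension. -/
lemma HasFiniteCoresolution.exists_approximation (h𝒱 : IsSelfOrthogonal 𝒱) :
    ∀ (d : ℕ) (N : ModuleCat.{u} R), HasFiniteCoresolution (GorensteinClass 𝒱) (d + 1) N →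
      ∃ (G K : ModuleCat.{u} R) (f : N ⟶ G) (g : G ⟶ K), IsSES f g ∧ GorensteinClass 𝒱 G ∧
        HasFiniteCoresolution 𝒱 d K := by
  intro d
  induction d with
  | zero =>
    rintro N ⟨G, K, f, g, h, hG, hK⟩
    exact ⟨G, K, f, g, h, hG, hK⟩
  | succ d ih =>
    rintro N ⟨G₀, N₁, f₀, g₀, h₀, hG₀, hN₁⟩
    obtain ⟨G, K, f, g, h, hG, hK⟩ := ih N₁ hN₁
    obtain ⟨S, ι, hS⟩ := gorensteinClass_iff.1 hG
    -- the short exact sequence `0 → Z → S⁻¹ → G → 0`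
    obtain ⟨π, hπ, hs⟩ := hS.exists_π
    have hZ : GorensteinClass 𝒱 (cocycles S (-1)) := by
      have h1 := hS.acyclic.reindex (-1)
      exact gorensteinClass_iff.2 ⟨reindex S (-1), cocyclesι S (-1), h1,
        cocyclesι_injective S (-1), fun x => ⟨fun hx => ⟨⟨x, hx⟩, rfl⟩, by
          rintro ⟨y, rfl⟩; exact y.2⟩⟩
    have hker : ∀ x, π x = 0 ↔ S.d (-1) 0 x = 0 := fun x => by
      rw [← hπ, ModuleCat.comp_apply, map_eq_zero_iff _ hS.injective]
    -- `K'` is the preimage of `N₁` under `S⁻¹ → G`, and `P` below is the fibre product of `G₀` and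
    -- `K'` over `N₁`. Its two projections give `0 → N → P → K' → 0` and `0 → Z → P → G₀ → 0`.
    let K' := LinearMap.ker (π ≫ g).hom
    have hp : ∀ x : K', ∃ n, f n = π x.1 := fun x => (h.exact _).1 x.2
    let P : Submodule R (G₀ × K') :=
      LinearMap.ker ((f.hom ∘ₗ g₀.hom).coprod (-(π.hom ∘ₗ K'.subtype)))
    have hP : ∀ x : G₀ × K', x ∈ P ↔ f (g₀ x.1) = π x.2.1 := fun x => by
      rw [LinearMap.mem_ker]
      change f (g₀ x.1) + -π x.2.1 = 0 ↔ _
      rw [← sub_eq_add_neg, sub_eq_zero]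
    have hfg : ∀ n, g₀ (f₀ n) = 0 := h₀.exact.apply_apply_eq_zero
    refine ⟨ModuleCat.of R P, ModuleCat.of R K',
      ModuleCat.ofHom (LinearMap.codRestrict P (f₀.hom.prod 0) fun n => (hP _).2 ?_),
      ModuleCat.ofHom (LinearMap.snd R G₀ K' ∘ₗ P.subtype), ⟨?_, ?_, ?_⟩, ?_, ?_⟩
    · change f (g₀ (f₀ n)) = π 0
      rw [hfg, map_zero, map_zero]
    · intro x y hxy
      exact h₀.injective (congrArg (fun z : P => z.1.1) hxy)
    · rintro ⟨⟨a, b⟩, hx⟩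
      constructor
      · intro hb
        obtain rfl : b = 0 := hb
        have h1 : f (g₀ a) = π 0 := (hP _).1 hx
        rw [map_zero] at h1
        obtain ⟨n, rfl⟩ := (h₀.exact a).1 ((map_eq_zero_iff _ h.injective).1 h1)
        exact ⟨n, rfl⟩
      · rintro ⟨n, hn⟩
        exact congrArg (fun z : P => z.1.2) hn.symm
    · intro b
      obtain ⟨n, hn⟩ := hp b
      obtain ⟨a, rfl⟩ := h₀.surjective n
      exact ⟨⟨(a, b), (hP _).2 hn⟩, rfl⟩
    -- `P` is an extension of the Gorenstein module `G₀` by the Gorenstein module `Z`.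
    · refine GorensteinClass.of_isSES h𝒱 (G' := cocycles S (-1)) (G := G₀)
        (i := ModuleCat.ofHom (LinearMap.codRestrict P (LinearMap.prod 0
          (LinearMap.codRestrict K' (cocyclesι S (-1)).hom fun x => ?_)) fun x => (hP _).2 ?_))
        (q := ModuleCat.ofHom (LinearMap.fst R G₀ K' ∘ₗ P.subtype)) ⟨?_, ?_, ?_⟩ hZ hG₀
      · change g (π x.1) = 0
        rw [(hker _).2 x.2, map_zero]
      · change f (g₀ 0) = π x.1
        rw [(hker _).2 x.2, map_zero, map_zero]
      · intro x y hxy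
        exact Subtype.ext (congrArg (fun z : P => z.1.2.1) hxy)
      · rintro ⟨⟨a, b⟩, hx⟩
        constructor
        · intro ha
          obtain rfl : a = 0 := ha
          have h1 : f (g₀ 0) = π b.1 := (hP _).1 hx
          rw [map_zero, map_zero] at h1
          exact ⟨⟨b.1, (hker _).1 h1.symm⟩, rfl⟩
        · rintro ⟨n, hn⟩
          exact congrArg (fun z : P => z.1.1) hn.symm
      · intro a
        obtain ⟨v, hv⟩ := hs (f (g₀ a))
        refine ⟨⟨(a, ⟨v, ?_⟩), (hP _).2 hv.symm⟩, rfl⟩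
        change g (π v) = 0
        rw [hv]
        exact h.exact.apply_apply_eq_zero _
    -- The sequence `0 → K' → S⁻¹ → K → 0` adds one term of `𝒱` to the coresolution of `K`.
    · refine ⟨S.X (-1), K, ModuleCat.ofHom K'.subtype, π ≫ g, ⟨Subtype.val_injective, ?_, ?_⟩,
        hS.acyclic.mem _, hK⟩
      · intro x
        exact ⟨fun hx => ⟨⟨x, hx⟩, rfl⟩, by rintro ⟨y, rfl⟩; exact y.2⟩
      · exact h.surjective.comp hs

end Approximation

/-! ### Splicing coresolutions, and a criterion for properness. -/

section Splice

variable {R : Type u} [CommRing R] {𝒱 𝒴 : ObjectProperty (ModuleCat.{u} R)}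

lemma IsSelfOrthogonal.of_linearEquiv (h𝒱 : IsSelfOrthogonal 𝒱) {X Y : ModuleCat.{u} R}
    (e : X ≃ₗ[R] Y) (hX : 𝒱 X) : 𝒱 Y :=
  h𝒱.of_iso e.toModuleIso hX

section

variable {N A L : ModuleCat.{u} R} {f : N ⟶ A} {g : A ⟶ L} (h : IsSES f g)
  (V : Coresolution 𝒱 L)

/-- The module `A`, as a complex concentrated in degree zero. -/
abbrev singleZero (A : ModuleCat.{u} R) : CochainComplex (ModuleCat.{u} R) ℤ :=
  (HomologicalComplex.single (ModuleCat.{u} R) (ComplexShape.up ℤ) 0).obj A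

/-- The identification of the term of degree zero. -/
abbrev singleZeroIso (A : ModuleCat.{u} R) : (singleZero A).X 0 ≅ A :=
  HomologicalComplex.singleObjXSelf (ComplexShape.up ℤ) 0 A

lemma isZero_singleZero (A : ModuleCat.{u} R) {n : ℤ} (hn : n ≠ 0) : IsZero ((singleZero A).X n) :=
  HomologicalComplex.isZero_single_obj_X _ _ _ _ hn

variable (g) in
/-- The map splicing `A → L` with a coresolution of `L`. -/
def spliceMap (m n : ℤ) : (singleZero A).X m ⟶ (reindex V.cx (-1)).X n :=
  if h : m = 0 ∧ n = 1 then
    ((singleZero A).XIsoOfEq h.1).hom ≫ (singleZeroIso A).hom ≫ g ≫ V.aug ≫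
      (V.cx.XIsoOfEq (by omega : 0 = n + -1)).hom
  else 0

lemma spliceMap_zero_one (a : (singleZero A).X 0) :
    spliceMap g V 0 1 a = V.aug (g ((singleZeroIso A).hom a)) := by
  rw [spliceMap, dif_pos ⟨rfl, rfl⟩]
  rfl

lemma spliceMap_rel (l m n : ℤ) (_ : l + 1 = m) (_ : m + 1 = n) :
    (singleZero A).d l m ≫ spliceMap g V m n + spliceMap g V l m ≫ (reindex V.cx (-1)).d m n = 0 := by
  rw [HomologicalComplex.single_obj_d, zero_comp, zero_add]
  by_cases h : l = 0
  · obtain rfl := h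
    obtain rfl : m = 1 := by omega
    obtain rfl : n = 2 := by omega
    ext x
    exact (congrArg (V.cx.d 0 1) (spliceMap_zero_one V x)).trans (V.d_aug_apply _)
  · rw [spliceMap, dif_neg (fun h' => h h'.1), zero_comp]

variable (g) in
/-- The complex `A → V⁰ → V¹ → ⋯`. -/
abbrev spliceCx : CochainComplex (ModuleCat.{u} R) ℤ :=
  twist (singleZero A) (reindex V.cx (-1)) (spliceMap g V) (spliceMap_rel V)

lemma spliceCx_mem (h𝒱 : IsSelfOrthogonal 𝒱) {n : ℤ} (hn : 0 < n) : 𝒱 ((spliceCx g V).X n) :=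
  h𝒱.prod (V.mem _ (by omega)) (h𝒱.of_isZero (isZero_singleZero A hn.ne'))

lemma spliceCx_isZero {n : ℤ} (hn : n ≠ 0) (hV : IsZero (V.cx.X (n - 1))) :
    IsZero ((spliceCx g V).X n) := by
  have h1 := ModuleCat.subsingleton_of_isZero hV
  have h2 := ModuleCat.subsingleton_of_isZero (isZero_singleZero A hn)
  exact ModuleCat.isZero_of_subsingleton
    (ModuleCat.of R (V.cx.X (n - 1) × (singleZero A).X n))

/-- The coresolution `0 → N → A → V⁰ → V¹ → ⋯` obtained from `0 → N → A → L → 0` and a coresolution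
of `L`. -/
def Coresolution.splice (hA : 𝒴 A) (h𝒴 : ∀ {X Y : ModuleCat.{u} R}, (X ≅ Y) → 𝒴 X → 𝒴 Y)
    (h𝒱 : IsSelfOrthogonal 𝒱) (h𝒱𝒴 : 𝒱 ≤ 𝒴) : Coresolution 𝒴 N where
  cx := spliceCx g V
  aug := ModuleCat.ofHom (LinearMap.prod 0 (f ≫ (singleZeroIso A).inv).hom)
  mem n hn := by
    rcases hn.eq_or_lt with rfl | hn
    · have h1 := ModuleCat.subsingleton_of_isZero (V.isZero (-1) (by norm_num))
      refine h𝒴 (X := A) (LinearEquiv.toModuleIso (LinearEquiv.ofBijective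
        (LinearMap.prod 0 (singleZeroIso A).inv.hom) ⟨fun x y hxy => ?_, ?_⟩)) hA
      · exact ((ModuleCat.mono_iff_injective (singleZeroIso A).inv).1 inferInstance)
          (Prod.ext_iff.1 hxy).2
      · rintro ⟨b, a⟩
        exact ⟨(singleZeroIso A).hom a, Prod.ext (@Subsingleton.elim _ h1 _ _)
          ((singleZeroIso A).hom_inv_id_apply a)⟩
    · exact h𝒱𝒴 _ (spliceCx_mem V h𝒱 hn)
  isZero n hn := spliceCx_isZero V hn.ne (V.isZero _ (by omega))
  aug_comp := by
    refine ModuleCat.hom_ext (LinearMap.ext fun x => ?_)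
    refine (twist_d_apply (spliceMap_rel V) (zero_add 1) 0 ((singleZeroIso A).inv (f x))).trans
      (Prod.ext ?_ ?_)
    · change (reindex V.cx (-1)).d 0 1 0 + spliceMap g V 0 1 ((singleZeroIso A).inv (f x)) = 0
      rw [map_zero, zero_add, spliceMap_zero_one, (singleZeroIso A).inv_hom_id_apply,
        h.exact.apply_apply_eq_zero]
      exact map_zero _
    · rw [HomologicalComplex.single_obj_d]
      rfl
  mono_aug := by
    refine (ModuleCat.mono_iff_injective _).2 fun x y hxy => h.injective ?_
    exact ((ModuleCat.mono_iff_injective (singleZeroIso A).inv).1 inferInstance)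
      (Prod.ext_iff.1 hxy).2
  exact_zero := by
    rw [ShortComplex.moduleCat_exact_iff]
    rintro ⟨b, a⟩ hx
    have h1 := ModuleCat.subsingleton_of_isZero (V.isZero (-1) (by norm_num))
    obtain rfl : b = 0 := @Subsingleton.elim _ h1 _ _
    have h2 := Prod.ext_iff.1 ((twist_d_apply (spliceMap_rel V) (zero_add 1) 0 a).symm.trans hx)
    have h3 : (reindex V.cx (-1)).d 0 1 0 + spliceMap g V 0 1 a = 0 := h2.1
    rw [map_zero, zero_add, spliceMap_zero_one] at h3
    obtain ⟨x, hx⟩ := (h.exact _).1 ((map_eq_zero_iff _ V.aug_injective).1 h3)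
    refine ⟨x, Prod.ext rfl ?_⟩
    change (singleZeroIso A).inv (f x) = a
    rw [hx]
    exact (singleZeroIso A).hom_inv_id_apply a
  exactAt n hn := by
    obtain ⟨m, rfl⟩ : ∃ m, n = m + 1 := ⟨n - 1, by ring⟩
    rw [CochainComplex.exactAt_iff_apply _ rfl rfl]
    rintro ⟨b, a⟩ hx
    have ha := ModuleCat.eq_zero_of_isZero (isZero_singleZero A hn.ne')
    obtain rfl : a = 0 := ha a
    have h2 := Prod.ext_iff.1 ((twist_d_apply (spliceMap_rel V) rfl b 0).symm.trans hx)
    have h3 : (reindex V.cx (-1)).d (m + 1) (m + 1 + 1) b +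
      spliceMap g V (m + 1) (m + 1 + 1) 0 = 0 := h2.1
    rw [map_zero, add_zero] at h3
    by_cases hm : m = 0
    · subst hm
      obtain ⟨l, hl⟩ := V.exists_aug_eq b h3
      obtain ⟨c, rfl⟩ := h.surjective l
      refine ⟨((0 : V.cx.X (0 + -1)), (singleZeroIso A).inv c), ?_⟩
      refine (twist_d_apply (spliceMap_rel V) rfl _ _).trans (Prod.ext ?_ (ha _))
      change (reindex V.cx (-1)).d 0 1 0 + spliceMap g V 0 1 ((singleZeroIso A).inv c) = b
      rw [map_zero, zero_add, spliceMap_zero_one, (singleZeroIso A).inv_hom_id_apply]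
      exact hl
    · obtain ⟨c, hc⟩ := (V.cx.exactAt_iff_apply (show m + -1 + 1 = m + 1 + -1 by ring)
        (show m + 1 + -1 + 1 = m + 1 + 1 + -1 by ring)).1 (V.exactAt _ (by omega)) b h3
      refine ⟨(c, (0 : (singleZero A).X m)), ?_⟩
      refine (twist_d_apply (spliceMap_rel V) rfl _ _).trans (Prod.ext ?_ (ha _))
      change (reindex V.cx (-1)).d m (m + 1) c + spliceMap g V m (m + 1) 0 = b
      rw [map_zero, add_zero]
      exact hc

end

lemma HasFiniteCoresolution.exists_coresolution (h𝒱 : IsSelfOrthogonal 𝒱) :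
    ∀ {k : ℕ} {K : ModuleCat.{u} R}, HasFiniteCoresolution 𝒱 k K →
      ∃ V : Coresolution 𝒱 K, ∀ n : ℤ, k ≤ n → IsZero (V.cx.X n)
  | 0, K, hK => by
    have hz : ∀ n, IsZero ((singleZero K).X n) := fun n => by
      by_cases hn : n = 0
      · subst hn
        exact hK.of_iso (singleZeroIso K)
      · exact isZero_singleZero K hn
    exact ⟨{  cx := singleZero K
              aug := 0
              mem := fun n _ => h𝒱.of_isZero (hz n)
              isZero := fun n _ => hz n
              aug_comp := zero_comp
              mono_aug := ⟨fun _ _ _ => hK.eq_of_tgt _ _⟩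
              exact_zero := ShortComplex.exact_of_isZero_X₂ _ (hz 0)
              exactAt := fun n _ => ShortComplex.exact_of_isZero_X₂ _ (hz n) },
      fun n _ => hz n⟩
  | k + 1, K, ⟨A, L, f, g, h, hA, hL⟩ => by
    obtain ⟨V, hV⟩ := HasFiniteCoresolution.exists_coresolution h𝒱 hL
    refine ⟨Coresolution.splice h V hA h𝒱.of_iso h𝒱 le_rfl, fun n hn => ?_⟩
    push_cast at hn
    exact spliceCx_isZero V (by omega) (hV _ (by omega))

/-- A module of finite Gorenstein dimension has a coresolution whose terms in positive degrees lie
in `𝒱`. -/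
lemma exists_coresolution_of_hasFiniteCoresolution (h𝒱 : IsSelfOrthogonal 𝒱) {N : ModuleCat.{u} R}
    {d : ℕ} (hN : HasFiniteCoresolution (GorensteinClass 𝒱) (d + 1) N) :
    ∃ Y : Coresolution (GorensteinClass 𝒱) N, (∀ n : ℤ, 0 < n → 𝒱 (Y.cx.X n)) ∧
      ∀ n : ℤ, d < n → IsZero (Y.cx.X n) := by
  obtain ⟨G, K, f, g, h, hG, hK⟩ := HasFiniteCoresolution.exists_approximation h𝒱 d N hN
  obtain ⟨V, hV⟩ := hK.exists_coresolution h𝒱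
  exact ⟨Coresolution.splice h V hG GorensteinClass.of_iso h𝒱 h𝒱.le_gorensteinClass,
    fun n hn => spliceCx_mem V h𝒱 hn, fun n hn => spliceCx_isZero V (by omega) (hV _ (by omega))⟩

/-- Descending induction from degrees above `d`, where the cocycles vanish, along `0 → Zⁿ → Yⁿ →
Zⁿ⁺¹ → 0`. -/
lemma Coresolution.extVanish_cocycles {N X : ModuleCat.{u} R} (Y : Coresolution 𝒴 N) {d : ℤ}
    (hd : ∀ n, d < n → IsZero (Y.cx.X n)) (hX : ∀ n, 0 < n → ExtVanish (Y.cx.X n) X) {n : ℤ}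
    (hn : 0 < n) : ExtVanish (cocycles Y.cx n) X := by
  have key : ∀ (k : ℕ) (n : ℤ), d < n + k → 0 < n → ExtVanish (cocycles Y.cx n) X := by
    intro k
    induction k with
    | zero =>
      intro n hn _
      have := ModuleCat.subsingleton_of_isZero (hd n (by simpa using hn))
      exact .of_isZero (ModuleCat.isZero_of_subsingleton (cocycles Y.cx n))
    | succ k ih =>
      intro n hn hn'
      exact (isSES_cocycles rfl (Y.exactAt (n + 1) (by omega))).extVanish_left (hX n hn')
        (ih (n + 1) (by push_cast at hn; omega) (by omega))
  exact key (d - n + 1).toNat n (by omega) hn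

lemma Coresolution.isSES_aug {N : ModuleCat.{u} R} (Y : Coresolution 𝒴 N) :
    IsSES Y.aug (cocyclesπ Y.cx 0 1) where
  injective := Y.aug_injective
  exact x := by
    constructor
    · intro hx
      exact Y.exists_aug_eq x (congrArg Subtype.val hx)
    · rintro ⟨y, rfl⟩
      exact Subtype.ext (Y.d_aug_apply y)
  surjective := (isSES_cocycles (zero_add 1) (Y.exactAt 1 one_pos)).surjective

/-- All the short exact pieces have a quotient `Zⁿ` with `n > 0`, and `Ext¹(Zⁿ, X) = 0` keeps them
exact under `Hom(-, X)`. Only terms in positive degrees matter, so `Y⁰` may be any Gorenstein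
module. -/
lemma Coresolution.isProper_of_extVanish {N : ModuleCat.{u} R} (Y : Coresolution 𝒴 N) {d : ℤ}
    (hd : ∀ n, d < n → IsZero (Y.cx.X n))
    (hY : ∀ n, 0 < n → ∀ X, 𝒴 X → ExtVanish (Y.cx.X n) X) : Y.IsProper := by
  have h1 : ∀ X, 𝒴 X → ∀ n, 0 < n → Subsingleton (Abelian.Ext.{u} (cocycles Y.cx n) X 1) :=
    fun X hX n hn => Y.extVanish_cocycles hd (fun n hn => hY n hn X hX) hn 1 le_rfl
  have key : ∀ X, 𝒴 X → ∀ n : ℤ, 0 ≤ n → ∀ c : cocycles Y.cx (n + 1) ⟶ X,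
      ∃ b : Y.cx.X (n + 1) ⟶ X, cocyclesι Y.cx (n + 1) ≫ b = c := fun X hX n hn c =>
    (isSES_cocycles rfl (Y.exactAt (n + 1 + 1) (by omega))).exists_extend
      (h1 X hX _ (by omega)) c
  refine ⟨fun X hX f => Y.isSES_aug.exists_extend (h1 X hX 1 one_pos) f, fun X hX f hf => ?_,
    fun X hX n hn f hf => ?_⟩
  · obtain ⟨c, rfl⟩ := Y.isSES_aug.exists_desc f hf
    obtain ⟨b, rfl⟩ := key X hX 0 le_rfl c
    exact ⟨b, rfl⟩
  · obtain ⟨c, rfl⟩ := (isSES_cocycles (show n + 1 + 1 = n + 2 by ring)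
      (Y.exactAt (n + 2) (by omega))).exists_desc f (by
        ext x
        obtain ⟨y, rfl⟩ := (isSES_cocycles rfl (Y.exactAt (n + 1) (by omega))).surjective x
        exact congr($hf y))
    obtain ⟨b, hb⟩ := (isSES_cocycles rfl (Y.exactAt (n + 2 + 1) (by omega))).exists_extend
      (h1 X hX _ (by omega)) c
    exact ⟨b, by rw [← hb]; rfl⟩

end Splice

/-! ### The explicit Tate coresolution built from an approximation. -/

section ApproximationData

variable {R : Type u} [CommRing R]

/-- Resolutions of `N` from which a Tate coresolution can be written down: a proper coresolution `Y`
of length `d` by Gorenstein modules, with terms in `𝒱` in positive degrees, a complete resolution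
`S` of `Y⁰`, and an extension `φ` of `Y⁰ → Y¹` to a chain map from `S` to a shift of `Y`, in
nonnegative degrees. -/
structure ApproximationData (𝒱 : ObjectProperty (ModuleCat.{u} R)) (N : ModuleCat.{u} R)
    (d : ℕ) where
  Y : Coresolution (GorensteinClass 𝒱) N
  proper : Y.IsProper
  mem : ∀ n : ℤ, 0 < n → 𝒱 (Y.cx.X n)
  isZero : ∀ n : ℤ, d < n → IsZero (Y.cx.X n)
  S : CochainComplex (ModuleCat.{u} R) ℤ
  ι : Y.cx.X 0 ⟶ S.X 0
  complete : IsCompleteResolution 𝒱 S ι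
  φ : ∀ m n, S.X m ⟶ Y.cx.X n
  ι_φ : ι ≫ φ 0 1 = Y.cx.d 0 1
  d_φ : ∀ l m n : ℤ, 0 ≤ l → l + 1 = m → m + 1 = n → S.d l m ≫ φ m n = -(φ l m ≫ Y.cx.d m n)

variable {𝒱 : ObjectProperty (ModuleCat.{u} R)} {N : ModuleCat.{u} R} {d : ℕ}

lemma ApproximationData.nonempty (h𝒱 : IsSelfOrthogonal 𝒱)
    (hN : injDim (GorensteinClass 𝒱) N = d) : Nonempty (ApproximationData 𝒱 N d) := by
  obtain ⟨V, hV⟩ := exists_coresolution_of_injDim hN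
  obtain ⟨Y, hY, hYz⟩ := exists_coresolution_of_hasFiniteCoresolution h𝒱
    (V.hasFiniteCoresolution hV)
  obtain ⟨S, ι, hS⟩ := gorensteinClass_iff.1 (Y.mem 0 le_rfl)
  obtain ⟨φ₀, hφ₀⟩ := hS.exists_extend (hY (0 + 1) (by norm_num)) (Y.cx.d 0 (0 + 1))
  -- The target is `Y` shifted by one with negated differential, which accounts for the sign in
  -- `d_φ`. Only nonnegative degrees are built, since nothing would allow lifting along `Y`.
  obtain ⟨σ, hσ, hσ'⟩ := exists_solution_right S (B := fun n => Y.cx.X (n + 1))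
    (fun m n => -Y.cx.d (m + 1) (n + 1)) (fun _ _ _ => 0) 0
    (Function.update (fun n => 0) 0 φ₀) (by simp) (by simp) (fun n _ => hS.acyclic.exactAt n)
    (fun m n hmn hm f hf => hS.acyclic.extendsTo (hY _ (by omega)) m n hmn f hf) (by
      intro x hx
      obtain ⟨g, rfl⟩ := hS.exists_ι_eq x hx
      have h1 : φ₀ (ι g) = Y.cx.d 0 (0 + 1) g := congr($hφ₀ g)
      rw [Function.update_self, ModuleCat.hom_neg_apply, ModuleCat.hom_zero_apply, add_zero, h1,
        CochainComplex.d_d_apply, neg_zero])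
  refine ⟨⟨Y, Y.isProper_of_extVanish hYz fun n hn X hX =>
    GorensteinClass.extVanish_left h𝒱 (hY n hn) hX, hY, hYz, S, ι, hS,
    fun m n => if h : m + 1 = n then σ m ≫ (Y.cx.XIsoOfEq h).hom else 0, ?_, ?_⟩⟩
  · have h1 : σ 0 = φ₀ := by rw [hσ 0 le_rfl, Function.update_self]
    rw [dif_pos (zero_add 1), h1, ← Category.assoc, hφ₀]
    rfl
  · rintro l _ _ hl rfl rfl
    have h1 := hσ' l (l + 1) rfl hl
    simp only [dite_true, HomologicalComplex.XIsoOfEq_rfl, Iso.refl_hom, Category.comp_id, h1]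
    simp

namespace ApproximationData

variable (E : ApproximationData 𝒱 N d)

/-- The submodule `S⁰` of `S⁰ × Y⁰` in degree zero, everything in positive degrees, and zero in
negative degrees. -/
def mapX (n : ℤ) : Submodule R (E.S.X n × E.Y.cx.X n) where
  carrier := {x | (n < 0 → x.1 = 0) ∧ (n ≤ 0 → x.2 = 0)}
  add_mem' h h' := ⟨fun hn => (congrArg₂ (· + ·) (h.1 hn) (h'.1 hn)).trans (add_zero _),
      fun hn => (congrArg₂ (· + ·) (h.2 hn) (h'.2 hn)).trans (add_zero _)⟩
  zero_mem' := ⟨fun _ => rfl, fun _ => rfl⟩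
  smul_mem' r _ h := ⟨fun hn => (congrArg (r • ·) (h.1 hn)).trans (smul_zero _),
      fun hn => (congrArg (r • ·) (h.2 hn)).trans (smul_zero _)⟩

lemma d_φ_apply {l m n : ℤ} (hl : 0 ≤ l) (hm : l + 1 = m) (hn : m + 1 = n) (x : E.S.X l) :
    E.φ m n (E.S.d l m x) = -E.Y.cx.d m n (E.φ l m x) :=
  congr($(E.d_φ l m n hl hm hn) x)

lemma φ_ι_apply (x : E.Y.cx.X 0) : E.φ 0 1 (E.ι x) = E.Y.cx.d 0 1 x := congr($(E.ι_φ) x)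

/-- The complex `S⁰ → S¹ × Y¹ → S² × Y² → ⋯` with differential `(s, y) ↦ (d s, φ s + d y)`. -/
def mapCx : CochainComplex (ModuleCat.{u} R) ℤ where
  X n := ModuleCat.of R (E.mapX n)
  d m n := if h : m + 1 = n then ModuleCat.ofHom (LinearMap.codRestrict (E.mapX n)
    ((((E.S.d m n).hom ∘ₗ LinearMap.fst R _ _).prod
      ((E.φ m n).hom.coprod (E.Y.cx.d m n).hom)) ∘ₗ (E.mapX m).subtype)
      (fun x => ⟨fun hn => (congrArg (E.S.d m n) (x.2.1 (by omega))).trans (map_zero _),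
        fun hn => (congrArg₂ (fun s y => E.φ m n s + E.Y.cx.d m n y) (x.2.1 (by omega))
          (x.2.2 (by omega))).trans (by rw [map_zero, map_zero, add_zero])⟩)) else 0
  shape _ _ h := dif_neg h
  d_comp_d' l m n hl hm := by
    have hl' : l + 1 = m := hl
    have hm' : m + 1 = n := hm
    rw [dif_pos hl', dif_pos hm']
    refine ModuleCat.hom_ext (LinearMap.ext ?_)
    rintro ⟨⟨s, y⟩, hx⟩
    refine Subtype.ext (Prod.ext (CochainComplex.d_d_apply s) ?_)
    change E.φ m n (E.S.d l m s) + E.Y.cx.d m n (E.φ l m s + E.Y.cx.d l m y) = 0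
    rw [map_add, CochainComplex.d_d_apply, add_zero]
    by_cases h : 0 ≤ l
    · rw [E.d_φ_apply h hl' hm', neg_add_cancel]
    · obtain rfl : s = 0 := hx.1 (by omega)
      simp

/-- The first projection. -/
def fst (n : ℤ) : E.mapCx.X n ⟶ E.S.X n :=
  ModuleCat.ofHom (LinearMap.fst R _ _ ∘ₗ (E.mapX n).subtype)

/-- The second projection. -/
def snd (n : ℤ) : E.mapCx.X n ⟶ E.Y.cx.X n :=
  ModuleCat.ofHom (LinearMap.snd R _ _ ∘ₗ (E.mapX n).subtype)

variable {E}

lemma mapCx_ext {n : ℤ} {x x' : E.mapCx.X n} (h : E.fst n x = E.fst n x')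
    (h' : E.snd n x = E.snd n x') : x = x' :=
  Subtype.ext (Prod.ext h h')

lemma mapCx_hom_ext {M : ModuleCat.{u} R} {n : ℤ} {f f' : M ⟶ E.mapCx.X n}
    (h : f ≫ E.fst n = f' ≫ E.fst n) (h' : f ≫ E.snd n = f' ≫ E.snd n) : f = f' := by
  ext x : 2
  exact mapCx_ext congr($h x) congr($h' x)

lemma fst_eq_zero {n : ℤ} (hn : n < 0) : E.fst n = 0 := by
  ext x
  exact x.2.1 hn

lemma snd_eq_zero {n : ℤ} (hn : n ≤ 0) : E.snd n = 0 := by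
  ext x
  exact x.2.2 hn

lemma snd_eq_snd {n : ℤ} (hn : n ≤ 0) (x x' : E.mapCx.X n) : E.snd n x = E.snd n x' :=
  (x.2.2 hn).trans (x'.2.2 hn).symm

/-- The map to `E.mapCx` with given components. -/
def lift {M : ModuleCat.{u} R} {n : ℤ} (s : M ⟶ E.S.X n) (y : M ⟶ E.Y.cx.X n)
    (hs : n < 0 → s = 0) (hy : n ≤ 0 → y = 0) : M ⟶ E.mapCx.X n :=
  ModuleCat.ofHom (LinearMap.codRestrict (E.mapX n) (s.hom.prod y.hom)
    fun x => ⟨fun hn => congr($(hs hn) x), fun hn => congr($(hy hn) x)⟩)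

lemma lift_fst {M : ModuleCat.{u} R} {n : ℤ} (s : M ⟶ E.S.X n) (y : M ⟶ E.Y.cx.X n)
    (hs : n < 0 → s = 0) (hy : n ≤ 0 → y = 0) : lift s y hs hy ≫ E.fst n = s := rfl

lemma lift_fst_assoc {M Z : ModuleCat.{u} R} {n : ℤ} (s : M ⟶ E.S.X n) (y : M ⟶ E.Y.cx.X n)
    (hs : n < 0 → s = 0) (hy : n ≤ 0 → y = 0) (k : E.S.X n ⟶ Z) :
    lift s y hs hy ≫ E.fst n ≫ k = s ≫ k := by
  rw [← Category.assoc, lift_fst]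

lemma lift_snd {M : ModuleCat.{u} R} {n : ℤ} (s : M ⟶ E.S.X n) (y : M ⟶ E.Y.cx.X n)
    (hs : n < 0 → s = 0) (hy : n ≤ 0 → y = 0) : lift s y hs hy ≫ E.snd n = y := rfl

lemma lift_snd_assoc {M Z : ModuleCat.{u} R} {n : ℤ} (s : M ⟶ E.S.X n) (y : M ⟶ E.Y.cx.X n)
    (hs : n < 0 → s = 0) (hy : n ≤ 0 → y = 0) (k : E.Y.cx.X n ⟶ Z) :
    lift s y hs hy ≫ E.snd n ≫ k = y ≫ k := by
  rw [← Category.assoc, lift_snd]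

lemma exists_mk {n : ℤ} (s : E.S.X n) (y : E.Y.cx.X n) (hs : n < 0 → s = 0) (hy : n ≤ 0 → y = 0) :
    ∃ x, E.fst n x = s ∧ E.snd n x = y :=
  ⟨⟨(s, y), hs, hy⟩, rfl, rfl⟩

variable (E) in
lemma d_fst (m n : ℤ) : E.mapCx.d m n ≫ E.fst n = E.fst m ≫ E.S.d m n := by
  by_cases h : m + 1 = n
  · simp only [mapCx, dif_pos h]
    rfl
  · rw [E.mapCx.shape _ _ h, E.S.shape _ _ h, zero_comp, comp_zero]

variable (E) in
lemma d_fst_assoc (m n : ℤ) {Z : ModuleCat.{u} R} (k : E.S.X n ⟶ Z) :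
    E.mapCx.d m n ≫ E.fst n ≫ k = E.fst m ≫ E.S.d m n ≫ k := by
  rw [← Category.assoc, d_fst, Category.assoc]

variable (E) in
lemma d_snd {m n : ℤ} (h : m + 1 = n) :
    E.mapCx.d m n ≫ E.snd n = E.fst m ≫ E.φ m n + E.snd m ≫ E.Y.cx.d m n := by
  simp only [mapCx, dif_pos h]
  rfl

variable (E) in
lemma d_snd_assoc {m n : ℤ} (h : m + 1 = n) {Z : ModuleCat.{u} R} (k : E.Y.cx.X n ⟶ Z) :
    E.mapCx.d m n ≫ E.snd n ≫ k = (E.fst m ≫ E.φ m n + E.snd m ≫ E.Y.cx.d m n) ≫ k := by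
  rw [← Category.assoc, d_snd E h]

lemma fst_d_apply {m n : ℤ} (x : E.mapCx.X m) : E.fst n (E.mapCx.d m n x) = E.S.d m n (E.fst m x) :=
  congr($(E.d_fst m n) x)

lemma snd_d_apply {m n : ℤ} (h : m + 1 = n) (x : E.mapCx.X m) :
    E.snd n (E.mapCx.d m n x) = E.φ m n (E.fst m x) + E.Y.cx.d m n (E.snd m x) :=
  congr($(E.d_snd h) x)

lemma mapCx_isZero {n : ℤ} (hn : n < 0) : IsZero (E.mapCx.X n) := by
  have : Subsingleton (E.mapCx.X n) := ⟨fun x y => mapCx_ext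
    (by rw [fst_eq_zero hn]; rfl) (by rw [snd_eq_zero hn.le]; rfl)⟩
  exact ModuleCat.isZero_of_subsingleton _

lemma mapCx_mem (h𝒱 : IsSelfOrthogonal 𝒱) {n : ℤ} (hn : 0 ≤ n) : 𝒱 (E.mapCx.X n) := by
  rcases hn.eq_or_lt with rfl | hn
  · refine h𝒱.of_linearEquiv (LinearEquiv.ofBijective (E.fst 0).hom ⟨fun x y hxy =>
      mapCx_ext hxy (by rw [snd_eq_zero le_rfl]; rfl), fun s => ?_⟩).symm
      (E.complete.acyclic.mem 0)
    obtain ⟨x, hx, -⟩ := E.exists_mk s 0 (fun h => absurd h (by norm_num)) (fun _ => rfl)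
    exact ⟨x, hx⟩
  · refine h𝒱.of_linearEquiv (X := ModuleCat.of R (E.S.X n × E.Y.cx.X n))
      (LinearEquiv.ofBijective ((E.fst n).hom.prod (E.snd n).hom) ⟨fun x y hxy =>
      mapCx_ext (Prod.ext_iff.1 hxy).1 (Prod.ext_iff.1 hxy).2, ?_⟩).symm
      (h𝒱.prod (E.complete.acyclic.mem n) (E.mem n hn))
    rintro ⟨s, y⟩
    obtain ⟨x, hx, hx'⟩ := E.exists_mk s y (fun h => absurd h (by omega))
      (fun h => absurd h (by omega))
    exact ⟨x, Prod.ext hx hx'⟩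

/-- For a cocycle `(s, y)`, write `s = d t`; then `y - φ t` is a cocycle of `Y`, hence some `d z`,
and `(t, z)` is a primitive. -/
lemma mapCx_exactAt {n : ℤ} (hn : 0 < n) : E.mapCx.ExactAt n := by
  obtain ⟨m, rfl⟩ : ∃ m, n = m + 1 := ⟨n - 1, by ring⟩
  rw [CochainComplex.exactAt_iff_apply _ rfl rfl]
  intro x hx
  have h1 : E.S.d (m + 1) (m + 1 + 1) (E.fst (m + 1) x) = 0 := by
    rw [← fst_d_apply, hx, map_zero]
  have h2 : E.φ (m + 1) (m + 1 + 1) (E.fst (m + 1) x) +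
      E.Y.cx.d (m + 1) (m + 1 + 1) (E.snd (m + 1) x) = 0 := by
    rw [← snd_d_apply rfl, hx, map_zero]
  obtain ⟨t, ht⟩ := E.complete.acyclic.exists_d_eq rfl rfl _ h1
  obtain ⟨z, hz⟩ := (E.Y.cx.exactAt_iff_apply rfl rfl).1 (E.Y.exactAt (m + 1) hn)
    (E.snd (m + 1) x - E.φ m (m + 1) t) (by
      rw [map_sub, sub_eq_add_neg, ← E.d_φ_apply (by omega) rfl rfl, ht]
      exact (add_comm _ _).trans h2)
  by_cases hm : m = 0
  · subst hm
    -- In degree zero there is no `Y⁰` component. There `z` enters as `ι z`, which has the right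
    -- effect since `d ι = 0` and `φ ι = d`.
    obtain ⟨w, hw, -⟩ := E.exists_mk (t + E.ι z) 0 (fun h => absurd h (by norm_num)) (fun _ => rfl)
    refine ⟨w, mapCx_ext ?_ ?_⟩
    · have h3 : E.S.d 0 (0 + 1) (E.ι z) = 0 := E.complete.d_ι_apply z
      rw [fst_d_apply, hw, map_add, ht, h3, add_zero]
    · have h4 : E.φ 0 (0 + 1) (E.ι z) = E.Y.cx.d 0 (0 + 1) z := E.φ_ι_apply z
      rw [snd_d_apply rfl, hw, snd_eq_zero le_rfl, ModuleCat.hom_zero_apply, map_zero, add_zero,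
        map_add, h4, hz, add_sub_cancel]
  · obtain ⟨w, hw, hw'⟩ := E.exists_mk t z (fun h => absurd h (by omega))
      (fun h => absurd h (by omega))
    exact ⟨w, mapCx_ext (by rw [fst_d_apply, hw, ht])
      (by rw [snd_d_apply rfl, hw, hw', hz, add_sub_cancel])⟩

variable (E) in
/-- The coresolution of `N` given by `E.mapCx`. -/
def coresolution (h𝒱 : IsSelfOrthogonal 𝒱) : Coresolution 𝒱 N where
  cx := E.mapCx
  aug := lift (E.Y.aug ≫ E.ι) 0 (fun h => absurd h (by norm_num)) (fun _ => rfl)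
  mem _ hn := mapCx_mem h𝒱 hn
  isZero _ hn := mapCx_isZero hn
  aug_comp := by
    refine mapCx_hom_ext ?_ ?_
    · rw [Category.assoc, d_fst, lift_fst_assoc, zero_comp]
      ext x
      exact E.complete.d_ι_apply _
    · rw [Category.assoc, d_snd E (zero_add 1), Preadditive.comp_add, lift_fst_assoc,
        lift_snd_assoc, zero_comp, Category.assoc, E.ι_φ, E.Y.aug_comp, add_zero, zero_comp]
  mono_aug := (ModuleCat.mono_iff_injective _).2 fun x y hxy =>
    E.Y.aug_injective (E.complete.injective (congrArg (E.fst 0) hxy))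
  exact_zero := by
    refine (ShortComplex.moduleCat_exact_iff _).2 fun x hx => ?_
    have hx' : E.mapCx.d 0 1 x = 0 := hx
    -- The `S`-component of the equation puts `x` in `ι(Y⁰)`, and the `Y`-component then puts it in
    -- the image of `N`.
    obtain ⟨g, hg⟩ := E.complete.exists_ι_eq (E.fst 0 x) (by rw [← fst_d_apply, hx', map_zero])
    have h2 : E.φ 0 1 (E.fst 0 x) + E.Y.cx.d 0 1 (E.snd 0 x) = 0 := by
      rw [← snd_d_apply (zero_add 1), hx', map_zero]
    rw [← hg, φ_ι_apply, snd_eq_zero le_rfl, ModuleCat.hom_zero_apply, map_zero, add_zero] at h2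
    obtain ⟨a, rfl⟩ := E.Y.exists_aug_eq g h2
    exact ⟨a, mapCx_ext hg (snd_eq_snd le_rfl _ _)⟩
  exactAt _ hn := mapCx_exactAt hn

/-- Both `Y` and `S` stay exact under `Hom(-, X)`. A map is extended on the `Y`-factor by some `b`,
and then on the `S`-factor after subtracting `φ ≫ b`. -/
lemma coresolution_isProper (h𝒱 : IsSelfOrthogonal 𝒱) : (E.coresolution h𝒱).IsProper := by
  have hY : ∀ {X}, 𝒱 X → ExtendsTo E.Y.cx X := fun hX =>
    E.proper.extendsTo (h𝒱.le_gorensteinClass _ hX)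
  have hS : ∀ {X}, 𝒱 X → ExtendsTo E.S X := fun hX => E.complete.acyclic.extendsTo hX
  refine ⟨fun X hX f => ?_, fun X hX f hf => ?_, fun X hX m hm f hf => ?_⟩
  · obtain ⟨a, rfl⟩ := E.proper.at_aug X (h𝒱.le_gorensteinClass _ hX) f
    obtain ⟨b, rfl⟩ := E.complete.exists_extend hX a
    exact ⟨E.fst 0 ≫ b, rfl⟩
  · change E.mapCx.X 0 ⟶ X at f
    let s : E.S.X 0 ⟶ E.mapCx.X 0 := lift (𝟙 _) 0 (fun h => absurd h (by norm_num)) (fun _ => rfl)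
    have hs : E.fst 0 ≫ s = 𝟙 _ := mapCx_hom_ext
      (by rw [Category.assoc, lift_fst, Category.comp_id, Category.id_comp])
      (by rw [snd_eq_zero le_rfl, comp_zero, comp_zero])
    obtain ⟨b, hb⟩ := hY hX 0 1 (zero_add 1) (E.ι ≫ s ≫ f) (fun y hy => by
      obtain ⟨a, rfl⟩ := E.Y.exists_aug_eq y hy
      exact congr($hf a))
    obtain ⟨a, ha⟩ := hS hX 0 1 (zero_add 1) (s ≫ f - E.φ 0 1 ≫ b) (fun x hx => by
      obtain ⟨g, rfl⟩ := E.complete.exists_ι_eq x hx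
      have h1 : b (E.Y.cx.d 0 1 g) = f (s (E.ι g)) := congr($hb g)
      change f (s (E.ι g)) - b (E.φ 0 1 (E.ι g)) = 0
      rw [φ_ι_apply, h1, sub_self])
    refine ⟨E.fst 1 ≫ a + E.snd 1 ≫ b, ?_⟩
    change E.mapCx.d 0 1 ≫ (E.fst 1 ≫ a + E.snd 1 ≫ b) = f
    rw [Preadditive.comp_add, d_fst_assoc, d_snd_assoc E (zero_add 1), ha, Preadditive.comp_sub,
      reassoc_of% hs, snd_eq_zero le_rfl, zero_comp, add_zero, Category.assoc, sub_add_cancel]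
  · change E.mapCx.X (m + 1) ⟶ X at f
    change E.mapCx.d m (m + 1) ≫ f = 0 at hf
    let s : E.S.X (m + 1) ⟶ E.mapCx.X (m + 1) :=
      lift (𝟙 _) 0 (fun h => absurd h (by omega)) (fun _ => rfl)
    let y : E.Y.cx.X (m + 1) ⟶ E.mapCx.X (m + 1) :=
      lift 0 (𝟙 _) (fun _ => rfl) (fun h => absurd h (by omega))
    have hsy : E.fst (m + 1) ≫ s + E.snd (m + 1) ≫ y = 𝟙 _ := mapCx_hom_ext
      (by simp [s, y, lift_fst]) (by simp [s, y, lift_snd])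
    have hf' : ∀ x, f (E.mapCx.d m (m + 1) x) = 0 := fun x => congr($hf x)
    obtain ⟨b, hb⟩ := hY hX (m + 1) (m + 2) (by ring) (y ≫ f) (fun v hv => by
      obtain ⟨z, rfl⟩ := (E.Y.cx.exactAt_iff_apply rfl (by ring)).1 (E.Y.exactAt (m + 1) (by omega))
        v hv
      -- The element `(0, d z)` is a coboundary, of `ι z` in degree zero and of `(0, z)` in positive
      -- degrees, so `f` kills it.
      by_cases h0 : m = 0
      · subst h0
        obtain ⟨w, hw, -⟩ := E.exists_mk (E.ι z) 0 (fun h => absurd h (by norm_num)) (fun _ => rfl)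
        rw [← hf' w, ModuleCat.comp_apply]
        refine congrArg f (mapCx_ext ?_ ?_)
        · rw [fst_d_apply, hw]
          exact (E.complete.d_ι_apply z).symm
        · rw [snd_d_apply rfl, hw, snd_eq_zero le_rfl, ModuleCat.hom_zero_apply, map_zero, add_zero]
          exact (E.φ_ι_apply z).symm
      · obtain ⟨w, hw, hw'⟩ := E.exists_mk 0 z (fun _ => rfl) (fun h => absurd h (by omega))
        rw [← hf' w, ModuleCat.comp_apply]
        refine congrArg f (mapCx_ext ?_ ?_)
        · rw [fst_d_apply, hw, map_zero]
          rfl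
        · rw [snd_d_apply rfl, hw, hw', map_zero, zero_add]
          rfl)
    have hb' : ∀ z, b (E.Y.cx.d (m + 1) (m + 2) z) = f (y z) := fun z => congr($hb z)
    obtain ⟨a, ha⟩ := hS hX (m + 1) (m + 2) (by ring) (s ≫ f - E.φ (m + 1) (m + 2) ≫ b)
      (fun x hx => by
        obtain ⟨t, rfl⟩ := E.complete.acyclic.exists_d_eq rfl (by ring) x hx
        obtain ⟨w, hw, hw'⟩ := E.exists_mk t 0 (fun h => absurd h (by omega)) (fun _ => rfl)
        change f (s (E.S.d m (m + 1) t)) - b (E.φ (m + 1) (m + 2) (E.S.d m (m + 1) t)) = 0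
        rw [E.d_φ_apply hm rfl (by ring), map_neg, sub_neg_eq_add, hb', ← map_add]
        rw [← hf' w]
        refine congrArg f (mapCx_ext ?_ ?_)
        · rw [fst_d_apply, hw, map_add]
          exact add_zero _
        · rw [snd_d_apply rfl, hw, hw', map_zero, map_add]
          exact (zero_add _).trans (add_zero _).symm)
    refine ⟨E.fst (m + 2) ≫ a + E.snd (m + 2) ≫ b, ?_⟩
    change E.mapCx.d (m + 1) (m + 2) ≫ (E.fst (m + 2) ≫ a + E.snd (m + 2) ≫ b) = f
    rw [Preadditive.comp_add, d_fst_assoc, d_snd_assoc E (by ring), ha, Preadditive.comp_sub,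
      Preadditive.add_comp, Category.assoc, Category.assoc, hb, ← add_assoc, sub_add_cancel,
      ← Category.assoc, ← Category.assoc, ← Preadditive.add_comp, hsy, Category.id_comp]

end ApproximationData

end ApproximationData

/-! ### The long exact sequence and its naturality for approximations. -/

section ApproximationSequence

variable {R : Type u} [CommRing R] {𝒱 : ObjectProperty (ModuleCat.{u} R)}
  {N N' : ModuleCat.{u} R} {d d' : ℕ}

namespace ApproximationData

variable (E : ApproximationData 𝒱 N d) (h𝒱 : IsSelfOrthogonal 𝒱)

/-- The projection to the totally acyclic complex. -/
def toS : E.mapCx ⟶ E.S where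
  f := E.fst
  comm' m n _ := (E.d_fst m n).symm

/-- The Tate coresolution obtained from an approximation. -/
def tate : TateCoresolution 𝒱 N where
  V := E.coresolution h𝒱
  proper := coresolution_isProper h𝒱
  S := E.S
  acyclic := E.complete.acyclic
  β := E.toS
  eventually_isIso := by
    refine ⟨d + 1, fun n hn => ?_⟩
    have hY := E.isZero n (by omega)
    refine (ConcreteCategory.isIso_iff_bijective (E.fst n)).2 ⟨fun x y hxy =>
      mapCx_ext hxy ?_, fun s => ?_⟩
    · exact @Subsingleton.elim _ (ModuleCat.subsingleton_of_isZero hY) _ _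
    · obtain ⟨x, hx, -⟩ := E.exists_mk s 0 (fun h => absurd h (by omega)) (fun _ => rfl)
      exact ⟨x, hx⟩

/-- The inclusion of `Y` into the complex `E.mapCx`. -/
def fromY : E.Y.cx ⟶ E.mapCx where
  f n := lift (if h : n = 0 then (E.Y.cx.XIsoOfEq h).hom ≫ E.ι ≫ (E.S.XIsoOfEq h.symm).hom else 0)
    (if 0 < n then 𝟙 _ else 0) (fun h => dif_neg h.ne) (fun h => if_neg h.not_gt)
  comm' m n h := by
    have hmn : m + 1 = n := h
    refine mapCx_hom_ext ?_ ?_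
    · rw [Category.assoc, d_fst, lift_fst_assoc, Category.assoc, lift_fst]
      by_cases hm : m = 0
      · subst hm
        rw [dif_pos rfl, dif_neg (by omega), comp_zero]
        obtain rfl : n = 1 := by omega
        ext x
        exact E.complete.d_ι_apply x
      · rw [dif_neg hm, zero_comp]
        by_cases hn : n = 0
        · exact (E.Y.isZero m (by omega)).eq_of_src _ _
        · rw [dif_neg hn, comp_zero]
    · rw [Category.assoc, d_snd E hmn, Preadditive.comp_add, lift_fst_assoc, lift_snd_assoc,
        Category.assoc, lift_snd]
      rcases lt_trichotomy m 0 with hm | rfl | hm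
      · exact (E.Y.isZero m (by omega)).eq_of_src _ _
      · obtain rfl : n = 1 := by omega
        rw [if_neg (lt_irrefl _), if_pos one_pos, zero_comp, add_zero, dif_pos rfl]
        ext x
        exact E.φ_ι_apply x
      · rw [dif_neg hm.ne', if_pos hm, if_pos (by omega), zero_comp, zero_add, Category.id_comp,
          Category.comp_id]

lemma fromY_fst {n : ℤ} (hn : 0 < n) : E.fromY.f n ≫ E.fst n = 0 :=
  (lift_fst _ _ (fun h => dif_neg h.ne) fun h => if_neg h.not_gt).trans (dif_neg hn.ne')

lemma fromY_snd {n : ℤ} (hn : 0 < n) : E.fromY.f n ≫ E.snd n = 𝟙 _ :=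
  (lift_snd _ _ (fun h => dif_neg h.ne) fun h => if_neg h.not_gt).trans (if_pos hn)

/-- The resolution data obtained from an approximation. -/
def data : ResolutionData (GorensteinClass 𝒱) 𝒱 N where
  Y := E.Y
  proper := E.proper
  T := E.tate h𝒱
  κ := E.fromY
  isLift := by
    refine mapCx_hom_ext ?_ ?_
    · rw [Category.id_comp]
      rfl
    · exact ModuleCat.hom_ext (LinearMap.ext fun x => snd_eq_snd le_rfl _ _)

/-- That coboundaries go to coboundaries uses `d_φ` in degree `n - 1`, which is available only for
`n ≥ 1`. -/
lemma exists_δ (M : ModuleCat.{u} R) {n : ℤ} (hn : 1 ≤ n) :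
    ∃ δ : homCoh M E.S n ⟶ homCoh M E.Y.cx (n + 1),
      ∀ (x : M ⟶ E.S.X n) (hx : x ≫ E.S.d n (n + 1) = 0)
        (hx' : (x ≫ E.φ n (n + 1)) ≫ E.Y.cx.d (n + 1) (n + 1 + 1) = 0),
        δ (homCoh.mk M n x hx) = homCoh.mk M (n + 1) (x ≫ E.φ n (n + 1)) hx' :=
  homCoh.exists_connecting n (E.φ n (n + 1))
    ⟨E.φ (n + 1) (n + 1 + 1), E.d_φ n (n + 1) (n + 1 + 1) (by omega) rfl rfl⟩
    ⟨-E.φ (n - 1) n, by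
      rw [E.d_φ (n - 1) n (n + 1) (by omega) (by ring) rfl, Preadditive.neg_comp]⟩

/-- The connecting map in positive degrees, and zero in the other ones. -/
def δ (M : ModuleCat.{u} R) (n : ℤ) : homCoh M E.S n ⟶ homCoh M E.Y.cx (n + 1) :=
  if hn : 1 ≤ n then (E.exists_δ M hn).choose else 0

lemma φ_cocycle {M : ModuleCat.{u} R} {n : ℤ} (hn : 0 ≤ n) (x : M ⟶ E.S.X n)
    (hx : x ≫ E.S.d n (n + 1) = 0) :
    (x ≫ E.φ n (n + 1)) ≫ E.Y.cx.d (n + 1) (n + 1 + 1) = 0 := by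
  rw [Category.assoc, ← neg_eq_iff_eq_neg.2 (E.d_φ n (n + 1) (n + 1 + 1) hn rfl rfl),
    Preadditive.comp_neg, reassoc_of% hx, zero_comp, neg_zero]

lemma δ_mk {M : ModuleCat.{u} R} {n : ℤ} (hn : 1 ≤ n) (x : M ⟶ E.S.X n)
    (hx : x ≫ E.S.d n (n + 1) = 0) :
    E.δ M n (homCoh.mk M n x hx) =
      homCoh.mk M (n + 1) (x ≫ E.φ n (n + 1)) (E.φ_cocycle (by omega) x hx) := by
  rw [δ, dif_pos hn]
  exact (E.exists_δ M hn).choose_spec x hx _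

lemma δ_comap {M M' : ModuleCat.{u} R} (f : M ⟶ M') {n : ℤ} (hn : 1 ≤ n) :
    E.δ M' n ≫ homCohComap f E.Y.cx (n + 1) = homCohComap f E.S n ≫ E.δ M n := by
  ext a
  obtain ⟨x, hx, rfl⟩ := homCoh.exists_rep a
  change homCohComap f E.Y.cx (n + 1) (E.δ M' n _) = E.δ M n (homCohComap f E.S n _)
  rw [E.δ_mk hn, homCoh.comap_mk, homCoh.comap_mk, E.δ_mk hn]
  simp only [Category.assoc]

/-- The map on `Hⁿ(Hom_R(M, -))` induced by the inclusion of `Y`. -/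
abbrev θ (M : ModuleCat.{u} R) (n : ℤ) : homCoh M E.Y.cx n ⟶ homCoh M E.mapCx n :=
  homCohMap M E.fromY n

/-- The map on `Hⁿ(Hom_R(M, -))` induced by the projection to `S`. -/
abbrev η (M : ModuleCat.{u} R) (n : ℤ) : homCoh M E.mapCx n ⟶ homCoh M E.S n :=
  homCohMap M E.toS n

variable (M : ModuleCat.{u} R)

/-- A primitive `v : M ⟶ S⁰` of a class coming from `Y¹` has `d v = 0`, so it factors through `ι`.
As `φ ι = d`, the factorization is a primitive in `Y⁰`. -/
lemma θ_injective : Function.Injective (E.θ M 1) := by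
  rw [injective_iff_map_eq_zero]
  intro a ha
  obtain ⟨y, hy, rfl⟩ := homCoh.exists_rep a
  rw [homCoh.map_mk, homCoh.mk_eq_zero_iff (zero_add 1)] at ha
  obtain ⟨v, hv⟩ := ha
  have h1 := congrArg (fun f => f ≫ E.fst 1) hv
  have h2 := congrArg (fun f => f ≫ E.snd 1) hv
  simp only [Category.assoc, d_fst, d_snd E (zero_add 1), E.fromY_fst one_pos,
    E.fromY_snd one_pos, snd_eq_zero le_rfl, zero_comp, add_zero, comp_zero, Category.comp_id]
    at h1 h2
  rw [homCoh.mk_eq_zero_iff (zero_add 1)]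
  have hι : ∀ m, ∃ g, E.ι g = E.fst 0 (v m) := fun m =>
    E.complete.exists_ι_eq _ congr($h1 m)
  have : Mono E.ι := (ModuleCat.mono_iff_injective _).2 E.complete.injective
  let T := ShortComplex.mk E.ι (E.S.d 0 1) (by ext x; exact E.complete.d_ι_apply x)
  have hT : T.Exact := (ShortComplex.moduleCat_exact_iff _).2 fun x hx =>
    E.complete.exists_ι_eq x hx
  have : Mono T.f := this
  have h3 := hT.lift_f (v ≫ E.fst 0) (by rw [Category.assoc]; exact h1)
  refine ⟨hT.lift (v ≫ E.fst 0) (by rw [Category.assoc]; exact h1), ?_⟩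
  rw [← E.ι_φ, ← Category.assoc]
  refine (congrArg (· ≫ E.φ 0 1) h3).trans ?_
  rw [Category.assoc]
  exact h2

/-- This and the next two lemmas are the chase for the degreewise split sequence `0 → Y → V → S → 0`
in positive degrees. If `t` is a primitive of the `S`-part of a cocycle `v`, subtracting the
coboundary of `(t, 0)` leaves a cocycle of `Y`. -/
lemma exact_θ_η {n : ℤ} (hn : 1 ≤ n) : Function.Exact (E.θ M n) (E.η M n) := by
  intro a
  constructor
  · intro ha
    obtain ⟨v, hv, rfl⟩ := homCoh.exists_rep a
    rw [homCoh.map_mk, homCoh.mk_eq_zero_iff (sub_add_cancel n 1)] at ha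
    obtain ⟨t, ht⟩ := ha
    have ht' : t ≫ E.S.d (n - 1) n = v ≫ E.fst n := ht
    have hv2 := congrArg (fun f => f ≫ E.snd (n + 1)) hv
    simp only [Category.assoc, d_snd E rfl, zero_comp, Preadditive.comp_add] at hv2
    have hy : (v ≫ E.snd n - t ≫ E.φ (n - 1) n) ≫ E.Y.cx.d n (n + 1) = 0 := by
      rw [Preadditive.sub_comp, Category.assoc, Category.assoc, sub_eq_add_neg,
        ← Preadditive.comp_neg, ← E.d_φ (n - 1) n (n + 1) (by omega) (by ring) rfl,
        reassoc_of% ht']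
      exact (add_comm _ _).trans hv2
    refine ⟨homCoh.mk M n _ hy, ?_⟩
    rw [homCoh.map_mk, homCoh.mk_eq_mk_iff (sub_add_cancel n 1)]
    refine ⟨lift (-t) 0 (fun h => absurd h (by omega)) (fun _ => rfl), mapCx_hom_ext ?_ ?_⟩
    · rw [Category.assoc, d_fst, lift_fst_assoc, Preadditive.sub_comp, Category.assoc,
        E.fromY_fst (by omega), comp_zero, zero_sub, Preadditive.neg_comp, ht']
    · rw [Category.assoc, d_snd E (sub_add_cancel n 1), Preadditive.comp_add, lift_fst_assoc,
        lift_snd_assoc, zero_comp, add_zero, Preadditive.sub_comp, Category.assoc,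
        E.fromY_snd (by omega), Category.comp_id, Preadditive.neg_comp]
      abel
  · rintro ⟨b, rfl⟩
    obtain ⟨y, hy, rfl⟩ := homCoh.exists_rep b
    rw [homCoh.map_mk, homCoh.map_mk, homCoh.mk_eq_zero_iff (sub_add_cancel n 1)]
    refine ⟨0, ?_⟩
    rw [zero_comp, Category.assoc]
    exact ((congrArg (y ≫ ·) (E.fromY_fst (by omega))).trans comp_zero).symm

lemma exact_η_δ {n : ℤ} (hn : 1 ≤ n) : Function.Exact (E.η M n) (E.δ M n) := by
  intro a
  constructor
  · intro ha
    obtain ⟨s, hs, rfl⟩ := homCoh.exists_rep a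
    rw [E.δ_mk hn, homCoh.mk_eq_zero_iff rfl] at ha
    obtain ⟨y, hy⟩ := ha
    let v : M ⟶ E.mapCx.X n := lift s (-y) (fun h => absurd h (by omega))
      (fun h => absurd h (by omega))
    have hv : v ≫ E.mapCx.d n (n + 1) = 0 := mapCx_hom_ext
      (by rw [Category.assoc, d_fst, lift_fst_assoc, hs, zero_comp])
      (by rw [Category.assoc, d_snd E rfl, Preadditive.comp_add, lift_fst_assoc, lift_snd_assoc,
        Preadditive.neg_comp, hy, add_neg_cancel, zero_comp])
    refine ⟨homCoh.mk M n v hv, ?_⟩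
    rw [homCoh.map_mk]
    rfl
  · rintro ⟨b, rfl⟩
    obtain ⟨v, hv, rfl⟩ := homCoh.exists_rep b
    rw [homCoh.map_mk, E.δ_mk hn, homCoh.mk_eq_zero_iff rfl]
    have hv2 := congrArg (fun f => f ≫ E.snd (n + 1)) hv
    simp only [Category.assoc, d_snd E rfl, zero_comp, Preadditive.comp_add] at hv2
    refine ⟨-(v ≫ E.snd n), ?_⟩
    rw [Preadditive.neg_comp, Category.assoc, Category.assoc]
    exact (eq_neg_of_add_eq_zero_left hv2).symm

lemma exact_δ_θ {n : ℤ} (hn : 1 ≤ n) : Function.Exact (E.δ M n) (E.θ M (n + 1)) := by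
  intro a
  constructor
  · intro ha
    obtain ⟨y, hy, rfl⟩ := homCoh.exists_rep a
    rw [homCoh.map_mk, homCoh.mk_eq_zero_iff rfl] at ha
    obtain ⟨v, hv⟩ := ha
    have h1 := congrArg (fun f => f ≫ E.fst (n + 1)) hv
    have h2 := congrArg (fun f => f ≫ E.snd (n + 1)) hv
    simp only [Category.assoc, d_fst, d_snd E rfl, E.fromY_fst (show 0 < n + 1 by omega),
      E.fromY_snd (show 0 < n + 1 by omega), comp_zero, Category.comp_id,
      Preadditive.comp_add] at h1 h2
    refine ⟨homCoh.mk M n (v ≫ E.fst n) (by rw [Category.assoc, h1]), ?_⟩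
    rw [E.δ_mk hn, homCoh.mk_eq_mk_iff rfl]
    refine ⟨-(v ≫ E.snd n), ?_⟩
    rw [← h2, Preadditive.neg_comp, Category.assoc, Category.assoc]
    abel
  · rintro ⟨b, rfl⟩
    obtain ⟨s, hs, rfl⟩ := homCoh.exists_rep b
    rw [E.δ_mk hn, homCoh.map_mk, homCoh.mk_eq_zero_iff rfl]
    refine ⟨lift s 0 (fun h => absurd h (by omega)) (fun _ => rfl), mapCx_hom_ext ?_ ?_⟩
    · rw [Category.assoc, d_fst, lift_fst_assoc, hs, Category.assoc, E.fromY_fst (by omega),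
        comp_zero]
    · rw [Category.assoc, d_snd E rfl, Preadditive.comp_add, lift_fst_assoc, lift_snd_assoc,
        zero_comp, add_zero, Category.assoc, E.fromY_snd (by omega), Category.comp_id]

lemma subsingleton_extY {n : ℤ} (hn : d < n) : Subsingleton (homCoh M E.Y.cx n) := by
  refine subsingleton_of_forall_eq 0 fun a => ?_
  obtain ⟨y, hy, rfl⟩ := homCoh.exists_rep a
  rw [homCoh.mk_eq_zero_iff (sub_add_cancel n 1)]
  exact ⟨0, (E.isZero n hn).eq_of_tgt _ _⟩

/-- Homomorphisms lift compatibly with the connecting maps. -/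
lemma exists_lift (E' : ApproximationData 𝒱 N' d') (g : N ⟶ N') :
    ∃ L : ResolutionLift (E.data h𝒱) (E'.data h𝒱) g, ∀ (M : ModuleCat.{u} R) (n : ℤ), 1 ≤ n →
      E.δ M n ≫ homCohMap M L.onY (n + 1) = homCohMap M L.onS n ≫ E'.δ M n := by
  obtain ⟨γ, hγ⟩ := Coresolution.exists_isLift E.Y E.proper E'.Y le_rfl g
  -- The map on `S` is built from `γ⁰`, so that it is strictly compatible with `ι` and `ι'`.
  obtain ⟨σ₀, hσ₀⟩ := E.complete.exists_extend (E'.complete.acyclic.mem 0) (γ.f 0 ≫ E'.ι)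
  have hσ₀' : ∀ x, σ₀ (E.ι x) = E'.ι (γ.f 0 x) := fun x => congr($hσ₀ x)
  obtain ⟨τ, hτ, hτ'⟩ := exists_solution_right E.S E'.S.d (fun _ _ _ => 0) 0
    (Function.update (fun n => 0) 0 σ₀) (by simp) (by simp)
    (fun n _ => E.complete.acyclic.exactAt n)
    (fun m n hmn _ f hf => E.complete.acyclic.extendsTo (E'.complete.acyclic.mem _) m n hmn f hf)
    (by
      intro x hx
      obtain ⟨y, rfl⟩ := E.complete.exists_ι_eq x hx
      rw [Function.update_self, hσ₀', ModuleCat.hom_zero_apply, add_zero]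
      exact E'.complete.d_ι_apply _)
  obtain ⟨σ, hσ, hσ'⟩ := exists_solution_left E.S E'.S.d (fun _ _ _ => 0) 0 τ (by simp)
    (fun l m n hl hm _ f hf => E'.complete.acyclic.liftsFrom (E.complete.acyclic.mem l) l m n hl hm
      f hf) (fun m n hm hn => hτ' m n hn hm)
  have hσd : ∀ m n, m + 1 = n → E.S.d m n ≫ σ n = σ m ≫ E'.S.d m n := fun m n h => by
    simpa using hσ' m n h
  have hσ0 : σ 0 = σ₀ := by rw [hσ 0 le_rfl, hτ 0 le_rfl, Function.update_self]
  -- The maps `σ ≫ φ'` and `φ ≫ γ` agree on `Y⁰` inside `S⁰`; `h` is a homotopy between them that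
  -- starts with zero in degree zero. It is the off-diagonal entry of the triangular map `onV`,
  -- which makes the square with the projections to `S` commute strictly.
  obtain ⟨h, h0, hh⟩ := exists_solution_right E.S E'.Y.cx.d
    (fun m n _ => σ m ≫ E'.φ m n - E.φ m n ≫ γ.f n) 0 (fun _ => 0) (by
      intro l m n hl hlm hmn
      rw [Preadditive.comp_sub, reassoc_of% hσd l m hlm, E'.d_φ l m n hl hlm hmn,
        ← Category.assoc, E.d_φ l m n hl hlm hmn]
      simp) (by simp) (fun n _ => E.complete.acyclic.exactAt n)
    (fun m n hmn hm f hf => E.complete.acyclic.extendsTo (E'.mem _ (by omega)) m n hmn f hf) (by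
      intro x hx
      obtain ⟨y, rfl⟩ := E.complete.exists_ι_eq x hx
      have h1 : E'.Y.cx.d 0 1 (γ.f 0 y) = γ.f 1 (E.Y.cx.d 0 1 y) :=
        CochainComplex.hom_comm_apply γ y
      rw [ModuleCat.hom_zero_apply, map_zero]
      refine (zero_add _).trans ?_
      change E'.φ 0 1 (σ 0 (E.ι y)) - γ.f 1 (E.φ 0 1 (E.ι y)) = 0
      rw [hσ0, hσ₀', φ_ι_apply, φ_ι_apply, h1, sub_self])
  let onS : E.S ⟶ E'.S := { f := σ, comm' := fun m n hmn => (hσd m n hmn).symm }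
  let onV : E.mapCx ⟶ E'.mapCx :=
    { f := fun n => lift (E.fst n ≫ σ n) (E.snd n ≫ γ.f n + E.fst n ≫ h n)
        (fun hn => by rw [fst_eq_zero hn, zero_comp])
        (fun hn => by rw [snd_eq_zero hn, zero_comp, h0 n hn, comp_zero, add_zero])
      comm' := fun m n hmn' => by
        have hmn : m + 1 = n := hmn'
        by_cases hm : 0 ≤ m
        · refine mapCx_hom_ext ?_ ?_
          · rw [Category.assoc, d_fst, lift_fst_assoc, Category.assoc, Category.assoc, lift_fst,
              d_fst_assoc, hσd m n hmn]
          · rw [Category.assoc, d_snd E' hmn, Preadditive.comp_add, lift_fst_assoc,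
              lift_snd_assoc, Category.assoc, Category.assoc, lift_snd, Preadditive.comp_add, d_fst_assoc,
              d_snd_assoc E hmn, hh m n hmn hm]
            simp only [Preadditive.add_comp, Preadditive.comp_add, Preadditive.comp_sub,
              Category.assoc, HomologicalComplex.Hom.comm]
            abel
        · exact (mapCx_isZero (by omega)).eq_of_src _ _ }
  refine ⟨⟨γ, onV, onS, hγ, ?_, ⟨Homotopy.ofEq ?_⟩⟩, fun M n hn => ?_⟩
  · refine mapCx_hom_ext ?_ ?_
    · change E.Y.aug ≫ E.ι ≫ σ 0 = g ≫ E'.Y.aug ≫ E'.ι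
      rw [hσ0, hσ₀, ← Category.assoc, hγ, Category.assoc]
    · exact ModuleCat.hom_ext (LinearMap.ext fun x => snd_eq_snd le_rfl _ _)
  · rfl
  · ext a
    obtain ⟨x, hx, rfl⟩ := homCoh.exists_rep a
    change homCohMap M γ (n + 1) (E.δ M n _) = E'.δ M n (homCohMap M onS n _)
    rw [E.δ_mk hn, homCoh.map_mk, homCoh.map_mk, E'.δ_mk hn, homCoh.mk_eq_mk_iff rfl]
    -- On a cocycle `x` the homotopy relation for `h` exhibits the difference of the two images as a
    -- coboundary.
    refine ⟨x ≫ h n, ?_⟩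
    have h1 := congrArg (x ≫ ·) (hh n (n + 1) rfl (by omega))
    simp only [reassoc_of% hx, zero_comp, Preadditive.comp_add, Preadditive.comp_sub] at h1
    simp only [Category.assoc, onS]
    exact eq_sub_of_add_eq (sub_eq_zero.1 (by rw [add_sub_assoc]; exact h1.symm))

end ApproximationData

end ApproximationSequence

/-! ### Evaluation for finite free modules, and exactness of `Hom` into injectives. -/

section FreeModules

variable {R P C I J : Type u} [CommRing R] [AddCommGroup P] [Module R P] [AddCommGroup C]
  [Module R C] [AddCommGroup I] [Module R I] [AddCommGroup J] [Module R J]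

section Evaluation

/-- For a finite free module `P`, the evaluation pairing of `P` and `Hom(C, I)` with values in
`Hom(Hom(P, C), I)` is generating: maps out of the target that agree on its image are equal. -/
lemma LinearMap.ext_of_evaluation [Module.Free R P] [Module.Finite R P]
    {u v : ((P →ₗ[R] C) →ₗ[R] I) →ₗ[R] J}
    (h : ∀ (p : P) (x : C →ₗ[R] I), u (x ∘ₗ LinearMap.applyₗ p) = v (x ∘ₗ LinearMap.applyₗ p)) :
    u = v := by
  let b := Module.Free.chooseBasis R P
  ext t
  -- Apply `t` to the expansion of `g : P → C` in terms of its values on the basis.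
  have ht : t = ∑ i, (t ∘ₗ LinearMap.smulRightₗ (b.coord i)) ∘ₗ LinearMap.applyₗ (b i) := by
    ext g
    have hg : g = ∑ i, LinearMap.smulRightₗ (b.coord i) (g (b i)) := by
      refine b.ext fun j => ?_
      simp [Finsupp.single_apply]
    conv_lhs => rw [hg]
    simp
  rw [ht, map_sum, map_sum]
  exact Finset.sum_congr rfl fun i _ => h _ _

/-- For a finite free module `P`, bilinear maps on `P` and `Hom(C, I)` factor through the evaluation
pairing with values in `Hom(Hom(P, C), I)`. -/
lemma LinearMap.exists_evaluation_eq [Module.Free R P] [Module.Finite R P]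
    (f : (C →ₗ[R] I) →ₗ[R] P →ₗ[R] J) : ∃ u : ((P →ₗ[R] C) →ₗ[R] I) →ₗ[R] J,
      ∀ (p : P) (x : C →ₗ[R] I), u (x ∘ₗ LinearMap.applyₗ p) = f x p := by
  let b := Module.Free.chooseBasis R P
  -- The same expansion dictates `u`: it sends `t` to the sum of the `f(xᵢ)(bᵢ)`, where `xᵢ(c) =
  -- t(coordᵢ · c)`.
  refine ⟨∑ i, f.flip (b i) ∘ₗ LinearMap.lcomp R I (LinearMap.smulRightₗ (b.coord i)),
    fun p x => ?_⟩
  have h (i) : (x ∘ₗ LinearMap.applyₗ p) ∘ₗ LinearMap.smulRightₗ (b.coord i) =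
      b.repr p i • x := by
    ext c
    simp
  conv_rhs => rw [← b.sum_repr p]
  simp only [LinearMap.coe_sum, Finset.sum_apply, LinearMap.comp_apply, LinearMap.lcomp_apply', h,
    map_sum, map_smul, LinearMap.flip_apply]

end Evaluation

lemma LinearMap.exists_comp_eq_of_exact {A B D : Type u} [AddCommGroup A] [Module R A]
    [AddCommGroup B] [Module R B] [AddCommGroup D] [Module R D] {f : A →ₗ[R] B} {g : B →ₗ[R] D}
    (h : ∀ x, g x = 0 → ∃ y, f y = x) (hI : Injective (ModuleCat.of R I)) (hfg : g ∘ₗ f = 0)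
    (u : B →ₗ[R] I) (hu : u ∘ₗ f = 0) : ∃ v : D →ₗ[R] I, v ∘ₗ g = u := by
  let S : ShortComplex (ModuleCat.{u} R) := ShortComplex.mk (ModuleCat.ofHom f) (ModuleCat.ofHom g)
    (by rw [← ModuleCat.ofHom_comp, hfg]; rfl)
  have hS : S.Exact := (ShortComplex.moduleCat_exact_iff _).2 h
  have hu' : S.f ≫ ModuleCat.ofHom u = 0 := by
    rw [← ModuleCat.ofHom_comp, hu]; rfl
  exact ⟨(hS.descToInjective (ModuleCat.ofHom u) hu').hom,
    congrArg ModuleCat.Hom.hom (hS.comp_descToInjective (ModuleCat.ofHom u) hu')⟩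

/-- `Hom(P, J)` is a product of copies of `J`, so maps are extended one basis coordinate at a time.
-/
lemma injective_linearMap_of_free [Module.Free R P] (hJ : Injective (ModuleCat.of R J)) :
    Injective (ModuleCat.of R (P →ₗ[R] J)) where
  factors {X Y} g f _ := by
    let b := Module.Free.chooseBasis R P
    let h (i) : Y ⟶ ModuleCat.of R J :=
      Injective.factorThru (ModuleCat.ofHom (g.hom.flip (b i))) f
    refine ⟨ModuleCat.ofHom ((b.constr R).toLinearMap ∘ₗ LinearMap.pi fun i => (h i).hom), ?_⟩
    ext x : 2
    refine b.ext fun i => ?_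
    have hi : f ≫ h i = _ := Injective.comp_factorThru _ _
    simpa using congr($hi x)

end FreeModules

/-! ### The contravariant functor `Hom(-, J)` on short exact sequences. -/

section Hom

variable {R : Type u} [CommRing R]

/-- Restriction of maps into `J` along `f`. -/
abbrev homMap {A B : ModuleCat.{u} R} (f : A ⟶ B) (J : ModuleCat.{u} R) :
    ModuleCat.of R (B →ₗ[R] J) ⟶ ModuleCat.of R (A →ₗ[R] J) :=
  ModuleCat.ofHom (LinearMap.lcomp R J f.hom)

lemma IsSES.homMap {A B D J : ModuleCat.{u} R} {f : A ⟶ B} {g : B ⟶ D} (h : IsSES f g)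
    (hJ : Injective J) : IsSES (homMap g J) (homMap f J) where
  injective u v huv := by
    ext x
    obtain ⟨y, rfl⟩ := h.surjective x
    exact congr($huv y)
  exact u := by
    constructor
    · intro hu
      obtain ⟨v, hv⟩ := h.exists_desc (ModuleCat.ofHom u) (by ext x; exact congr($hu x))
      exact ⟨v.hom, congrArg ModuleCat.Hom.hom hv⟩
    · rintro ⟨v, rfl⟩
      ext x
      exact (congrArg v (h.exact.apply_apply_eq_zero x)).trans (map_zero v)
  surjective u := by
    have := h.shortExact.mono_f
    have h1 := Injective.comp_factorThru (ModuleCat.ofHom u) f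
    exact ⟨(Injective.factorThru (ModuleCat.ofHom u) f).hom, congrArg ModuleCat.Hom.hom h1⟩

end Hom

/-! ### Self-orthogonality of the class of `C`-injective modules. -/

section Semidualizing

variable {R : Type u} [CommRing R]

/-- A resolution of `C` by finite free modules, given by its syzygies. -/
structure FiniteFreeResolution (C : ModuleCat.{u} R) where
  P : ℕ → ModuleCat.{u} R
  K : ℕ → ModuleCat.{u} R
  ι : ∀ j, K (j + 1) ⟶ P j
  π : ∀ j, P j ⟶ K j
  free : ∀ j, Module.Free R (P j)
  finite : ∀ j, Module.Finite R (P j)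
  isSES : ∀ j, IsSES (ι j) (π j)
  iso : K 0 ≅ C

/-- The syzygies of a projective resolution. -/
def CategoryTheory.ProjectiveResolution.syzygy {C : ModuleCat.{u} R} (Q : ProjectiveResolution C) :
    ℕ → ModuleCat.{u} R
  | 0 => C
  | j + 1 => ModuleCat.of R (LinearMap.range (Q.complex.d (j + 1) j).hom)

lemma CategoryTheory.ProjectiveResolution.nonempty_finiteFreeResolution {C : ModuleCat.{u} R}
    (Q : ProjectiveResolution C)
    (hQ : ∀ i, Module.Free R (Q.complex.X i) ∧ Module.Finite R (Q.complex.X i)) :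
    Nonempty (FiniteFreeResolution C) := by
  let ι (j : ℕ) : Q.syzygy (j + 1) ⟶ Q.complex.X j := ModuleCat.ofHom (Submodule.subtype _)
  have hι (j) : Function.Injective (ι j) := Subtype.val_injective
  let ρ (j : ℕ) : Q.complex.X (j + 1) ⟶ Q.syzygy (j + 1) :=
    ModuleCat.ofHom (LinearMap.rangeRestrict _)
  have hρ (j) : Function.Surjective (ρ j) := LinearMap.surjective_rangeRestrict _
  have h₀ : ∃ π : Q.complex.X 0 ⟶ C, IsSES (ι 0) π := by
    refine ⟨Q.π.f 0, hι 0, fun x => ?_,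
      (ModuleCat.epi_iff_surjective _).1 (inferInstanceAs (Epi (Q.π.f 0)))⟩
    have hex := (ShortComplex.moduleCat_exact_iff _).1 (ShortComplex.exact_of_g_is_cokernel
      (ShortComplex.mk (Q.complex.d 1 0) (Q.π.f 0) Q.complex_d_comp_π_f_zero)
      Q.isColimitCokernelCofork)
    constructor
    · intro hx
      obtain ⟨y, hy⟩ := hex x hx
      exact ⟨ρ 0 y, hy⟩
    · rintro ⟨z, rfl⟩
      obtain ⟨y, rfl⟩ := hρ 0 z
      exact ModuleCat.comp_eq_zero_apply Q.complex_d_comp_π_f_zero y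
  obtain ⟨π₀, hπ₀⟩ := h₀
  let π : ∀ j, Q.complex.X j ⟶ Q.syzygy j
    | 0 => π₀
    | j + 1 => ρ j
  refine ⟨⟨Q.complex.X, Q.syzygy, ι, π, fun j => (hQ j).1, fun j => (hQ j).2, ?_, Iso.refl _⟩⟩
  rintro (_ | j)
  · exact hπ₀
  · refine ⟨hι _, fun x => ⟨fun hx => ?_, ?_⟩, hρ j⟩
    · obtain ⟨y, hy⟩ := (ShortComplex.moduleCat_exact_iff _).1 (Q.exact_succ j) x
        (congrArg (ι j) hx)
      exact ⟨ρ (j + 1) y, hy⟩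
    · rintro ⟨z, rfl⟩
      obtain ⟨y, rfl⟩ := hρ (j + 1) z
      exact hι j (ModuleCat.comp_eq_zero_apply (Q.complex.d_comp_d (j + 2) (j + 1) j) y)

namespace FiniteFreeResolution

variable {C : ModuleCat.{u} R} (F : FiniteFreeResolution C)

lemma extVanish (hC : ExtVanish C C) : ∀ j, ExtVanish (F.K j) C
  | 0 => hC.of_iso F.iso.symm (Iso.refl C)
  | j + 1 => by
    have := F.free j
    exact (F.isSES j).extVanish_left .of_projective (extVanish hC j)

/-- The complex `Hom(F, C)` is exact in positive degrees. -/
lemma exists_homMap_eq (hC : ExtVanish C C) (j : ℕ) (f : F.P (j + 1) ⟶ C)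
    (hf : F.ι (j + 1) ≫ f = 0) : ∃ g : F.P j ⟶ C, F.π (j + 1) ≫ F.ι j ≫ g = f := by
  obtain ⟨l, rfl⟩ := (F.isSES (j + 1)).exists_desc f hf
  obtain ⟨g, rfl⟩ := (F.isSES j).exists_extend (F.extVanish hC j 1 le_rfl) l
  exact ⟨g, rfl⟩

variable {I J : ModuleCat.{u} R}

/-- Maps from `Hom(C, I)` lift along the maps `Hom(P, J) → Hom(K, J)` given by a resolution. -/
lemma exists_lift (hC : ExtVanish C C) (hI : Injective I) (hJ : Injective J) (j : ℕ)
    (c : (C →ₗ[R] I) →ₗ[R] F.K (j + 1) →ₗ[R] J) :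
    ∃ g : (C →ₗ[R] I) →ₗ[R] F.P j →ₗ[R] J, ∀ x, g x ∘ₗ (F.ι j).hom = c x := by
  have := F.free (j + 1)
  have := F.finite (j + 1)
  have := F.free (j + 2)
  have := F.finite (j + 2)
  let d₁ : F.P (j + 1) →ₗ[R] F.P j := (F.π (j + 1) ≫ F.ι j).hom
  let d₂ : F.P (j + 2) →ₗ[R] F.P (j + 1) := (F.π (j + 2) ≫ F.ι (j + 1)).hom
  have hd : d₁ ∘ₗ d₂ = 0 := by
    ext x
    have h1 := (F.isSES (j + 1)).exact.apply_apply_eq_zero (F.π (j + 2) x)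
    exact (congrArg (F.ι j) h1).trans (map_zero (F.ι j).hom)
  have hexact (f : F.P (j + 1) →ₗ[R] C) (hf : f ∘ₗ d₂ = 0) :
      ∃ g : F.P j →ₗ[R] C, g ∘ₗ d₁ = f := by
    obtain ⟨g, hg⟩ := F.exists_homMap_eq hC j (ModuleCat.ofHom f) (by
      ext y
      obtain ⟨x, rfl⟩ := (F.isSES (j + 2)).surjective y
      exact congr($hf x))
    exact ⟨g.hom, congrArg ModuleCat.Hom.hom hg⟩
  let T₁ := LinearMap.lcomp R I (LinearMap.lcomp R C d₁)
  let T₂ := LinearMap.lcomp R I (LinearMap.lcomp R C d₂)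
  have hT : T₁ ∘ₗ T₂ = 0 := by
    ext t g
    have h1 : LinearMap.lcomp R C d₂ (LinearMap.lcomp R C d₁ g) = 0 := by
      ext x
      exact (congrArg g congr($hd x)).trans (map_zero g)
    exact (congrArg t h1).trans (map_zero t)
  -- Exactness of `Hom(F, C)` in degree `j + 1 ≥ 1` is preserved by `Hom(-, I)`, and below by
  -- `Hom(-, J)`.
  have hT' (t) (ht : T₁ t = 0) : ∃ s, T₂ s = t :=
    LinearMap.exists_comp_eq_of_exact (fun f hf => hexact f hf) hI (by
      ext g x
      exact (congrArg g congr($hd x)).trans (map_zero g)) t ht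
  -- `u` is `c`, composed with restriction to `P (j + 1)`, transported to a map out of `Hom(Hom(P (j
  -- + 1), C), I)`. It kills the image of `T₂`, hence extends along `T₁`, and evaluating the
  -- extension on `P j` gives the lift.
  obtain ⟨u, hu⟩ := LinearMap.exists_evaluation_eq
    ((LinearMap.lcomp R J (F.π (j + 1)).hom) ∘ₗ c)
  have hu₂ : u ∘ₗ T₂ = 0 := by
    refine LinearMap.ext_of_evaluation fun p x => ?_
    refine (hu (d₂ p) x).trans ?_
    have h1 := (F.isSES (j + 1)).exact.apply_apply_eq_zero (F.π (j + 2) p)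
    exact (congrArg (c x) h1).trans (map_zero _)
  obtain ⟨v, hv⟩ := LinearMap.exists_comp_eq_of_exact hT' hJ hT u hu₂
  refine ⟨LinearMap.mk₂ R (fun x p => v (x ∘ₗ LinearMap.applyₗ p)) ?_ ?_ ?_ ?_, fun x => ?_⟩
  · intro x x' p
    rw [LinearMap.add_comp, map_add]
  · intro r x p
    rw [LinearMap.smul_comp, map_smul]
  · intro x p p'
    rw [map_add, LinearMap.comp_add, map_add]
  · intro r x p
    rw [map_smul, LinearMap.comp_smul, map_smul]
  · ext y
    obtain ⟨p, rfl⟩ := (F.isSES (j + 1)).surjective y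
    exact congr($hv (x ∘ₗ LinearMap.applyₗ p)).trans (hu p x)

/-- Dimension shifting along `0 → Hom(K j, J) → Hom(P j, J) → Hom(K (j + 1), J) → 0`, whose middle
term is injective; `exists_lift` settles degree one. All syzygies are treated at once because each
step moves from `j` to `j + 1`. -/
lemma subsingleton_ext (hC : ExtVanish C C) (hI : Injective I) (hJ : Injective J) (i j : ℕ) :
    Subsingleton (Abelian.Ext.{u} (ModuleCat.of R (C →ₗ[R] I)) (ModuleCat.of R (F.K j →ₗ[R] J))
      (i + 1)) := by
  have hB (j) : ExtVanish (ModuleCat.of R (C →ₗ[R] I)) (ModuleCat.of R (F.P j →ₗ[R] J)) := by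
    have := F.free j
    have : Injective (ModuleCat.of R (F.P j →ₗ[R] J)) := injective_linearMap_of_free hJ
    exact .of_injective
  induction i generalizing j with
  | zero =>
    refine ((F.isSES j).homMap hJ).subsingleton_ext_one_of_lift (fun c => ?_) (hB j 1 le_rfl)
    obtain ⟨g, hg⟩ := F.exists_lift hC hI hJ j c.hom
    exact ⟨ModuleCat.ofHom g, by ext x : 2; exact hg x⟩
  | succ i ih =>
    exact ((F.isSES j).homMap hJ).subsingleton_ext_of_lift (ih (j + 1)) (hB j _ (by omega))

end FiniteFreeResolution

lemma IsSemidualizing.extVanish {C : ModuleCat.{u} R} (hC : IsSemidualizing C)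
    {I J : ModuleCat.{u} R} (hI : Injective I) (hJ : Injective J) :
    ExtVanish (ModuleCat.of R (C →ₗ[R] I)) (ModuleCat.of R (C →ₗ[R] J)) := by
  obtain ⟨Q, hQ⟩ := hC.exists_resolution
  obtain ⟨F⟩ := Q.nonempty_finiteFreeResolution hQ
  have h : ExtVanish (ModuleCat.of R (C →ₗ[R] I)) (ModuleCat.of R (F.K 0 →ₗ[R] J)) := by
    intro i hi
    obtain ⟨i, rfl⟩ := Nat.exists_eq_add_of_le' hi
    exact F.subsingleton_ext hC.ext_eq_zero hI hJ i 0
  exact h.of_iso (Iso.refl _)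
    (LinearEquiv.toModuleIso (F.iso.toLinearEquiv.congrLeft J R))

lemma isSelfOrthogonal_cInjective {C : ModuleCat.{u} R} (hC : IsSemidualizing C) :
    IsSelfOrthogonal (CInjective C) where
  of_iso := by
    rintro X Y e ⟨I, hI, ⟨e'⟩⟩
    exact ⟨I, hI, ⟨e.symm ≪≫ e'⟩⟩
  of_isZero {X} hX := by
    refine ⟨ModuleCat.of R PUnit, (ModuleCat.isZero_of_subsingleton _).injective,
      ⟨hX.iso (ModuleCat.isZero_of_subsingleton _)⟩⟩
  prod := by
    rintro X Y ⟨I, hI, ⟨e⟩⟩ ⟨J, hJ, ⟨e'⟩⟩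
    refine ⟨ModuleCat.of R (I × J), Injective.of_iso (ModuleCat.biprodIsoProd I J) inferInstance,
      ⟨LinearEquiv.toModuleIso ((e.toLinearEquiv.prodCongr e'.toLinearEquiv).trans
        (LinearMap.prodEquiv R))⟩⟩
  extVanish := by
    rintro X Y ⟨I, hI, ⟨e⟩⟩ ⟨J, hJ, ⟨e'⟩⟩
    exact (hC.extVanish hI hJ).of_iso e.symm e'.symm

end Semidualizing

/-! ### Transport of the sequence to arbitrary resolution data. -/

section LongExactSequence

variable {R : Type u} [CommRing R] {𝒴 𝒱 : ObjectProperty (ModuleCat.{u} R)}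

lemma ModuleCat.exact_of_ladder {A B C A' B' C' : ModuleCat.{u} R} {f : A ⟶ B} {g : B ⟶ C}
    {f' : A' ⟶ B'} {g' : B' ⟶ C'} (a : A ≅ A') (b : B ≅ B') (c : C ≅ C')
    (h₁ : f ≫ b.hom = a.hom ≫ f') (h₂ : g ≫ c.hom = b.hom ≫ g') (h : Function.Exact f' g') :
    Function.Exact f g := by
  have h₁' (x : A) : b.hom (f x) = f' (a.hom x) := congr($h₁ x)
  have h₂' (x : B) : c.hom (g x) = g' (b.hom x) := congr($h₂ x)
  have hb := (ModuleCat.mono_iff_injective b.hom).1 inferInstance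
  have hc := (ModuleCat.mono_iff_injective c.hom).1 inferInstance
  intro y
  rw [← map_eq_zero_iff c.hom.hom hc]
  refine ((congrArg (· = 0) (h₂' y)).to_iff.trans (h (b.hom y))).trans ⟨?_, ?_⟩
  · rintro ⟨x', hx'⟩
    obtain ⟨x, rfl⟩ := (ModuleCat.epi_iff_surjective a.hom).1 inferInstance x'
    exact ⟨x, hb ((h₁' x).trans hx')⟩
  · rintro ⟨x, rfl⟩
    exact ⟨a.hom x, (h₁' x).symm⟩

namespace ResolutionLift

variable {N N' N'' : ModuleCat.{u} R} {D : ResolutionData 𝒴 𝒱 N} {D' : ResolutionData 𝒴 𝒱 N'}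
  {D'' : ResolutionData 𝒴 𝒱 N''} {g : N ⟶ N'} {g' : N' ⟶ N''} {g'' : N ⟶ N''}

lemma homCohMap_onY_comp (L : ResolutionLift D D' g) (L' : ResolutionLift D' D'' g')
    (L'' : ResolutionLift D D'' g'') (h : g ≫ g' = g'') (M : ModuleCat.{u} R) (n : ℤ) :
    homCohMap M L.onY n ≫ homCohMap M L'.onY n = homCohMap M L''.onY n := by
  subst h
  rw [← homCohMap_comp]
  exact homCohMap_eq_of_homotopy M ((L.comp L').homotopy_onY L'') n

lemma homCohMap_onV_comp (L : ResolutionLift D D' g) (L' : ResolutionLift D' D'' g')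
    (L'' : ResolutionLift D D'' g'') (h : g ≫ g' = g'') (M : ModuleCat.{u} R) (n : ℤ) :
    homCohMap M L.onV n ≫ homCohMap M L'.onV n = homCohMap M L''.onV n := by
  subst h
  rw [← homCohMap_comp]
  exact homCohMap_eq_of_homotopy M ((L.comp L').homotopy_onV L'') n

lemma homCohMap_onS_comp (L : ResolutionLift D D' g) (L' : ResolutionLift D' D'' g')
    (L'' : ResolutionLift D D'' g'') (h : g ≫ g' = g'') (M : ModuleCat.{u} R) (n : ℤ) :
    homCohMap M L.onS n ≫ homCohMap M L'.onS n = homCohMap M L''.onS n := by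
  subst h
  rw [← homCohMap_comp]
  exact homCohMap_eq_of_homotopy M ((L.comp L').homotopy_onS L'') n

lemma ϑ_naturality (h : 𝒱 ≤ 𝒴) (L : ResolutionLift D D' g) (M : ModuleCat.{u} R) (n : ℤ) :
    D.ϑ M n ≫ homCohMap M L.onV n = homCohMap M L.onY n ≫ D'.ϑ M n := by
  rw [← homCohMap_comp, ← homCohMap_comp]
  exact homCohMap_eq_of_homotopy M (L.homotopy_κ h) n

lemma ε_naturality (L : ResolutionLift D D' g) (M : ModuleCat.{u} R) (n : ℤ) :
    D.ε M n ≫ homCohMap M L.onS n = homCohMap M L.onV n ≫ D'.ε M n := by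
  rw [← homCohMap_comp, ← homCohMap_comp]
  exact homCohMap_eq_of_homotopy M L.homotopic n

section Iso

variable {D₁ D₂ : ResolutionData 𝒴 𝒱 N} (L : ResolutionLift D₁ D₂ (𝟙 N))
  (L' : ResolutionLift D₂ D₁ (𝟙 N)) (M : ModuleCat.{u} R) (n : ℤ)

/-- The comparison of `Ext_𝒴` computed from two coresolutions. -/
def isoY : D₁.extY M n ≅ D₂.extY M n where
  hom := homCohMap M L.onY n
  inv := homCohMap M L'.onY n
  hom_inv_id := (L.homCohMap_onY_comp L' (refl D₁) (Category.comp_id _) M n).trans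
    (homCohMap_id M n)
  inv_hom_id := (L'.homCohMap_onY_comp L (refl D₂) (Category.comp_id _) M n).trans
    (homCohMap_id M n)

/-- The comparison of `Ext_𝒱` computed from two coresolutions. -/
def isoV : D₁.extV M n ≅ D₂.extV M n where
  hom := homCohMap M L.onV n
  inv := homCohMap M L'.onV n
  hom_inv_id := (L.homCohMap_onV_comp L' (refl D₁) (Category.comp_id _) M n).trans
    (homCohMap_id M n)
  inv_hom_id := (L'.homCohMap_onV_comp L (refl D₂) (Category.comp_id _) M n).trans
    (homCohMap_id M n)

/-- The comparison of Tate cohomology computed from two Tate coresolutions. -/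
def isoS : D₁.extTate M n ≅ D₂.extTate M n where
  hom := homCohMap M L.onS n
  inv := homCohMap M L'.onS n
  hom_inv_id := (L.homCohMap_onS_comp L' (refl D₁) (Category.comp_id _) M n).trans
    (homCohMap_id M n)
  inv_hom_id := (L'.homCohMap_onS_comp L (refl D₂) (Category.comp_id _) M n).trans
    (homCohMap_id M n)

end Iso

end ResolutionLift

variable (h𝒱 : IsSelfOrthogonal 𝒱) {N N' : ModuleCat.{u} R}

include h𝒱 in
lemma exists_approximationData (hN : injDim (GorensteinClass 𝒱) N < ⊤) :
    ∃ d, Nonempty (ApproximationData 𝒱 N d) :=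
  ⟨_, ApproximationData.nonempty h𝒱 (ENat.natCast_toNat hN.ne).symm⟩

/-- A choice of approximation data of a module of finite Gorenstein dimension. -/
def approximationData (hN : injDim (GorensteinClass 𝒱) N < ⊤) :
    ApproximationData 𝒱 N (exists_approximationData h𝒱 hN).choose :=
  (exists_approximationData h𝒱 hN).choose_spec.some

/-- The resolutions provided by the approximation data. -/
def approximationResolution (hN : injDim (GorensteinClass 𝒱) N < ⊤) :
    ResolutionData (GorensteinClass 𝒱) 𝒱 N :=
  (approximationData h𝒱 hN).data h𝒱

/-- The connecting map for the resolutions provided by the approximation data. -/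
def approximationδ (hN : injDim (GorensteinClass 𝒱) N < ⊤) (M : ModuleCat.{u} R) (n : ℤ) :
    (approximationResolution h𝒱 hN).extTate M n ⟶ (approximationResolution h𝒱 hN).extY M (n + 1) :=
  (approximationData h𝒱 hN).δ M n

lemma approximationδ_comap (hN : injDim (GorensteinClass 𝒱) N < ⊤) {M M' : ModuleCat.{u} R}
    (f : M ⟶ M') {n : ℤ} (hn : 1 ≤ n) :
    approximationδ h𝒱 hN M' n ≫ homCohComap f (approximationResolution h𝒱 hN).Y.cx (n + 1) =
      homCohComap f (approximationResolution h𝒱 hN).T.S n ≫ approximationδ h𝒱 hN M n :=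
  (approximationData h𝒱 hN).δ_comap f hn

lemma exists_lift_approximationδ (hN : injDim (GorensteinClass 𝒱) N < ⊤)
    (hN' : injDim (GorensteinClass 𝒱) N' < ⊤) (g : N ⟶ N') :
    ∃ L : ResolutionLift (approximationResolution h𝒱 hN) (approximationResolution h𝒱 hN') g,
      ∀ (M : ModuleCat.{u} R) (n : ℤ), 1 ≤ n →
        approximationδ h𝒱 hN M n ≫ homCohMap M L.onY (n + 1) =
          homCohMap M L.onS n ≫ approximationδ h𝒱 hN' M n :=
  (approximationData h𝒱 hN).exists_lift h𝒱 (approximationData h𝒱 hN') g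

namespace ResolutionData

/-- The comparison with the resolutions provided by the approximation data. -/
def toApproximation (hN : injDim (GorensteinClass 𝒱) N < ⊤)
    (D : ResolutionData (GorensteinClass 𝒱) 𝒱 N) :
    ResolutionLift D (approximationResolution h𝒱 hN) (𝟙 N) :=
  (ResolutionLift.nonempty _ _ _).some

/-- The comparison with the resolutions provided by the approximation data. -/
def fromApproximation (hN : injDim (GorensteinClass 𝒱) N < ⊤)
    (D : ResolutionData (GorensteinClass 𝒱) 𝒱 N) :
    ResolutionLift (approximationResolution h𝒱 hN) D (𝟙 N) :=
  (ResolutionLift.nonempty _ _ _).some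

open Classical in
/-- The connecting maps from Tate cohomology to relative cohomology. They are zero if the
Gorenstein dimension is infinite. -/
def δ (D : ResolutionData (GorensteinClass 𝒱) 𝒱 N) (M : ModuleCat.{u} R) (n : ℤ) :
    D.extTate M n ⟶ D.extY M (n + 1) :=
  if hN : injDim (GorensteinClass 𝒱) N < ⊤ then
    homCohMap M (D.toApproximation h𝒱 hN).onS n ≫ approximationδ h𝒱 hN M n ≫
      homCohMap M (D.fromApproximation h𝒱 hN).onY (n + 1)
  else 0

lemma δ_eq (hN : injDim (GorensteinClass 𝒱) N < ⊤) (D : ResolutionData (GorensteinClass 𝒱) 𝒱 N)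
    (M : ModuleCat.{u} R) (n : ℤ) : D.δ h𝒱 M n =
      homCohMap M (D.toApproximation h𝒱 hN).onS n ≫ approximationδ h𝒱 hN M n ≫
        homCohMap M (D.fromApproximation h𝒱 hN).onY (n + 1) :=
  dif_pos hN

lemma δ_comap (hN : injDim (GorensteinClass 𝒱) N < ⊤)
    (D : ResolutionData (GorensteinClass 𝒱) 𝒱 N) {M M' : ModuleCat.{u} R} (f : M ⟶ M') {n : ℤ}
    (hn : 1 ≤ n) : D.δ h𝒱 M' n ≫ homCohComap f D.Y.cx (n + 1) =
      homCohComap f D.T.S n ≫ D.δ h𝒱 M n := by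
  have h := approximationδ_comap h𝒱 hN f hn
  have h₁ := homCohMap_comp_homCohComap f (D.fromApproximation h𝒱 hN).onY (n + 1)
  have h₂ := homCohMap_comp_homCohComap f (D.toApproximation h𝒱 hN).onS n
  rw [δ_eq h𝒱 hN, δ_eq h𝒱 hN, Category.assoc, Category.assoc, h₁, reassoc_of% h, reassoc_of% h₂]

/-- On cohomology all lifts of a given homomorphism agree. Inserting the special lift `L₀` between
approximations, which commutes with the connecting maps, thus reduces the claim for an arbitrary `L`
to that of `L₀`. -/
lemma δ_naturality (hN : injDim (GorensteinClass 𝒱) N < ⊤)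
    (hN' : injDim (GorensteinClass 𝒱) N' < ⊤) {D : ResolutionData (GorensteinClass 𝒱) 𝒱 N}
    {D' : ResolutionData (GorensteinClass 𝒱) 𝒱 N'} {g : N ⟶ N'} (L : ResolutionLift D D' g)
    (M : ModuleCat.{u} R) {n : ℤ} (hn : 1 ≤ n) :
    D.δ h𝒱 M n ≫ homCohMap M L.onY (n + 1) = homCohMap M L.onS n ≫ D'.δ h𝒱 M n := by
  obtain ⟨L₀, h₀⟩ := exists_lift_approximationδ h𝒱 hN hN' g
  obtain ⟨A⟩ := ResolutionLift.nonempty D (approximationResolution h𝒱 hN') g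
  obtain ⟨B⟩ := ResolutionLift.nonempty (approximationResolution h𝒱 hN) D' g
  have h₁ := (D.fromApproximation h𝒱 hN).homCohMap_onY_comp L B (Category.id_comp g) M (n + 1)
  have h₂ := L₀.homCohMap_onY_comp (D'.fromApproximation h𝒱 hN') B (Category.comp_id g) M (n + 1)
  have h₃ := L.homCohMap_onS_comp (D'.toApproximation h𝒱 hN') A (Category.comp_id g) M n
  have h₄ := (D.toApproximation h𝒱 hN).homCohMap_onS_comp L₀ A (Category.id_comp g) M n
  rw [δ_eq h𝒱 hN, δ_eq h𝒱 hN', Category.assoc, Category.assoc, h₁, ← h₂,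
    reassoc_of% (h₀ M n hn), reassoc_of% h₄, reassoc_of% h₃]

section Exactness

variable (hN : injDim (GorensteinClass 𝒱) N < ⊤) (D : ResolutionData (GorensteinClass 𝒱) 𝒱 N)
  (M : ModuleCat.{u} R)

include h𝒱 hN

lemma ϑ_injective : Function.Injective (D.ϑ M 1) := by
  have h := (D.toApproximation h𝒱 hN).ϑ_naturality h𝒱.le_gorensteinClass M 1
  have hY := (ModuleCat.mono_iff_injective ((D.toApproximation h𝒱 hN).isoY
    (D.fromApproximation h𝒱 hN) M 1).hom).1 inferInstance
  have hE := (approximationData h𝒱 hN).θ_injective M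
  refine Function.Injective.of_comp (f := homCohMap M (D.toApproximation h𝒱 hN).onV 1) ?_
  have : ⇑(homCohMap M (D.toApproximation h𝒱 hN).onV 1) ∘ ⇑(D.ϑ M 1) =
      (approximationData h𝒱 hN).θ M 1 ∘ ((D.toApproximation h𝒱 hN).isoY
        (D.fromApproximation h𝒱 hN) M 1).hom := funext fun x => congr($h x)
  rw [this]
  exact hE.comp hY

lemma exact_ϑ_ε {n : ℤ} (hn : 1 ≤ n) : Function.Exact (D.ϑ M n) (D.ε M n) :=
  ModuleCat.exact_of_ladder
    ((D.toApproximation h𝒱 hN).isoY (D.fromApproximation h𝒱 hN) M n)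
    ((D.toApproximation h𝒱 hN).isoV (D.fromApproximation h𝒱 hN) M n)
    ((D.toApproximation h𝒱 hN).isoS (D.fromApproximation h𝒱 hN) M n)
    ((D.toApproximation h𝒱 hN).ϑ_naturality h𝒱.le_gorensteinClass M n)
    ((D.toApproximation h𝒱 hN).ε_naturality M n)
    ((approximationData h𝒱 hN).exact_θ_η M hn)

/-- The square that puts `δ` into the ladders comparing the sequence of `D` with that of the
approximation. -/
lemma δ_comp_isoY (n : ℤ) : D.δ h𝒱 M n ≫
    ((D.toApproximation h𝒱 hN).isoY (D.fromApproximation h𝒱 hN) M (n + 1)).hom =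
    ((D.toApproximation h𝒱 hN).isoS (D.fromApproximation h𝒱 hN) M n).hom ≫
      approximationδ h𝒱 hN M n := by
  have h := ((D.toApproximation h𝒱 hN).isoY (D.fromApproximation h𝒱 hN) M (n + 1)).inv_hom_id
  rw [δ_eq h𝒱 hN, Category.assoc, Category.assoc]
  exact congrArg (fun k => _ ≫ _ ≫ k) h |>.trans (by rw [Category.comp_id]; rfl)

lemma exact_ε_δ {n : ℤ} (hn : 1 ≤ n) : Function.Exact (D.ε M n) (D.δ h𝒱 M n) :=
  ModuleCat.exact_of_ladder
    ((D.toApproximation h𝒱 hN).isoV (D.fromApproximation h𝒱 hN) M n)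
    ((D.toApproximation h𝒱 hN).isoS (D.fromApproximation h𝒱 hN) M n)
    ((D.toApproximation h𝒱 hN).isoY (D.fromApproximation h𝒱 hN) M (n + 1))
    ((D.toApproximation h𝒱 hN).ε_naturality M n) (D.δ_comp_isoY h𝒱 hN M n)
    ((approximationData h𝒱 hN).exact_η_δ M hn)

lemma exact_δ_ϑ {n : ℤ} (hn : 1 ≤ n) : Function.Exact (D.δ h𝒱 M n) (D.ϑ M (n + 1)) :=
  ModuleCat.exact_of_ladder
    ((D.toApproximation h𝒱 hN).isoS (D.fromApproximation h𝒱 hN) M n)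
    ((D.toApproximation h𝒱 hN).isoY (D.fromApproximation h𝒱 hN) M (n + 1))
    ((D.toApproximation h𝒱 hN).isoV (D.fromApproximation h𝒱 hN) M (n + 1))
    (D.δ_comp_isoY h𝒱 hN M n)
    ((D.toApproximation h𝒱 hN).ϑ_naturality h𝒱.le_gorensteinClass M (n + 1))
    ((approximationData h𝒱 hN).exact_δ_θ M hn)

end Exactness

include h𝒱

/-- The given proper coresolution may be unbounded, but its cohomology is that of an approximation
of length `d`. -/
lemma subsingleton_extY {d : ℕ} (hN : injDim (GorensteinClass 𝒱) N = d)
    (D : ResolutionData (GorensteinClass 𝒱) 𝒱 N) (M : ModuleCat.{u} R) {n : ℤ} (hn : d < n) :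
    Subsingleton (D.extY M n) := by
  obtain ⟨E⟩ := ApproximationData.nonempty h𝒱 hN
  obtain ⟨L⟩ := ResolutionLift.nonempty D (E.data h𝒱) (𝟙 N)
  obtain ⟨L'⟩ := ResolutionLift.nonempty (E.data h𝒱) D (𝟙 N)
  have : Subsingleton ((E.data h𝒱).extY M n) := E.subsingleton_extY M hn
  exact (L.isoY L' M n).toLinearEquiv.toEquiv.subsingleton

lemma ε_injective {d : ℕ} (hN : injDim (GorensteinClass 𝒱) N = d)
    (D : ResolutionData (GorensteinClass 𝒱) 𝒱 N) (M : ModuleCat.{u} R) {n : ℤ} (hn : d < n) :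
    Function.Injective (D.ε M n) := by
  have := D.subsingleton_extY h𝒱 hN M hn
  refine (injective_iff_map_eq_zero (D.ε M n).hom).2 fun x hx => ?_
  obtain ⟨y, rfl⟩ := (D.exact_ϑ_ε h𝒱 (hN ▸ ENat.natCast_lt_top d) M (by omega) x).1 hx
  rw [Subsingleton.elim y 0]
  exact map_zero (D.ϑ M n).hom

/-- The map `δ` in degree `n` has its target in degree `n + 1 > d`, where it vanishes. The case `n =
d` ends the sequence; the cases `n > d` belong to the isomorphisms. -/
lemma ε_surjective {d : ℕ} (hN : injDim (GorensteinClass 𝒱) N = d)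
    (D : ResolutionData (GorensteinClass 𝒱) 𝒱 N) (M : ModuleCat.{u} R) {n : ℤ} (h1 : 1 ≤ n)
    (hn : d ≤ n) : Function.Surjective (D.ε M n) := by
  have := D.subsingleton_extY h𝒱 hN M (n := n + 1) (by omega)
  exact fun x => (D.exact_ε_δ h𝒱 (hN ▸ ENat.natCast_lt_top d) M h1 x).1 (Subsingleton.elim _ _)

end ResolutionData

end LongExactSequence

end

theorem corollary4p13 {R : Type u} [CommRing R] (C : ModuleCat.{u} R) (hC : IsSemidualizing C) :
    -- the resolutions that define the cohomology modules exist when the dimension is finite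
    (∀ N : ModuleCat.{u} R, injDim (GorensteinClass (CInjective C)) N < ⊤ →
      Nonempty (ResolutionData (GorensteinClass (CInjective C)) (CInjective C) N)) ∧
    -- homomorphisms lift to any such resolutions
    (∀ (N N' : ModuleCat.{u} R)
      (D : ResolutionData (GorensteinClass (CInjective C)) (CInjective C) N)
      (D' : ResolutionData (GorensteinClass (CInjective C)) (CInjective C) N')
      (g : N ⟶ N'), Nonempty (ResolutionLift D D' g)) ∧
    -- the long exact sequence, with connecting maps `δ`
    ∃ δ : ∀ (N : ModuleCat.{u} R)
        (D : ResolutionData (GorensteinClass (CInjective C)) (CInjective C) N)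
        (M : ModuleCat.{u} R) (n : ℤ), D.extTate M n ⟶ D.extY M (n + 1),
      -- exactness, and the isomorphisms in degrees above the dimension
      (∀ (N : ModuleCat.{u} R) (d : ℕ), injDim (GorensteinClass (CInjective C)) N = d →
        ∀ (D : ResolutionData (GorensteinClass (CInjective C)) (CInjective C) N)
          (M : ModuleCat.{u} R),
          (1 ≤ d → Function.Injective (D.ϑ M 1)) ∧
          (∀ n : ℤ, 1 ≤ n → n ≤ d → Function.Exact (D.ϑ M n) (D.ε M n)) ∧
          (∀ n : ℤ, 1 ≤ n → n < d → Function.Exact (D.ε M n) (δ N D M n)) ∧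
          (∀ n : ℤ, 1 ≤ n → n < d → Function.Exact (δ N D M n) (D.ϑ M (n + 1))) ∧
          (1 ≤ d → Function.Surjective (D.ε M d)) ∧
          (∀ n : ℤ, d < n → Function.Bijective (D.ε M n))) ∧
      -- naturality in `M`
      (∀ (N : ModuleCat.{u} R), injDim (GorensteinClass (CInjective C)) N < ⊤ →
        ∀ (D : ResolutionData (GorensteinClass (CInjective C)) (CInjective C) N)
          (M M' : ModuleCat.{u} R) (f : M ⟶ M') (n : ℤ), 1 ≤ n →
          D.ϑ M' n ≫ homCohComap f D.T.V.cx n = homCohComap f D.Y.cx n ≫ D.ϑ M n ∧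
          D.ε M' n ≫ homCohComap f D.T.S n = homCohComap f D.T.V.cx n ≫ D.ε M n ∧
          δ N D M' n ≫ homCohComap f D.Y.cx (n + 1) = homCohComap f D.T.S n ≫ δ N D M n) ∧
      -- naturality in `N`, for all choices of resolutions and lifts
      (∀ (N N' : ModuleCat.{u} R), injDim (GorensteinClass (CInjective C)) N < ⊤ →
        injDim (GorensteinClass (CInjective C)) N' < ⊤ →
        ∀ (D : ResolutionData (GorensteinClass (CInjective C)) (CInjective C) N)
          (D' : ResolutionData (GorensteinClass (CInjective C)) (CInjective C) N')
          (g : N ⟶ N') (L : ResolutionLift D D' g) (M : ModuleCat.{u} R) (n : ℤ), 1 ≤ n →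
          D.ϑ M n ≫ homCohMap M L.onV n = homCohMap M L.onY n ≫ D'.ϑ M n ∧
          D.ε M n ≫ homCohMap M L.onS n = homCohMap M L.onV n ≫ D'.ε M n ∧
          δ N D M n ≫ homCohMap M L.onY (n + 1) = homCohMap M L.onS n ≫ δ N' D' M n) := by
  have h := isSelfOrthogonal_cInjective hC
  refine ⟨fun N hN => ⟨approximationResolution h hN⟩,
    fun N N' D D' g => ResolutionLift.nonempty D D' g, fun N D M n => D.δ h M n, ?_, ?_, ?_⟩
  · intro N d hd D M
    have hN : injDim (GorensteinClass (CInjective C)) N < ⊤ := hd ▸ ENat.natCast_lt_top d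
    exact ⟨fun _ => D.ϑ_injective h hN M, fun n hn _ => D.exact_ϑ_ε h hN M hn,
      fun n hn _ => D.exact_ε_δ h hN M hn, fun n hn _ => D.exact_δ_ϑ h hN M hn,
      fun h1 => D.ε_surjective h hd M (by exact_mod_cast h1) le_rfl,
      fun n hn => ⟨D.ε_injective h hd M hn, D.ε_surjective h hd M (by omega) hn.le⟩⟩
  · intro N hN D M M' f n hn
    exact ⟨homCohMap_comp_homCohComap f D.κ n, homCohMap_comp_homCohComap f D.T.β n,
      D.δ_comap h hN f hn⟩
  · intro N N' hN hN' D D' g L M n hn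
    exact ⟨L.ϑ_naturality h.le_gorensteinClass M n, L.ε_naturality M n,
      ResolutionData.δ_naturality h hN hN' L M hn⟩
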